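/- **Setting.** All registers are finite-dimensional; $\lambda\in\mathbb N$ is the security parameter and every object below is a family indexed by $\lambda$. A *two-party functionality* $f$ has finite non-empty input sets and finite output sets for Alice and Bob, the outputs being extended by an abort symbol $\bot$. $\mathrm{IDEAL}(f)$ takes classical inputs $a,b$, draws $(o_A,o_B)$ from a distribution $f(a,b)$, gives $o_A$ to Alice, lets her send an abort signal, and gives Bob $\bot$ if she aborts and $o_B$ otherwise (an honest Alice does not send the signal). A *device* is a bipartite state $\rho$ shared by Alice and Bob, with, for each party and each classical input to that party's port, a measurement of that party's share with classical output. A *protocol* $\mathcal P_f$ for $f$ consists of a public schedule of classical messages between Alice and Bob and instructions for the honest parties, each of which starts with its classical input, keeps its own (possibly quantum) memory, uses its share of a device $\mathsf D_f$ only through classical inputs and outputs, and finally produces a classical output. An *oracle-aided protocol* $\mathcal P_{g|f}$ for $g$ uses a device $\mathsf D_g$ and moreover makes a sequence of calls to $\mathrm{IDEAL}(f)$, one after the other, between phases of classical communication; instead of making a call an honest party may abort, in which case it takes no further part and outputs $\bot$. $\mathcal P_g$ is the protocol obtained from $\mathcal P_{g|f}$ by replacing each call to $\mathrm{IDEAL}(f)$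 by an execution of $\mathcal P_f$ on the same inputs, with a new device for $\mathcal P_f$, in a product state with everything else, delivered at the beginning of that execution. **Augmented security.** Let $\mathfrak D^*$ be a class of devices. Suppose one party is honest and the other one cheats; say Bob, with classical input register $B$, is honest (the other case is the same with the parties exchanged). The cheating party $\mathsf{Alice}^*$ may apply arbitrary quantum operations to her registers, her shares of the devices included, but communicates classically. The initial state is $\eta=\rho^*\otimes\varphi^*$, where $\rho^*$ is the state of the devices $\mathsf D^*\in\mathfrak D^*$ and $\varphi^*$ is an arbitrary state of $\mathsf{Alice}^*$'s other registers (her input among them) and $B$; let $R$ be the purifying register of the canonical purification of $\eta$, to which no party has access. Let $\tau_{\mathcal P}$ be the final state of the protocol on $\mathsf{Alice}^*$'s final registers $\widehat A O_A$, Bob's output $O_B$, $B$ and $R$. A *simulator* $\mathrm{Sim}$, which may depend on $\mathsf{Alice}^*,\mathsf D^*,\varphi^*$, starts with $\mathsf{Alice}^*$'s registers of the same purified state (including her shares of all devices) and takes the part of Alice in one invocation of the ideal functionality, by arbitrary quantum operations, while Bob gives it his input $B$ and outputs what he receives; $\tau_{\mathrm{Sim}}$ is the resulting final state on the same registers. The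 protocol is *augmented-secure against* $\mathfrak D^*$ if, whichever party is honest, for all cheating strategies, all devices $\mathsf D^*\in\mathfrak D^*$ and all $\varphi^*$ there is a simulator such that $$\bigl\|\tau_{\mathrm{Sim}}^{\widehat A O_A O_B B R}-\tau_{\mathcal P}^{\widehat A O_A O_B B R}\bigr\|_1\le \mathsf{negl}(\lambda).$$ For $\mathcal P_{g|f}$ the cheating party interacts with $\mathrm{IDEAL}(f)$ at each call. **Theorem (sequential composition).** Let $\mathcal P_{g|f}$ make at most polynomially many (in $\lambda$) calls to $\mathrm{IDEAL}(f)$. If $\mathcal P_{g|f}$ is augmented-secure against a class of devices $\mathfrak D_g$, and $\mathcal P_f$ is augmented-secure against a non-empty class of devices $\mathfrak D_f$, then $\mathcal P_g$ is augmented-secure against the class of all families of devices whose device for the main part is in $\mathfrak D_g$ and whose device for each execution of $\mathcal P_f$ is in $\mathfrak D_f$. -/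

import Mathlib

open scoped Matrix Kronecker MatrixOrder ComplexOrder

namespace QComp

/-! ### Finite quantum registers, states and operations -/

/-- A register: a non-empty finite set of basis labels. The same type serves for classical
alphabets, which are read in the computational basis. -/
structure Reg where
  carrier : Type
  [fintype : Fintype carrier]
  [decEq : DecidableEq carrier]
  [nonempty : Nonempty carrier]

instance : CoeSort Reg Type := ⟨Reg.carrier⟩

attribute [instance] Reg.fintype Reg.decEq Reg.nonempty

/-- The one-dimensional register. -/
abbrev Reg.unit : Reg := ⟨Unit⟩

/-- The joint register. -/
abbrev Reg.prod (A B : Reg) : Reg := ⟨A × B⟩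

/-- Operators on the Hilbert space with orthonormal basis `X`. -/
abbrev Mat (X : Type) := Matrix X X ℂ

/-- Density operators. -/
structure IsDensity {X : Type} [Fintype X] (ρ : Mat X) : Prop where
  posSemidef : ρ.PosSemidef
  trace_eq_one : ρ.trace = 1

/-- The trace norm `‖A‖₁ = Tr √(A† A)`, the sum of the singular values. -/
noncomputable def traceNorm {X : Type} [Fintype X] [DecidableEq X] (A : Mat X) : ℝ :=
  ∑ i, Real.sqrt ((Matrix.isHermitian_conjTranspose_mul_self A).eigenvalues i)

/-- The canonical purification `∑ₓ (√η |x⟩) ⊗ |x⟩` of `η`, as a rank-one operator on the register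
of `η` and a copy `R` of it. -/
noncomputable def purify {X : Type} [Fintype X] [DecidableEq X] (η : Mat X) : Mat (X × X) :=
  Matrix.vecMulVec (fun i => CFC.sqrt η i.1 i.2) (star fun i => CFC.sqrt η i.1 i.2)

/-- A quantum instrument from register `A` to register `B` with classical outcome in `M`: for every
outcome a completely positive map in Kraus form, the sum being trace preserving. -/
structure Instrument (A B : Reg) (M : Type) [Fintype M] where
  n : ℕ
  K : M → Fin n → Matrix B A ℂ
  trace_preserving : ∑ m, ∑ k, (K m k)ᴴ * K m k = 1

/-- A quantum channel (completely positive trace-preserving map). -/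
abbrev Channel (A B : Reg) := Instrument A B Unit

section Actions

variable {A A' B B' C C' : Reg} {X : Type} [Fintype X] [DecidableEq X] {M : Type} [Fintype M]

/-- The branch `m` of `I` applied to the first register (unnormalised). -/
noncomputable def Instrument.act₁ (I : Instrument A A' M) (m : M) (ρ : Mat (A × X)) :
    Mat (A' × X) :=
  ∑ k, (I.K m k ⊗ₖ (1 : Mat X)) * ρ * (I.K m k ⊗ₖ (1 : Mat X))ᴴ

/-- The branch `m` of `I` applied to the second register (unnormalised). -/
noncomputable def Instrument.act₂ (I : Instrument B B' M) (m : M) (ρ : Mat (A × B × X)) :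
    Mat (A × B' × X) :=
  ∑ k, ((1 : Mat A) ⊗ₖ (I.K m k ⊗ₖ (1 : Mat X))) * ρ *
    ((1 : Mat A) ⊗ₖ (I.K m k ⊗ₖ (1 : Mat X)))ᴴ

/-- The branch `m` of `I` applied to the third register (unnormalised). -/
noncomputable def Instrument.act₃ (I : Instrument C C' M) (m : M) (ρ : Mat (A × B × C × X)) :
    Mat (A × B × C' × X) :=
  ∑ k, ((1 : Mat A) ⊗ₖ ((1 : Mat B) ⊗ₖ (I.K m k ⊗ₖ (1 : Mat X)))) * ρ *
    ((1 : Mat A) ⊗ₖ ((1 : Mat B) ⊗ₖ (I.K m k ⊗ₖ (1 : Mat X))))ᴴ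

end Actions

/-- Partial trace over the second of three registers. -/
noncomputable def trace₂ {Y Z X : Type} [Fintype Z] (ρ : Mat (Y × Z × X)) : Mat (Y × X) :=
  Matrix.of fun i j => ∑ z, ρ (i.1, z, i.2) (j.1, z, j.2)

/-! ### Parties, functionalities and devices -/

/-- The two parties. -/
inductive Party
  | alice
  | bob
  deriving DecidableEq

/-- The other party. -/
def Party.other : Party → Party
  | .alice => .bob
  | .bob => .alice

/-- A (possibly randomised) two-party functionality with finite input sets `In` and output sets
`Out`, to which the abort symbol `⊥` is adjoined as `none`. On inputs `a`, `b` it draws the pair of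
outputs of Alice and Bob from `dist a b`; Bob's output is replaced by `⊥` if Alice, after having
seen her output, sends the abort signal. -/
structure Functionality where
  In : Party → Reg
  Out : Party → Reg
  dist : In .alice → In .bob → PMF (Option (Out .alice) × Option (Out .bob))

/-- The classical interface of a device: for each party, the alphabets of the inputs that the party
may give and of the outputs that it gets. (For a device that consists of several boxes, an input
names the box as well.) -/
structure Ports where
  X : Party → Reg
  O : Party → Reg

/-- A quantum device shared by the two parties: a bipartite state and, for each party and each
classical input `x`, a measurement `{Λˣₒ}` on that party's share with classical output `o`, given
together with its post-measurement states, so that a port can be used several times. -/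
structure Device (P : Ports) where
  reg : Party → Reg
  state : Mat (reg .alice × reg .bob)
  isDensity : IsDensity state
  use : (p : Party) → P.X p → Instrument (reg p) (reg p) (P.O p)

/-- A bipartite operator, rearranged so that the register of `p` comes second. -/
def viewFor {reg : Party → Reg} (ρ : Mat (reg .alice × reg .bob)) :
    (p : Party) → Mat (reg p.other × reg p)
  | .bob => ρ
  | .alice => ρ.submatrix Prod.swap Prod.swap

/-! ### Interactive computation with classical communication -/

/-- The schedule of a classical communication phase, seen by one party: it sends or receives a
message from the alphabet `M`, and so on. -/
inductive Sched : Type 1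
  | done : Sched
  | send (M : Reg) (s : Sched) : Sched
  | recv (M : Reg) (s : Sched) : Sched

/-- The same schedule seen by the other party. -/
def Sched.flip : Sched → Sched
  | .done => .done
  | .send M s => .recv M s.flip
  | .recv M s => .send M s.flip

/-- A schedule that is written down as Bob sees it, as `p` sees it. -/
def Sched.view (s : Sched) : Party → Sched
  | .bob => s
  | .alice => s.flip

/-- The instructions of an honest party for a communication phase, from its memory register `W` at
the beginning to its memory register at the end. It accesses its device only by classical inputs
(alphabet `X`) and outputs (alphabet `O`). -/
inductive Code (X O : Reg) : Sched → Reg → Reg → Type 1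
  | done {W : Reg} : Code X O .done W W
  | query {s : Sched} {W W₁ W₂ V : Reg} (input : Instrument W W₁ X) (output : O → Channel W₁ W₂)
      (rest : Code X O s W₂ V) : Code X O s W V
  | send {M : Reg} {s : Sched} {W W₁ V : Reg} (msg : Instrument W W₁ M)
      (rest : Code X O s W₁ V) : Code X O (.send M s) W V
  | recv {M : Reg} {s : Sched} {W W₁ V : Reg} (process : M → Channel W W₁)
      (rest : Code X O s W₁ V) : Code X O (.recv M s) W V

/-- The strategy of a cheating party against an honest party that follows the given schedule (as
the honest party sees it): arbitrary quantum operations on all registers the cheating party holds,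
its shares of the devices included; only the communication is classical. -/
inductive Cheat : Sched → Reg → Reg → Type 1
  | done {A : Reg} : Cheat .done A A
  | send {M : Reg} {s : Sched} {A A₁ V : Reg} (process : M → Channel A A₁)
      (rest : Cheat s A₁ V) : Cheat (.send M s) A V
  | recv {M : Reg} {s : Sched} {A A₁ V : Reg} (msg : Instrument A A₁ M)
      (rest : Cheat s A₁ V) : Cheat (.recv M s) A V

/-- A communication phase between the honest party `p`, using the device `D`, and a cheating party.
The registers are, in this order: cheating party, memory of `p`, device share of `p`, rest. -/
noncomputable def runCode {P : Ports} (D : Device P) (p : Party)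
    {X : Type} [Fintype X] [DecidableEq X] :
    {s : Sched} → {A A' W W' : Reg} → Code (P.X p) (P.O p) s W W' → Cheat s A A' →
      Mat (A × W × D.reg p × X) → Mat (A' × W' × D.reg p × X)
  | _, _, _, _, _, .done, .done, ρ => ρ
  | _, _, _, _, _, .query input output rest, adv, ρ =>
      runCode D p rest adv
        (∑ x, ∑ o, (output o).act₂ () ((D.use p x).act₃ o (input.act₂ x ρ)))
  | _, _, _, _, _, .send msg rest, .send process adv, ρ =>
      runCode D p rest adv (∑ m, (process m).act₁ () (msg.act₂ m ρ))
  | _, _, _, _, _, .recv process rest, .recv msg adv, ρ =>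
      runCode D p rest adv (∑ m, (process m).act₂ () (msg.act₁ m ρ))

/-- A last phase of an honest party: a communication phase, and a measurement of the memory that
determines the classical output (`none` is `⊥`). -/
structure LastPhase (X O : Reg) (s : Sched) (W Out : Reg) where
  W' : Reg
  code : Code X O s W W'
  output : Instrument W' .unit (Option Out)

/-- The unnormalised states after a last phase, for every output of the honest party; the memory
and the device share of the honest party are traced out. -/
noncomputable def runLast {P : Ports} (D : Device P) (p : Party)
    {X : Type} [Fintype X] [DecidableEq X] {s : Sched} {A A' W Out : Reg}
    (L : LastPhase (P.X p) (P.O p) s W Out) (adv : Cheat s A A')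
    (ρ : Mat (A × W × D.reg p × X)) (o : Option Out) : Mat (A' × X) :=
  trace₂ (trace₂ (L.output.act₂ o (runCode D p L.code adv ρ)))

/-! ### The ideal functionality -/

/-- The strategy of a cheating party in an interaction with `IDEAL(f)`, indexed by the party that
is honest. A cheating Alice chooses her input, receives her output, and decides whether to send the
abort signal (`true`); a cheating Bob chooses his input and receives his output. -/
inductive IdealCheat (f : Functionality) : Party → Reg → Reg → Type 1
  | alice {A A₁ V : Reg} (input : Instrument A A₁ (f.In .alice))
      (abort : Option (f.Out .alice) → Instrument A₁ V Bool) : IdealCheat f .bob A V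
  | bob {A A₁ V : Reg} (input : Instrument A A₁ (f.In .bob))
      (process : Option (f.Out .bob) → Channel A₁ V) : IdealCheat f .alice A V

/-- One invocation of `IDEAL(f)`, where the honest party `p` has input `x`: the unnormalised states
for every output of the honest party. An honest Alice does not send the abort signal. -/
noncomputable def runIdeal (f : Functionality) {X : Type} [Fintype X] [DecidableEq X] :
    {p : Party} → {A V : Reg} → (x : f.In p) → IdealCheat f p A V → Mat (A × X) →
      Option (f.Out p) → Mat (V × X)
  | _, _, _, x, .alice input abort, ρ, o =>
      ∑ a : f.In .alice, ∑ oA : Option (f.Out .alice), ∑ oB : Option (f.Out .bob), ∑ c : Bool,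
        if (if c then none else oB) = o then
          ((f.dist a x (oA, oB)).toReal : ℂ) • (abort oA).act₁ c (input.act₁ a ρ)
        else 0
  | _, _, _, x, .bob input process, ρ, o =>
      ∑ b : f.In .bob, ∑ oB : Option (f.Out .bob),
        ((f.dist x b (o, oB)).toReal : ℂ) • (process oB).act₁ () (input.act₁ b ρ)

/-! ### Protocols -/

/-- A protocol for `f` without oracle calls. The schedule is written as Bob sees it. An honest party
`p` reads its input and then follows `prog p`, beginning with no further memory. -/
structure PlainProtocol (f : Functionality) where
  ports : Ports
  sched : Sched
  prog : (p : Party) → f.In p → LastPhase (ports.X p) (ports.O p) (sched.view p) .unit (f.Out p)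

/-- The sequence of communication phases of an oracle-aided protocol (as Bob sees them), with a call
to the oracle between any two consecutive phases. -/
inductive Shape : Type 1
  | last (s : Sched) : Shape
  | call (s : Sched) (rest : Shape) : Shape

/-- The number of oracle calls. -/
def Shape.numCalls : Shape → ℕ
  | .last _ => 0
  | .call _ rest => rest.numCalls + 1

/-- The instructions of the honest party `p` in a protocol with oracle calls to `f`. At a call, the
party determines its input from its memory, and processes the output that it gets. It may also
abort (`none`) instead of making the call: it then takes no further part and has output `⊥`. -/
inductive Prog (f : Functionality) (P : Ports) (p : Party) (Out : Reg) : Shape → Reg → Type 1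
  | last {s : Sched} {W : Reg} (L : LastPhase (P.X p) (P.O p) (s.view p) W Out) :
      Prog f P p Out (.last s) W
  | call {s : Sched} {sh : Shape} {W W₁ W₂ W₃ : Reg} (code : Code (P.X p) (P.O p) (s.view p) W W₁)
      (input : Instrument W₁ W₂ (Option (f.In p)))
      (process : Option (f.Out p) → Channel W₂ W₃)
      (rest : Prog f P p Out sh W₃) : Prog f P p Out (.call s sh) W

/-- A protocol for `g` with oracle calls to `f`: what the oracle calls are answered by is left
open. -/
structure OracleProtocol (f g : Functionality) where
  ports : Ports
  shape : Shape
  prog : (p : Party) → g.In p → Prog f ports p (g.Out p) shape .unit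

/-- What answers a call to `f`: the ideal functionality, or an execution of a protocol for `f`. -/
inductive Resource (f : Functionality) : Type 1
  | ideal : Resource f
  | run (P : PlainProtocol f) : Resource f

/-- A protocol for `g`: an oracle-aided protocol together with what answers its calls. -/
structure Protocol (g : Functionality) where
  f : Functionality
  oracle : OracleProtocol f g
  resource : Resource f

/-- The oracle-aided protocol `P_{g|f}` itself, with calls to `IDEAL(f)`. -/
def OracleProtocol.aided {f g : Functionality} (Q : OracleProtocol f g) : Protocol g :=
  ⟨f, Q, .ideal⟩

/-- The protocol `P_g`: every call to `IDEAL(f)` in `Q` is replaced by an execution of `P`. -/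
def OracleProtocol.replace {f g : Functionality} (Q : OracleProtocol f g) (P : PlainProtocol f) :
    Protocol g :=
  ⟨f, Q, .run P⟩

/-- A protocol without calls, as a protocol with no calls. -/
def PlainProtocol.toProtocol {f : Functionality} (P : PlainProtocol f) : Protocol f :=
  ⟨f, ⟨P.ports, .last P.sched, fun p x => .last (P.prog p x)⟩, .ideal⟩

/-! ### The devices of a protocol -/

section Resource

variable {f : Functionality}

/-- The devices for one call: none for an ideal call, a device of `P` for an execution of `P`. -/
def Resource.Dev : Resource f → Type 1
  | .ideal => PUnit
  | .run P => Device P.ports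

/-- The share of a party in the device for one call. -/
def Resource.reg : (r : Resource f) → r.Dev → Party → Reg
  | .ideal, _ => fun _ => .unit
  | .run _, D => D.reg

/-- The state of the device for one call. -/
def Resource.state : (r : Resource f) → (d : r.Dev) → Mat (r.reg d .alice × r.reg d .bob)
  | .ideal, _ => (1 : Mat (Unit × Unit))
  | .run _, D => D.state

/-- The strategy of a cheating party in one call against the honest party `p`. The cheating party
holds its memory `A` and its share of the device for this call. -/
def Resource.Cheat : (r : Resource f) → (p : Party) → (d : r.Dev) → Reg → Reg → Type 1
  | .ideal, p, _, A, V => IdealCheat f p (A.prod .unit) V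
  | .run P, p, D, A, V => QComp.Cheat (P.sched.view p) (A.prod (D.reg p.other)) V

/-- One call, where the honest party has input `x`: the unnormalised states for every output of the
honest party. -/
noncomputable def Resource.exec {X : Type} [Fintype X] [DecidableEq X] :
    (r : Resource f) → (p : Party) → (d : r.Dev) → {A V : Reg} → (x : f.In p) →
      r.Cheat p d A V → Mat ((A × r.reg d p.other) × r.reg d p × X) →
      Option (f.Out p) → Mat (V × X)
  | .ideal, _, _, _, _, x, adv, ρ, o => runIdeal f x adv (trace₂ ρ) o
  | .run P, p, D, A, _, x, adv, ρ, o =>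
      runLast (A := A.prod (D.reg p.other)) D p (P.prog p x) adv
        (ρ.submatrix (fun i => (i.1, i.2.2)) (fun i => (i.1, i.2.2))) o

/-- The devices for all calls. -/
inductive CallDevs (r : Resource f) : Shape → Type 1
  | last {s : Sched} : CallDevs r (.last s)
  | call {s : Sched} {sh : Shape} (d : r.Dev) (ds : CallDevs r sh) : CallDevs r (.call s sh)

/-- The joint share of a party in the devices for all calls. -/
def CallDevs.reg {r : Resource f} : {sh : Shape} → CallDevs r sh → Party → Reg
  | _, .last => fun _ => .unit
  | _, .call d ds => fun p => (r.reg d p).prod (ds.reg p)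

/-- The state `⊗ᵢ ρᵢ` of the devices for all calls, the register of `p` being second. -/
def CallDevs.state {r : Resource f} : {sh : Shape} → (ds : CallDevs r sh) → (p : Party) →
    Mat (ds.reg p.other × ds.reg p)
  | _, .last, _ => (1 : Mat (Unit × Unit))
  | _, .call d ds, p =>
      (viewFor (r.state d) p ⊗ₖ ds.state p).submatrix
        (fun i : (r.reg d p.other × ds.reg p.other) × (r.reg d p × ds.reg p) =>
          ((i.1.1, i.2.1), (i.1.2, i.2.2)))
        (fun i => ((i.1.1, i.2.1), (i.1.2, i.2.2)))

/-- Every one of the devices for the calls is in the class `S`. -/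
def CallDevs.All {r : Resource f} (S : Set r.Dev) : {sh : Shape} → CallDevs r sh → Prop
  | _, .last => True
  | _, .call d ds => d ∈ S ∧ ds.All S

/-- The strategy of a cheating party against the honest party `p` in a protocol with calls. The
device for a call is delivered when the call begins. If the honest party aborts, the cheating party
notices this and finishes by `onAbort`. -/
inductive CheatAll (r : Resource f) (p : Party) :
    {sh : Shape} → CallDevs r sh → Reg → Reg → Type 1
  | last {s : Sched} {A V : Reg} (adv : QComp.Cheat (s.view p) A V) :
      CheatAll r p (.last (s := s)) A V
  | call {s : Sched} {sh : Shape} {d : r.Dev} {ds : CallDevs r sh} {A A₁ A₂ V : Reg}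
      (adv : QComp.Cheat (s.view p) A A₁) (onAbort : Channel A₁ V) (inCall : r.Cheat p d A₁ A₂)
      (rest : CheatAll r p ds A₂ V) : CheatAll r p (.call (s := s) d ds) A V

/-- An execution of a protocol with calls: the unnormalised states for every output of the honest
party `p`. The registers are, in this order: cheating party, memory of `p`, share of `p` in the main
device, the two shares in the devices for the calls still to come, rest. -/
noncomputable def runProg {P : Ports} (D : Device P) (r : Resource f) (p : Party) {Out : Reg}
    {X : Type} [Fintype X] [DecidableEq X] {V : Reg} :
    {sh : Shape} → {ds : CallDevs r sh} → {W A : Reg} → Prog f P p Out sh W →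
      CheatAll r p ds A V →
      Mat (A × W × D.reg p × (ds.reg p.other × ds.reg p) × X) → Option Out → Mat (V × X)
  | _, _, _, _, .last L, .last adv, ρ, o => trace₂ (runLast D p L adv ρ o)
  | _, _, _, _, .call code input process rest, .call (d := d) (ds := ds) adv onAbort inCall advRest,
      ρ, o =>
      let ρ₁ := runCode D p code adv ρ
      (if o = none then
        trace₂ (trace₂ (trace₂ (onAbort.act₁ () (input.act₂ none ρ₁)))) else 0) +
      runProg D r p rest advRest
        (∑ x : f.In p, ∑ y : Option (f.Out p), (process y).act₂ ()
          (r.exec p d x inCall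
            ((input.act₂ (some x) ρ₁).submatrix
              (fun i => (i.1.1, i.2.2.1, i.2.2.2.1, ((i.1.2, i.2.2.2.2.1.1),
                (i.2.1, i.2.2.2.2.1.2)), i.2.2.2.2.2))
              (fun i => (i.1.1, i.2.2.1, i.2.2.2.1, ((i.1.2, i.2.2.2.2.1.1),
                (i.2.1, i.2.2.2.2.1.2)), i.2.2.2.2.2))) y)) o

end Resource

/-- A device for the main part of the protocol and, for every call, a device for that call. -/
structure Protocol.Devices {g : Functionality} (Q : Protocol g) where
  main : Device Q.oracle.ports
  calls : CallDevs Q.resource Q.oracle.shape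

/-- The devices whose main part is in `S` and whose parts for the calls are all in `T`. -/
def Protocol.deviceClass {g : Functionality} (Q : Protocol g) (S : Set (Device Q.oracle.ports))
    (T : Set Q.resource.Dev) : Set Q.Devices :=
  {D | D.main ∈ S ∧ D.calls.All T}

/-! ### Augmented security -/

section Security

variable {g : Functionality}

/-- A cheating party against the honest party `p`: a state `φ` of the cheating party's registers
`A₀` (which include its input) and the input register of `p`, and a strategy that begins with `A₀`
and the cheating party's share of the main device. -/
structure Attack (Q : Protocol g) (p : Party) (D : Q.Devices) where
  A₀ : Reg
  φ : Mat (A₀ × g.In p)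
  isDensity : IsDensity φ
  V : Reg
  strategy : CheatAll Q.resource p D.calls (A₀.prod (D.main.reg p.other)) V

variable {Q : Protocol g} {p : Party} {D : Q.Devices}

/-- All registers that the cheating party holds initially or is given in the course of the
protocol: `A₀` and its shares of all devices. -/
abbrev Attack.cheatReg (a : Attack Q p D) : Reg :=
  a.A₀.prod ((D.main.reg p.other).prod (D.calls.reg p.other))

/-- The shares of the honest party in all devices. -/
abbrev Attack.honestDevReg (_ : Attack Q p D) : Reg :=
  (D.main.reg p).prod (D.calls.reg p)

/-- The registers of the initial state `η`: those of the cheating party, the input of `p`, and the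
device shares of `p`. -/
abbrev Attack.initReg (a : Attack Q p D) : Reg :=
  a.cheatReg.prod ((g.In p).prod a.honestDevReg)

/-- The initial state `η = φ ⊗ ρ`, where `ρ` is the joint state of the devices. -/
noncomputable def Attack.init (a : Attack Q p D) : Mat a.initReg :=
  ((a.φ ⊗ₖ viewFor D.main.state p) ⊗ₖ D.calls.state p).submatrix
    (fun i : (a.A₀ × D.main.reg p.other × D.calls.reg p.other) ×
        (g.In p × D.main.reg p × D.calls.reg p) =>
      (((i.1.1, i.2.1), (i.1.2.1, i.2.2.1)), (i.1.2.2, i.2.2.2)))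
    (fun i => (((i.1.1, i.2.1), (i.1.2.1, i.2.2.1)), (i.1.2.2, i.2.2.2)))

/-- The final state of the protocol on the cheating party's registers, the purifying register `R`
of the canonical purification of `η`, the output of `p`, and the input of `p` (the last two are
classical). -/
noncomputable def Attack.real (a : Attack Q p D) :
    Mat ((a.V × a.initReg) × Option (g.Out p) × g.In p) :=
  Matrix.blockDiagonal fun ox =>
    runProg (X := a.initReg) D.main Q.resource p (Q.oracle.prog p ox.2) a.strategy
      ((purify a.init).submatrix
        (fun i => ((((i.1.1, i.1.2, i.2.2.2.1.1), (ox.2, i.2.2.1, i.2.2.2.1.2)), i.2.2.2.2)))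
        (fun i => ((((i.1.1, i.1.2, i.2.2.2.1.1), (ox.2, i.2.2.1, i.2.2.2.1.2)), i.2.2.2.2))))
      ox.1

/-- A simulator: it starts from the cheating party's registers and interacts with `IDEAL(g)`. -/
abbrev Attack.Simulator (a : Attack Q p D) : Type 1 := IdealCheat g p a.cheatReg a.V

/-- The final state of the simulated protocol, on the same registers, from the same purified initial
state: the honest party `p` gives its input to `IDEAL(g)` and outputs what it gets. -/
noncomputable def Attack.ideal (a : Attack Q p D) (sim : a.Simulator) :
    Mat ((a.V × a.initReg) × Option (g.Out p) × g.In p) :=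
  Matrix.blockDiagonal fun ox =>
    runIdeal (X := a.initReg) g ox.2 sim
      (trace₂ (Z := a.honestDevReg) ((purify a.init).submatrix
        (fun i => ((i.1, (ox.2, i.2.1)), i.2.2))
        (fun i => ((i.1, (ox.2, i.2.1)), i.2.2))))
      ox.1

set_option synthInstance.maxSize 2000 in
/-- The trace distance `‖τ_Sim - τ_P‖₁` of the two final states. -/
noncomputable def Attack.error (a : Attack Q p D) (sim : a.Simulator) : ℝ :=
  traceNorm (a.ideal sim - a.real)

end Security

/-- Negligible functions of the security parameter. -/
def Negligible (ν : ℕ → ℝ) : Prop :=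
  Asymptotics.SuperpolynomialDecay Filter.atTop (fun n : ℕ => (n : ℝ)) ν

/-- The protocol `Q` (a family indexed by the security parameter) is augmented-secure against the
class of devices `𝔇`: whichever party is honest, for every choice of devices in the class and every
cheating party there is a simulator whose final state, purifying register included, is negligibly
close to that of the protocol. -/
def AugmentedSecure {g : ℕ → Functionality} (Q : (n : ℕ) → Protocol (g n))
    (𝔇 : (n : ℕ) → Set (Q n).Devices) : Prop :=
  ∀ (p : Party) (D : (n : ℕ) → (Q n).Devices), (∀ n, D n ∈ 𝔇 n) →
    ∀ a : (n : ℕ) → Attack (Q n) p (D n), ∃ sim : (n : ℕ) → (a n).Simulator,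
      ∃ ν : ℕ → ℝ, Negligible ν ∧ ∀ n, (a n).error (sim n) ≤ ν n

end QComp

/-!
The composed protocol is compared with the oracle-aided protocol one call at a time, beginning with
the last one. The three ideas are the following.

*A uniform bound for `P_f`.* Augmented security provides one negligible function for every family
of attacks. The executions of `P_f` within the composed protocol are polynomially many attacks for
every value of the security parameter, and they must have a common negligible bound. Such a bound
exists for all attacks on all devices of the class (`AugmentedSecure.exists_uniform`): choose for
every value of the parameter an attack that is essentially the worst one, and apply security to this
family. The class of devices for `P_f` has to be non-empty here.

*Simulation within a larger computation.* When a call begins, the device for this call is in a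
product state with everything else, so that the state of the cheating party, the input of the honest
party and the device is the initial state `η` of an attack on `P_f`. Everything else (the memory of
the honest party, the devices still to come, the global purifying register) is an extension of `η`,
and every extension of `η` is obtained from the canonical purification of `η` by a completely
positive trace-non-increasing map on the purifying register (`exists_rest_purify`). Such a map
commutes with the execution and does not increase the trace distance, so the simulator for this
attack works within the larger computation (`exists_call_simulator`). This is where it matters that
the purifying register is part of the final state in the definition of augmented security.

*Replacing the calls.* The cheating party of the oracle-aided protocol holds its shares of all
devices for the calls from the beginning, as part of its own registers, while the honest shares are
discarded (`toIdeal`). In every call it runs the simulator for this call. By induction on the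
number of calls (`simulates`) the final states of the two executions differ by at most the number of
calls times the uniform bound. This is an attack on the oracle-aided protocol, and a simulator for
it is, up to a rearrangement of registers, a simulator for the composed protocol: the purified
initial state of the latter, with the honest call shares discarded, is once more an extension of the
initial state of the former (`exists_rest_start`). The total error is a negligible function plus a
polynomial times a negligible function.

Throughout, distances are handled through `Close`: the difference of two families of Hermitian
operators is written as a difference of positive families of small total trace, which is preserved
by additive, positive, trace-non-increasing maps without any further norm estimates.
-/

namespace QComp

/-! ### Superoperators on one tensor factor -/

section Superoperators

variable {X Y Z : Type}

/-- The superoperator `id ⊗ Φ`. -/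
def rest (Φ : Mat X →ₗ[ℂ] Mat Y) : Mat (Z × X) →ₗ[ℂ] Mat (Z × Y) where
  toFun ρ := Matrix.of fun i j => Φ (Matrix.of fun x x' => ρ (i.1, x) (j.1, x')) i.2 j.2
  map_add' ρ σ := by
    ext i j
    simp only [Matrix.of_apply, Matrix.add_apply]
    rw [← Matrix.add_apply, ← map_add]
    rfl
  map_smul' c ρ := by
    ext i j
    simp only [Matrix.of_apply, Matrix.smul_apply, RingHom.id_apply]
    rw [← Matrix.smul_apply, ← map_smul]
    rfl

theorem rest_apply (Φ : Mat X →ₗ[ℂ] Mat Y) (ρ : Mat (Z × X)) (i j : Z × Y) :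
    rest Φ ρ i j = Φ (Matrix.of fun x x' => ρ (i.1, x) (j.1, x')) i.2 j.2 := rfl

/-- The superoperator `ρ ↦ M ρ M†`. -/
def conjL [Fintype X] (M : Matrix Y X ℂ) : Mat X →ₗ[ℂ] Mat Y where
  toFun ρ := M * ρ * Mᴴ
  map_add' ρ σ := by rw [Matrix.mul_add, Matrix.add_mul]
  map_smul' c ρ := by simp

theorem conjL_apply [Fintype X] (M : Matrix Y X ℂ) (ρ : Mat X) : conjL M ρ = M * ρ * Mᴴ := rfl

theorem conjL_entry [Fintype X] (M : Matrix Y X ℂ) (ρ : Mat X) (i j : Y) :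
    conjL M ρ i j = ∑ a, ∑ b, M i a * ρ a b * star (M j b) := by
  simp only [conjL_apply, Matrix.mul_apply, Matrix.conjTranspose_apply, Finset.sum_mul]
  exact Finset.sum_comm

/-- The trace over the first of two factors. -/
def trFst [Fintype Z] : Mat (Z × X) →ₗ[ℂ] Mat X where
  toFun ρ := Matrix.of fun i j => ∑ z, ρ (z, i) (z, j)
  map_add' ρ σ := by ext i j; simp [Finset.sum_add_distrib]
  map_smul' c ρ := by ext i j; simp [Finset.mul_sum]

theorem trFst_apply [Fintype Z] (ρ : Mat (Z × X)) (i j : X) :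
    trFst ρ i j = ∑ z, ρ (z, i) (z, j) := rfl

theorem trFst_rest [Fintype Z] (Φ : Mat X →ₗ[ℂ] Mat Y) (ρ : Mat (Z × X)) :
    trFst (rest Φ ρ) = Φ (trFst ρ) := by
  ext i j
  have h : trFst ρ = ∑ z, Matrix.of fun x x' => ρ (z, x) (z, x') := by
    ext a b
    simp [trFst_apply, Matrix.sum_apply]
  simp [trFst_apply, rest_apply, h, map_sum, Matrix.sum_apply]

theorem trace_trFst [Fintype Z] [Fintype X] (ρ : Mat (Z × X)) : (trFst ρ).trace = ρ.trace := by
  simp only [Matrix.trace, Matrix.diag, trFst_apply, Fintype.sum_prod_type]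
  exact Finset.sum_comm

theorem posSemidef_trFst [Fintype Z] {ρ : Mat (Z × X)} (h : ρ.PosSemidef) :
    (trFst ρ).PosSemidef := by
  have : trFst ρ = ∑ z, ρ.submatrix (fun i => (z, i)) (fun i => (z, i)) := by
    ext a b
    simp [trFst_apply, Matrix.sum_apply]
  rw [this]
  exact Matrix.posSemidef_sum _ fun z _ => h.submatrix _

theorem trace_rest [Fintype Z] [Fintype Y] (Φ : Mat X →ₗ[ℂ] Mat Y) (ρ : Mat (Z × X)) :
    (rest Φ ρ).trace = (Φ (trFst ρ)).trace := by
  rw [← trFst_rest, trace_trFst]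

theorem kronecker_one_conj_entry [Fintype X] [Fintype Z] [DecidableEq Z] (M : Matrix Y X ℂ)
    (ρ : Mat (X × Z)) (i j : Y × Z) :
    ((M ⊗ₖ (1 : Mat Z)) * ρ * (M ⊗ₖ (1 : Mat Z))ᴴ) i j =
      ∑ a, ∑ b, M i.1 a * ρ (a, i.2) (b, j.2) * star (M j.1 b) := by
  rw [← conjL_apply, conjL_entry]
  simp [Fintype.sum_prod_type, Matrix.kroneckerMap_apply, Matrix.one_apply, apply_ite]

theorem rest_conjL [Fintype X] [Fintype Z] [DecidableEq Z] (M : Matrix Y X ℂ) (ρ : Mat (Z × X)) :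
    rest (conjL M) ρ = ((1 : Mat Z) ⊗ₖ M) * ρ * ((1 : Mat Z) ⊗ₖ M)ᴴ := by
  ext i j
  rw [← conjL_apply, conjL_entry, rest_apply, conjL_entry]
  simp [Fintype.sum_prod_type_right, Matrix.kroneckerMap_apply, Matrix.one_apply, apply_ite]

theorem rest_sum {ι : Type} (s : Finset ι) (Φ : ι → Mat X →ₗ[ℂ] Mat Y) (ρ : Mat (Z × X)) :
    rest (∑ k ∈ s, Φ k) ρ = ∑ k ∈ s, rest (Φ k) ρ := by
  ext i j
  simp [rest_apply, Matrix.sum_apply, LinearMap.sum_apply]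

theorem rest_comp {W : Type} (Φ : Mat X →ₗ[ℂ] Mat Y) (Ψ : Mat W →ₗ[ℂ] Mat X) (ρ : Mat (Z × W)) :
    rest Φ (rest Ψ ρ) = rest (Φ ∘ₗ Ψ) ρ := rfl

end Superoperators

section ActionLemmas

variable {A A' B B' C C' : Reg} {X Y Z : Type} [Fintype X] [DecidableEq X] [Fintype Y]
  [DecidableEq Y] {M : Type} [Fintype M]

/-- The branch `m` of `I` on the first register, as a linear map. -/
noncomputable def Instrument.lin (I : Instrument A A' M) (m : M) :
    Mat (A × X) →ₗ[ℂ] Mat (A' × X) :=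
  ∑ k, conjL (I.K m k ⊗ₖ (1 : Mat X))

theorem Instrument.lin_apply (I : Instrument A A' M) (m : M) (ρ : Mat (A × X)) :
    I.lin m ρ = I.act₁ m ρ := by
  simp [Instrument.lin, Instrument.act₁, LinearMap.sum_apply, conjL_apply]

theorem act₁_apply (I : Instrument A A' M) (m : M) (ρ : Mat (A × X)) (i j : A' × X) :
    I.act₁ m ρ i j =
      ∑ k, ∑ a, ∑ b, I.K m k i.1 a * ρ (a, i.2) (b, j.2) * star (I.K m k j.1 b) := by
  simp only [Instrument.act₁, Matrix.sum_apply, kronecker_one_conj_entry]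

theorem act₂_eq (I : Instrument B B' M) (m : M) (ρ : Mat (A × B × X)) :
    I.act₂ m ρ = rest (I.lin m) ρ := by
  simp only [Instrument.act₂, Instrument.lin, rest_sum, rest_conjL]

theorem act₃_eq (I : Instrument C C' M) (m : M) (ρ : Mat (A × B × C × X)) :
    I.act₃ m ρ = rest (rest (I.lin m)) ρ := by
  have h : rest (Z := B) (I.lin (X := X) m) =
      ∑ k, conjL ((1 : Mat B) ⊗ₖ (I.K m k ⊗ₖ (1 : Mat X))) := by
    ext1 σ
    simp only [Instrument.lin, rest_sum, rest_conjL, LinearMap.sum_apply, conjL_apply]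
  simp only [h, Instrument.act₃, rest_sum, rest_conjL]

omit [Fintype X] [DecidableEq X] [DecidableEq Y] in
theorem trace₂_eq (ρ : Mat (Z × Y × X)) : trace₂ ρ = rest trFst ρ := rfl

/-- Operations on different registers commute. -/
theorem act₁_rest (I : Instrument A A' M) (m : M) (Φ : Mat X →ₗ[ℂ] Mat Y) (ρ : Mat (A × X)) :
    I.act₁ m (rest Φ ρ) = rest Φ (I.act₁ m ρ) := by
  ext i j
  have h : (Matrix.of fun x x' => I.act₁ m ρ (i.1, x) (j.1, x')) =
      ∑ k, ∑ a, ∑ b, (I.K m k i.1 a * star (I.K m k j.1 b)) •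
        (Matrix.of fun x x' => ρ (a, x) (b, x')) := by
    ext x x'
    simp only [Matrix.of_apply, act₁_apply, Matrix.sum_apply, Matrix.smul_apply, smul_eq_mul]
    refine Finset.sum_congr rfl fun k _ => Finset.sum_congr rfl fun a _ =>
      Finset.sum_congr rfl fun b _ => ?_
    ring
  rw [rest_apply, h]
  simp only [act₁_apply, rest_apply, map_sum, map_smul, Matrix.sum_apply, Matrix.smul_apply,
    smul_eq_mul]
  refine Finset.sum_congr rfl fun k _ => Finset.sum_congr rfl fun a _ =>
      Finset.sum_congr rfl fun b _ => ?_
  ring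

theorem lin_comp_rest (I : Instrument A A' M) (m : M) (Φ : Mat X →ₗ[ℂ] Mat Y) :
    I.lin m ∘ₗ rest Φ = rest Φ ∘ₗ I.lin m := by
  ext1 ρ
  simp only [LinearMap.comp_apply, Instrument.lin_apply, act₁_rest]

theorem act₂_rest (I : Instrument B B' M) (m : M) (Φ : Mat X →ₗ[ℂ] Mat Y) (ρ : Mat (A × B × X)) :
    I.act₂ m (rest (rest Φ) ρ) = rest (rest Φ) (I.act₂ m ρ) := by
  rw [act₂_eq, act₂_eq, rest_comp, rest_comp, lin_comp_rest]

theorem act₃_rest (I : Instrument C C' M) (m : M) (Φ : Mat X →ₗ[ℂ] Mat Y)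
    (ρ : Mat (A × B × C × X)) :
    I.act₃ m (rest (rest (rest Φ)) ρ) = rest (rest (rest Φ)) (I.act₃ m ρ) := by
  have h : rest (Z := B) (I.lin m) ∘ₗ rest (rest Φ) = rest (rest Φ) ∘ₗ rest (I.lin m) := by
    ext1 σ
    simp only [LinearMap.comp_apply, rest_comp, lin_comp_rest]
  rw [act₃_eq, act₃_eq, rest_comp, rest_comp, h]

omit [Fintype X] [DecidableEq X] [Fintype Y] [DecidableEq Y] in
theorem trace₂_rest {W : Type} [Fintype W] (Φ : Mat X →ₗ[ℂ] Mat Y) (ρ : Mat (Z × W × X)) :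
    trace₂ (rest (rest Φ) ρ) = rest Φ (trace₂ ρ) := by
  have h : trFst (Z := W) ∘ₗ rest Φ = Φ ∘ₗ trFst := by
    ext1 σ
    simp only [LinearMap.comp_apply, trFst_rest]
  exact congrArg (fun Ψ : Mat (W × X) →ₗ[ℂ] Mat Y => rest Ψ ρ) h

/-! ### Operations preserve positivity and the trace -/

theorem posSemidef_act₁ (I : Instrument A A' M) (m : M) {ρ : Mat (A × X)} (h : ρ.PosSemidef) :
    (I.act₁ m ρ).PosSemidef :=
  Matrix.posSemidef_sum _ fun _ _ => h.mul_mul_conjTranspose_same _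

theorem posSemidef_act₂ (I : Instrument B B' M) (m : M) {ρ : Mat (A × B × X)}
    (h : ρ.PosSemidef) : (I.act₂ m ρ).PosSemidef :=
  Matrix.posSemidef_sum _ fun _ _ => h.mul_mul_conjTranspose_same _

theorem posSemidef_act₃ (I : Instrument C C' M) (m : M) {ρ : Mat (A × B × C × X)}
    (h : ρ.PosSemidef) : (I.act₃ m ρ).PosSemidef :=
  Matrix.posSemidef_sum _ fun _ _ => h.mul_mul_conjTranspose_same _

omit [Fintype X] [DecidableEq X] in
theorem posSemidef_trace₂ {W : Type} [Fintype W] {ρ : Mat (Z × W × X)}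
    (h : ρ.PosSemidef) : (trace₂ ρ).PosSemidef := by
  have : trace₂ ρ = ∑ w, ρ.submatrix (fun i => (i.1, w, i.2)) (fun i => (i.1, w, i.2)) := by
    ext a b
    simp [trace₂, Matrix.sum_apply]
  rw [this]
  exact Matrix.posSemidef_sum _ fun z _ => h.submatrix _

theorem sum_trace_act₁ (I : Instrument A A' M) (ρ : Mat (A × X)) :
    ∑ m, (I.act₁ m ρ).trace = ρ.trace := by
  have h : ∀ m k, ((I.K m k ⊗ₖ (1 : Mat X)) * ρ * (I.K m k ⊗ₖ (1 : Mat X))ᴴ).trace =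
      ((((I.K m k)ᴴ * I.K m k) ⊗ₖ (1 : Mat X)) * ρ).trace := by
    intro m k
    rw [Matrix.trace_mul_comm, ← Matrix.mul_assoc, Matrix.conjTranspose_kronecker,
      ← Matrix.mul_kronecker_mul, Matrix.conjTranspose_one, Matrix.mul_one]
  simp only [Instrument.act₁, Matrix.trace_sum, h]
  simp only [← Matrix.trace_sum, ← Matrix.sum_mul]
  have h2 : ∑ m, ∑ k, (((I.K m k)ᴴ * I.K m k) ⊗ₖ (1 : Mat X)) =
      (∑ m, ∑ k, (I.K m k)ᴴ * I.K m k) ⊗ₖ (1 : Mat X) := by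
    ext i j
    simp only [Matrix.sum_apply, Matrix.kroneckerMap_apply, Finset.sum_mul]
  rw [h2, I.trace_preserving, Matrix.one_kronecker_one, Matrix.one_mul]

theorem sum_trace_act₂ (I : Instrument B B' M) (ρ : Mat (A × B × X)) :
    ∑ m, (I.act₂ m ρ).trace = ρ.trace := by
  simp only [act₂_eq, trace_rest, Instrument.lin_apply, sum_trace_act₁, trace_trFst]

theorem sum_trace_act₃ (I : Instrument C C' M) (ρ : Mat (A × B × C × X)) :
    ∑ m, (I.act₃ m ρ).trace = ρ.trace := by
  simp only [act₃_eq, trace_rest, Instrument.lin_apply, sum_trace_act₁, trace_trFst]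

theorem trace_act₁ (I : Channel A A') (ρ : Mat (A × X)) : (I.act₁ () ρ).trace = ρ.trace := by
  rw [← sum_trace_act₁ I ρ]; simp

theorem trace_act₂ (I : Channel B B') (ρ : Mat (A × B × X)) :
    (I.act₂ () ρ).trace = ρ.trace := by
  rw [← sum_trace_act₂ I ρ]; simp

omit [DecidableEq X] [DecidableEq Y] in
theorem trace_trace₂ [Fintype Z] (ρ : Mat (Z × Y × X)) : (trace₂ ρ).trace = ρ.trace := by
  rw [trace₂_eq, trace_rest, trace_trFst, trace_trFst]

end ActionLemmas

/-! ### Executions commute with operations on the remaining register -/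

section Naturality

variable {X Y : Type} [Fintype X] [DecidableEq X] [Fintype Y] [DecidableEq Y]

theorem runCode_rest {P : Ports} (D : Device P) (p : Party) (Φ : Mat X →ₗ[ℂ] Mat Y) {s : Sched}
    {A A' W W' : Reg} (code : Code (P.X p) (P.O p) s W W') (adv : Cheat s A A')
    (ρ : Mat (A × W × D.reg p × X)) :
    runCode D p code adv (rest (rest (rest Φ)) ρ) =
      rest (rest (rest Φ)) (runCode D p code adv ρ) := by
  induction code generalizing A with
  | done => cases adv; simp only [runCode]
  | query input output r ih =>
    simp only [runCode, act₂_rest, act₃_rest, ← map_sum, ih]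
  | send msg r ih =>
    cases adv with | send process adv =>
    simp only [runCode, act₂_rest, act₁_rest, ← map_sum, ih]
  | recv msg r ih =>
    cases adv with | recv process adv =>
    simp only [runCode, act₂_rest, act₁_rest, ← map_sum, ih]

theorem runLast_rest {P : Ports} (D : Device P) (p : Party) (Φ : Mat X →ₗ[ℂ] Mat Y) {s : Sched}
    {A A' W Out : Reg} (L : LastPhase (P.X p) (P.O p) s W Out) (adv : Cheat s A A')
    (ρ : Mat (A × W × D.reg p × X)) (o : Option Out) :
    runLast D p L adv (rest (rest (rest Φ)) ρ) o = rest Φ (runLast D p L adv ρ o) := by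
  simp only [runLast, runCode_rest, act₂_rest, trace₂_rest]

theorem runIdeal_rest (f : Functionality) (Φ : Mat X →ₗ[ℂ] Mat Y) {p : Party} {A V : Reg}
    (x : f.In p) (adv : IdealCheat f p A V) (ρ : Mat (A × X)) (o : Option (f.Out p)) :
    runIdeal f x adv (rest Φ ρ) o = rest Φ (runIdeal f x adv ρ o) := by
  cases adv with
  | alice input abort =>
    simp only [runIdeal, act₁_rest, map_sum]
    refine Finset.sum_congr rfl fun _ _ => Finset.sum_congr rfl fun _ _ =>
      Finset.sum_congr rfl fun _ _ => Finset.sum_congr rfl fun _ _ => ?_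
    by_cases h : (if ‹Bool› = true then none else ‹Option (f.Out .bob)›) = o
    · simp only [h, if_true, map_smul]
    · simp only [h, if_false, map_zero]
  | bob input process =>
    simp only [runIdeal, act₁_rest, map_sum, map_smul]

/-- Adjoins a one-dimensional register in the second place. -/
def insertUnit {Z X : Type} (ρ : Mat (Z × X)) : Mat (Z × Unit × X) :=
  ρ.submatrix (fun i => (i.1, i.2.2)) (fun i => (i.1, i.2.2))

omit [Fintype X] [DecidableEq X] [Fintype Y] [DecidableEq Y] in
theorem insertUnit_rest {Z : Type} (Φ : Mat X →ₗ[ℂ] Mat Y) (ρ : Mat (Z × X)) :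
    insertUnit (rest Φ ρ) = rest (rest Φ) (insertUnit ρ) := rfl

theorem Resource.exec_rest {f : Functionality} (r : Resource f) (p : Party) (d : r.Dev)
    (Φ : Mat X →ₗ[ℂ] Mat Y) {A V : Reg} (x : f.In p) (adv : r.Cheat p d A V)
    (ρ : Mat ((A × r.reg d p.other) × r.reg d p × X)) (o : Option (f.Out p)) :
    r.exec p d x adv (rest (rest Φ) ρ) o = rest Φ (r.exec p d x adv ρ o) := by
  cases r with
  | ideal =>
    have h : ∀ (adv : IdealCheat f p (A.prod .unit) V) (ρ : Mat ((A × Unit) × Unit × X)),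
        runIdeal f x adv (trace₂ (rest (rest Φ) ρ)) o =
          rest Φ (runIdeal f x adv (trace₂ ρ) o) := fun adv ρ => by
      rw [trace₂_rest, ← runIdeal_rest]
    exact h adv ρ
  | run P =>
    have h : ∀ (D : Device P.ports) (adv : QComp.Cheat (P.sched.view p) (A.prod (D.reg p.other)) V)
        (ρ : Mat ((A × D.reg p.other) × D.reg p × X)),
        runLast (A := A.prod (D.reg p.other)) D p (P.prog p x) adv
          (insertUnit (rest (rest Φ) ρ)) o =
          rest Φ (runLast (A := A.prod (D.reg p.other)) D p (P.prog p x) adv (insertUnit ρ) o) :=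
      fun D adv ρ => by rw [insertUnit_rest, ← runLast_rest]
    exact h d adv ρ

/-- The rearrangement of registers at the beginning of a call: the shares of the device for this
call are taken out of the shares of all devices for calls. -/
def atCall {A W D O O' H H' X : Type} (ρ : Mat (A × W × D × ((O × O') × (H × H')) × X)) :
    Mat ((A × O) × H × W × D × (O' × H') × X) :=
  ρ.submatrix
    (fun i => (i.1.1, i.2.2.1, i.2.2.2.1, ((i.1.2, i.2.2.2.2.1.1), (i.2.1, i.2.2.2.2.1.2)),
      i.2.2.2.2.2))
    (fun i => (i.1.1, i.2.2.1, i.2.2.2.1, ((i.1.2, i.2.2.2.2.1.1), (i.2.1, i.2.2.2.2.1.2)),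
      i.2.2.2.2.2))

/-- The state after one call, when `ρ` is the state before the honest party determines its input. -/
noncomputable def callStep {f : Functionality} {r : Resource f} {p : Party} {d : r.Dev}
    {O' H' D : Type} [Fintype O'] [Fintype H'] [Fintype D] [DecidableEq O'] [DecidableEq H']
    [DecidableEq D] {A A' W₁ W₂ W₃ : Reg}
    (input : Instrument W₁ W₂ (Option (f.In p))) (process : Option (f.Out p) → Channel W₂ W₃)
    (inCall : r.Cheat p d A A')
    (ρ : Mat (A × W₁ × D × ((r.reg d p.other × O') × (r.reg d p × H')) × X)) :
    Mat (A' × W₃ × D × (O' × H') × X) :=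
  ∑ x : f.In p, ∑ y : Option (f.Out p), (process y).act₂ ()
    (r.exec p d x inCall (atCall (input.act₂ (some x) ρ)) y)

/-- The state if the honest party aborts instead of making a call. -/
noncomputable def abortStep {f : Functionality} {p : Party} {D Q : Type} [Fintype D] [Fintype Q]
    [DecidableEq D] [DecidableEq Q]
    {A V W₁ W₂ : Reg} (input : Instrument W₁ W₂ (Option (f.In p))) (onAbort : Channel A V)
    (ρ : Mat (A × W₁ × D × Q × X)) : Mat (V × X) :=
  trace₂ (trace₂ (trace₂ (onAbort.act₁ () (input.act₂ none ρ))))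

/-- `runProg` for a program that begins with a communication phase and a call, over registers
written as products. -/
noncomputable def runCall {f : Functionality} {P : Ports} (D : Device P) (r : Resource f)
    (p : Party) {Out : Reg} {V : Reg} {s : Sched} {sh : Shape} {d : r.Dev} {ds : CallDevs r sh}
    {A A₁ A₂ W W₁ W₂ W₃ : Reg} (code : Code (P.X p) (P.O p) (s.view p) W W₁)
    (input : Instrument W₁ W₂ (Option (f.In p))) (process : Option (f.Out p) → Channel W₂ W₃)
    (prog : Prog f P p Out sh W₃) (adv : Cheat (s.view p) A A₁) (onAbort : Channel A₁ V)
    (inCall : r.Cheat p d A₁ A₂) (advRest : CheatAll r p ds A₂ V)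
    (ρ : Mat (A × W × D.reg p ×
      ((r.reg d p.other × ds.reg p.other) × (r.reg d p × ds.reg p)) × X)) (o : Option Out) :
    Mat (V × X) :=
  (if o = none then abortStep input onAbort (runCode D p code adv ρ) else 0) +
    runProg D r p prog advRest (callStep input process inCall (runCode D p code adv ρ)) o

theorem runCall_of_eq {f : Functionality} {P : Ports} (D : Device P) {r : Resource f} {p : Party}
    {Out : Reg} {V : Reg} {s : Sched} {sh : Shape} {d : r.Dev} {ds : CallDevs r sh}
    {A A₁ A₂ W W₁ W₂ W₃ : Reg} {code : Code (P.X p) (P.O p) (s.view p) W W₁}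
    {input : Instrument W₁ W₂ (Option (f.In p))} {process : Option (f.Out p) → Channel W₂ W₃}
    {prog : Prog f P p Out sh W₃} {adv : Cheat (s.view p) A A₁} {onAbort : Channel A₁ V}
    {inCall : r.Cheat p d A₁ A₂} {advRest : CheatAll r p ds A₂ V}
    {ρ : Mat (A × W × D.reg p × ((r.reg d p.other × ds.reg p.other) × (r.reg d p × ds.reg p)) × X)}
    {ρ₁ : Mat (A₁ × W₁ × D.reg p ×
      ((r.reg d p.other × ds.reg p.other) × (r.reg d p × ds.reg p)) × X)}
    (h : runCode D p code adv ρ = ρ₁) (o : Option Out) :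
    runCall D r p code input process prog adv onAbort inCall advRest ρ o =
      (if o = none then abortStep input onAbort ρ₁ else 0) +
        runProg D r p prog advRest (callStep input process inCall ρ₁) o := by
  rw [runCall, h]

theorem callStep_rest {f : Functionality} {r : Resource f} {p : Party} {d : r.Dev}
    {O' H' D : Type} [Fintype O'] [Fintype H'] [Fintype D] [DecidableEq O'] [DecidableEq H']
    [DecidableEq D] {A A' W₁ W₂ W₃ : Reg}
    (input : Instrument W₁ W₂ (Option (f.In p))) (process : Option (f.Out p) → Channel W₂ W₃)
    (inCall : r.Cheat p d A A') (Φ : Mat X →ₗ[ℂ] Mat Y)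
    (ρ : Mat (A × W₁ × D × ((r.reg d p.other × O') × (r.reg d p × H')) × X)) :
    callStep input process inCall (rest (rest (rest (rest Φ))) ρ) =
      rest (rest (rest (rest Φ))) (callStep input process inCall ρ) := by
  simp only [callStep, map_sum]
  refine Finset.sum_congr rfl fun x _ => Finset.sum_congr rfl fun y _ => ?_
  have h : atCall (input.act₂ (some x) (rest (rest (rest (rest Φ))) ρ)) =
      rest (rest (rest (rest (rest Φ)))) (atCall (input.act₂ (some x) ρ)) := by
    rw [act₂_rest]
    rfl
  rw [h, Resource.exec_rest, act₂_rest]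

theorem abortStep_rest {f : Functionality} {p : Party} {D Q : Type} [Fintype D] [Fintype Q]
    [DecidableEq D] [DecidableEq Q]
    {A V W₁ W₂ : Reg} (input : Instrument W₁ W₂ (Option (f.In p))) (onAbort : Channel A V)
    (Φ : Mat X →ₗ[ℂ] Mat Y) (ρ : Mat (A × W₁ × D × Q × X)) :
    abortStep input onAbort (rest (rest (rest (rest Φ))) ρ) =
      rest Φ (abortStep input onAbort ρ) := by
  simp only [abortStep, act₂_rest, act₁_rest, trace₂_rest]

theorem runProg_rest {f : Functionality} {P : Ports} (D : Device P) (r : Resource f) (p : Party)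
    {Out : Reg} (Φ : Mat X →ₗ[ℂ] Mat Y) {V : Reg} {sh : Shape} {ds : CallDevs r sh} {W A : Reg}
    (prog : Prog f P p Out sh W) (adv : CheatAll r p ds A V)
    (ρ : Mat (A × W × D.reg p × (ds.reg p.other × ds.reg p) × X)) (o : Option Out) :
    runProg D r p prog adv (rest (rest (rest (rest Φ))) ρ) o =
      rest Φ (runProg D r p prog adv ρ o) := by
  induction prog generalizing A with
  | last L =>
    cases adv
    simp only [runProg, runLast_rest, trace₂_rest]
  | call code input process rest' ih =>
    cases adv with | @call _ _ d ds _ _ _ _ adv onAbort inCall advRest =>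
    -- The registers of `CallDevs.call d ds` unfold to products; the step is stated over products.
    have key : ∀ ρ : Mat (A × _ × D.reg p ×
        ((r.reg d p.other × ds.reg p.other) × (r.reg d p × ds.reg p)) × X),
        runCall D r p code input process rest' adv onAbort inCall advRest
          (rest (rest (rest (rest Φ))) ρ) o =
        rest Φ (runCall D r p code input process rest' adv onAbort inCall advRest ρ o) :=
      fun ρ => by
      rw [runCall, runCall, map_add, runCode_rest, callStep_rest, ih, abortStep_rest]
      split_ifs
      · rfl
      · simp
    exact key ρ

end Naturality

/-! ### Executions preserve positivity and the trace -/

section Positivity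

variable {X : Type} [Fintype X] [DecidableEq X]

theorem posSemidef_runCode {P : Ports} (D : Device P) (p : Party) {s : Sched}
    {A A' W W' : Reg} (code : Code (P.X p) (P.O p) s W W') (adv : Cheat s A A')
    {ρ : Mat (A × W × D.reg p × X)} (h : ρ.PosSemidef) :
    (runCode D p code adv ρ).PosSemidef := by
  induction code generalizing A with
  | done => cases adv; simpa only [runCode] using h
  | query input output r ih =>
    simp only [runCode]
    exact ih _ (Matrix.posSemidef_sum _ fun _ _ => Matrix.posSemidef_sum _ fun _ _ =>
      posSemidef_act₂ _ _ (posSemidef_act₃ _ _ (posSemidef_act₂ _ _ h)))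
  | send msg r ih =>
    cases adv with | send process adv =>
    simp only [runCode]
    exact ih _ (Matrix.posSemidef_sum _ fun _ _ => posSemidef_act₁ _ _ (posSemidef_act₂ _ _ h))
  | recv msg r ih =>
    cases adv with | recv process adv =>
    simp only [runCode]
    exact ih _ (Matrix.posSemidef_sum _ fun _ _ => posSemidef_act₂ _ _ (posSemidef_act₁ _ _ h))

theorem trace_runCode {P : Ports} (D : Device P) (p : Party) {s : Sched}
    {A A' W W' : Reg} (code : Code (P.X p) (P.O p) s W W') (adv : Cheat s A A')
    (ρ : Mat (A × W × D.reg p × X)) :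
    (runCode D p code adv ρ).trace = ρ.trace := by
  induction code generalizing A with
  | done => cases adv; simp only [runCode]
  | query input output r ih =>
    simp only [runCode, ih, Matrix.trace_sum, trace_act₂, sum_trace_act₃, sum_trace_act₂]
  | send msg r ih =>
    cases adv with | send process adv =>
    simp only [runCode, ih, Matrix.trace_sum, trace_act₁, sum_trace_act₂]
  | recv msg r ih =>
    cases adv with | recv process adv =>
    simp only [runCode, ih, Matrix.trace_sum, trace_act₂, sum_trace_act₁]

theorem posSemidef_runLast {P : Ports} (D : Device P) (p : Party) {s : Sched}
    {A A' W Out : Reg} (L : LastPhase (P.X p) (P.O p) s W Out) (adv : Cheat s A A')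
    {ρ : Mat (A × W × D.reg p × X)} (h : ρ.PosSemidef) (o : Option Out) :
    (runLast D p L adv ρ o).PosSemidef :=
  posSemidef_trace₂ (posSemidef_trace₂ (posSemidef_act₂ _ _ (posSemidef_runCode D p _ _ h)))

theorem sum_trace_runLast {P : Ports} (D : Device P) (p : Party) {s : Sched}
    {A A' W Out : Reg} (L : LastPhase (P.X p) (P.O p) s W Out) (adv : Cheat s A A')
    (ρ : Mat (A × W × D.reg p × X)) :
    ∑ o, (runLast D p L adv ρ o).trace = ρ.trace := by
  simp only [runLast, trace_trace₂, sum_trace_act₂, trace_runCode]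

theorem sum_toReal_pmf {α β : Type} [Fintype α] [Fintype β] (q : PMF (α × β)) :
    ∑ a, ∑ b, ((q (a, b)).toReal : ℂ) = 1 := by
  have h : ∑ a, ∑ b, (q (a, b)).toReal = 1 := by
    rw [← Fintype.sum_prod_type (f := fun i : α × β => (q i).toReal),
      ← ENNReal.toReal_sum fun i _ => q.apply_ne_top i, ← tsum_fintype (L := .unconditional _),
      q.tsum_coe]
    rfl
  exact_mod_cast h

theorem posSemidef_toReal_smul {Y : Type} {ρ : Mat Y} (h : ρ.PosSemidef) (c : ENNReal) :
    ((c.toReal : ℂ) • ρ).PosSemidef :=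
  h.smul (by exact_mod_cast ENNReal.toReal_nonneg)

theorem posSemidef_runIdeal (f : Functionality) {p : Party} {A V : Reg}
    (x : f.In p) (adv : IdealCheat f p A V) {ρ : Mat (A × X)} (h : ρ.PosSemidef)
    (o : Option (f.Out p)) : (runIdeal f x adv ρ o).PosSemidef := by
  cases adv with
  | alice input abort =>
    simp only [runIdeal]
    refine Matrix.posSemidef_sum _ fun a _ => Matrix.posSemidef_sum _ fun oA _ =>
      Matrix.posSemidef_sum _ fun oB _ => Matrix.posSemidef_sum _ fun c _ => ?_
    by_cases hq : (if c = true then none else oB) = o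
    · rw [if_pos hq]
      exact posSemidef_toReal_smul (posSemidef_act₁ _ _ (posSemidef_act₁ _ _ h)) _
    · rw [if_neg hq]
      exact Matrix.PosSemidef.zero
  | bob input process =>
    simp only [runIdeal]
    exact Matrix.posSemidef_sum _ fun _ _ => Matrix.posSemidef_sum _ fun _ _ =>
      posSemidef_toReal_smul (posSemidef_act₁ _ _ (posSemidef_act₁ _ _ h)) _

theorem sum_trace_runIdeal (f : Functionality) {p : Party} {A V : Reg}
    (x : f.In p) (adv : IdealCheat f p A V) (ρ : Mat (A × X)) :
    ∑ o, (runIdeal f x adv ρ o).trace = ρ.trace := by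
  cases adv with
  | alice input abort =>
    simp only [runIdeal, Matrix.trace_sum]
    have h : ∀ (a : f.In .alice) (oA : Option (f.Out .alice)) (oB : Option (f.Out .bob)) (c : Bool),
        ∑ o : Option (f.Out .bob), (if (if c = true then none else oB) = o then
          ((f.dist a x (oA, oB)).toReal : ℂ) • (abort oA).act₁ c (input.act₁ a ρ) else 0).trace =
        ((f.dist a x (oA, oB)).toReal : ℂ) * ((abort oA).act₁ c (input.act₁ a ρ)).trace := by
      intro a oA oB c
      simp only [apply_ite Matrix.trace, Matrix.trace_zero, Matrix.trace_smul, smul_eq_mul]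
      rw [Finset.sum_ite_eq]
      simp
    rw [Finset.sum_comm, ← sum_trace_act₁ input ρ]
    refine Finset.sum_congr rfl fun a _ => ?_
    rw [Finset.sum_comm]
    trans ∑ oA, ∑ oB, ((f.dist a x (oA, oB)).toReal : ℂ) * (input.act₁ a ρ).trace
    · refine Finset.sum_congr rfl fun oA _ => ?_
      rw [Finset.sum_comm]
      refine Finset.sum_congr rfl fun oB _ => ?_
      rw [Finset.sum_comm, ← sum_trace_act₁ (abort oA), Finset.mul_sum]
      exact Finset.sum_congr rfl fun c _ => h a oA oB c
    · simp only [← Finset.sum_mul, sum_toReal_pmf, one_mul]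
  | bob input process =>
    simp only [runIdeal, Matrix.trace_sum]
    rw [Finset.sum_comm]
    have h : ∀ b, ∑ o : Option (f.Out .alice), ∑ oB : Option (f.Out .bob),
        (((f.dist x b (o, oB)).toReal : ℂ) • (process oB).act₁ () (input.act₁ b ρ)).trace =
        (input.act₁ b ρ).trace := fun b => by
      simp only [Matrix.trace_smul, trace_act₁, smul_eq_mul, ← Finset.sum_mul, sum_toReal_pmf,
        one_mul]
    simp only [h, sum_trace_act₁]

theorem posSemidef_exec {f : Functionality} (r : Resource f) (p : Party) (d : r.Dev) {A V : Reg}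
    (x : f.In p) (adv : r.Cheat p d A V) {ρ : Mat ((A × r.reg d p.other) × r.reg d p × X)}
    (h : ρ.PosSemidef) (o : Option (f.Out p)) : (r.exec p d x adv ρ o).PosSemidef := by
  cases r with
  | ideal => exact posSemidef_runIdeal f x _ (posSemidef_trace₂ h) o
  | run P =>
    exact posSemidef_runLast (A := A.prod (Device.reg d p.other)) d p (P.prog p x) adv
      (h.submatrix _) o

omit [DecidableEq X] in
theorem trace_insertUnit {Z : Type} [Fintype Z] (ρ : Mat (Z × X)) :
    (insertUnit ρ).trace = ρ.trace := by
  simp [Matrix.trace, insertUnit, Fintype.sum_prod_type]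

theorem sum_trace_exec {f : Functionality} (r : Resource f) (p : Party) (d : r.Dev) {A V : Reg}
    (x : f.In p) (adv : r.Cheat p d A V) (ρ : Mat ((A × r.reg d p.other) × r.reg d p × X)) :
    ∑ o, (r.exec p d x adv ρ o).trace = ρ.trace := by
  cases r with
  | ideal => exact (sum_trace_runIdeal f x _ _).trans (trace_trace₂ _)
  | run P =>
    exact (sum_trace_runLast (A := A.prod (Device.reg d p.other)) d p (P.prog p x) adv _).trans
      (trace_insertUnit _)

omit [Fintype X] [DecidableEq X] in
theorem posSemidef_atCall {A W D O O' H H' : Type}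
    {ρ : Mat (A × W × D × ((O × O') × (H × H')) × X)} (h : ρ.PosSemidef) :
    (atCall ρ).PosSemidef := h.submatrix _

omit [DecidableEq X] in
theorem trace_atCall {A W D O O' H H' : Type} [Fintype A] [Fintype W] [Fintype D] [Fintype O]
    [Fintype O'] [Fintype H] [Fintype H'] (ρ : Mat (A × W × D × ((O × O') × (H × H')) × X)) :
    (atCall ρ).trace = ρ.trace := by
  let e : ((A × O) × H × W × D × (O' × H') × X) ≃ (A × W × D × ((O × O') × (H × H')) × X) :=
    { toFun := fun i => (i.1.1, i.2.2.1, i.2.2.2.1, ((i.1.2, i.2.2.2.2.1.1),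
        (i.2.1, i.2.2.2.2.1.2)), i.2.2.2.2.2)
      invFun := fun j => ((j.1, j.2.2.2.1.1.1), j.2.2.2.1.2.1, j.2.1, j.2.2.1,
        (j.2.2.2.1.1.2, j.2.2.2.1.2.2), j.2.2.2.2) }
  exact e.sum_comp fun j => ρ j j

section CallStep

variable {f : Functionality} {r : Resource f} {p : Party} {d : r.Dev}
    {O' H' D : Type} [Fintype O'] [Fintype H'] [Fintype D] [DecidableEq O'] [DecidableEq H']
    [DecidableEq D] {A A' W₁ W₂ W₃ : Reg}
    (input : Instrument W₁ W₂ (Option (f.In p))) (process : Option (f.Out p) → Channel W₂ W₃)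

theorem posSemidef_callStep (inCall : r.Cheat p d A A')
    {ρ : Mat (A × W₁ × D × ((r.reg d p.other × O') × (r.reg d p × H')) × X)} (h : ρ.PosSemidef) :
    (callStep input process inCall ρ).PosSemidef :=
  Matrix.posSemidef_sum _ fun _ _ => Matrix.posSemidef_sum _ fun _ _ =>
    posSemidef_act₂ _ _ (posSemidef_exec r p d _ _ (posSemidef_atCall (posSemidef_act₂ _ _ h)) _)

theorem trace_callStep (inCall : r.Cheat p d A A')
    (ρ : Mat (A × W₁ × D × ((r.reg d p.other × O') × (r.reg d p × H')) × X)) :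
    (callStep input process inCall ρ).trace = ∑ x, (input.act₂ (some x) ρ).trace := by
  simp only [callStep, Matrix.trace_sum, trace_act₂, sum_trace_exec, trace_atCall]

variable {V : Reg} {Q : Type} [Fintype Q] [DecidableEq Q] (onAbort : Channel A V)

theorem posSemidef_abortStep {ρ : Mat (A × W₁ × D × Q × X)} (h : ρ.PosSemidef) :
    (abortStep input onAbort ρ).PosSemidef :=
  posSemidef_trace₂ (posSemidef_trace₂ (posSemidef_trace₂
    (posSemidef_act₁ _ _ (posSemidef_act₂ _ _ h))))

theorem trace_abortStep (ρ : Mat (A × W₁ × D × Q × X)) :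
    (abortStep input onAbort ρ).trace = (input.act₂ none ρ).trace := by
  simp only [abortStep, trace_trace₂, trace_act₁]

end CallStep

theorem posSemidef_runProg {f : Functionality} {P : Ports} (D : Device P) (r : Resource f)
    (p : Party) {Out : Reg} {V : Reg} {sh : Shape} {ds : CallDevs r sh} {W A : Reg}
    (prog : Prog f P p Out sh W) (adv : CheatAll r p ds A V)
    {ρ : Mat (A × W × D.reg p × (ds.reg p.other × ds.reg p) × X)} (h : ρ.PosSemidef)
    (o : Option Out) : (runProg D r p prog adv ρ o).PosSemidef := by
  induction prog generalizing A with
  | last L =>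
    cases adv
    exact posSemidef_trace₂ (posSemidef_runLast D p _ _ h o)
  | call code input process rest' ih =>
    cases adv with | @call _ _ d ds _ _ _ _ adv onAbort inCall advRest =>
    have key : ∀ ρ : Mat (A × _ × D.reg p ×
        ((r.reg d p.other × ds.reg p.other) × (r.reg d p × ds.reg p)) × X), ρ.PosSemidef →
        (runCall D r p code input process rest' adv onAbort inCall advRest ρ o).PosSemidef := by
      intro ρ h
      have h1 := posSemidef_runCode D p code adv h
      refine Matrix.PosSemidef.add ?_ (ih _ (posSemidef_callStep _ _ _ h1))
      split_ifs
      · exact posSemidef_abortStep _ _ h1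
      · exact Matrix.PosSemidef.zero
    exact key ρ h

theorem sum_trace_runProg {f : Functionality} {P : Ports} (D : Device P) (r : Resource f)
    (p : Party) {Out : Reg} {V : Reg} {sh : Shape} {ds : CallDevs r sh} {W A : Reg}
    (prog : Prog f P p Out sh W) (adv : CheatAll r p ds A V)
    (ρ : Mat (A × W × D.reg p × (ds.reg p.other × ds.reg p) × X)) :
    ∑ o, (runProg D r p prog adv ρ o).trace = ρ.trace := by
  induction prog generalizing A with
  | last L =>
    cases adv
    simp only [runProg]
    exact (Finset.sum_congr rfl fun _ _ => trace_trace₂ _).trans (sum_trace_runLast D p _ _ _)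
  | call code input process rest' ih =>
    cases adv with | @call _ _ d ds _ _ _ _ adv onAbort inCall advRest =>
    have key : ∀ ρ : Mat (A × _ × D.reg p ×
        ((r.reg d p.other × ds.reg p.other) × (r.reg d p × ds.reg p)) × X),
        ∑ o, (runCall D r p code input process rest' adv onAbort inCall advRest ρ o).trace =
          ρ.trace := by
      intro ρ
      simp only [runCall, Matrix.trace_add, Finset.sum_add_distrib, ih, trace_callStep,
        apply_ite Matrix.trace, Matrix.trace_zero, Finset.sum_ite_eq', Finset.mem_univ, if_true,
        trace_abortStep]
      rw [← trace_runCode D p code adv ρ, ← sum_trace_act₂ input, Fintype.sum_option]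
    exact key ρ

/-- Additivity of an execution is a consequence of naturality: `ρ` and `σ` are two blocks of one
operator with a larger last register. -/
theorem runProg_add {f : Functionality} {P : Ports} (D : Device P) (r : Resource f) (p : Party)
    {Out : Reg} {V : Reg} {sh : Shape} {ds : CallDevs r sh} {W A : Reg}
    (prog : Prog f P p Out sh W) (adv : CheatAll r p ds A V)
    (ρ σ : Mat (A × W × D.reg p × (ds.reg p.other × ds.reg p) × X)) (o : Option Out) :
    runProg D r p prog adv (ρ + σ) o = runProg D r p prog adv ρ o + runProg D r p prog adv σ o := by
  let block (b : Bool) : Mat (X × Bool) →ₗ[ℂ] Mat X :=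
    { toFun := fun m => m.submatrix (fun x => (x, b)) (fun x => (x, b))
      map_add' := fun _ _ => rfl
      map_smul' := fun _ _ => rfl }
  let τ : Mat (A × W × D.reg p × (ds.reg p.other × ds.reg p) × X × Bool) :=
    Matrix.of fun i j => (bif i.2.2.2.2.2 then ρ else σ)
      (i.1, i.2.1, i.2.2.1, i.2.2.2.1, i.2.2.2.2.1) (j.1, j.2.1, j.2.2.1, j.2.2.2.1, j.2.2.2.2.1)
  have h1 : ρ = rest (rest (rest (rest (block true)))) τ := rfl
  have h2 : σ = rest (rest (rest (rest (block false)))) τ := rfl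
  have h3 : ρ + σ = rest (rest (rest (rest (block true + block false)))) τ := rfl
  rw [h3, h1, h2, runProg_rest, runProg_rest, runProg_rest]
  rfl

end Positivity

/-! ### The trace norm of Hermitian operators -/

section TraceNorm

variable {X : Type} [Fintype X] [DecidableEq X]

/-- The eigenvalues of `A† A = A²` are the squares of those of `A`, as multisets: both are the roots
of one characteristic polynomial. -/
theorem traceNorm_eq_sum_abs {A : Mat X} (hA : A.IsHermitian) :
    traceNorm A = ∑ i, |hA.eigenvalues i| := by
  have h1 : Aᴴ * A = cfc (fun x : ℝ => x ^ 2) A := by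
    rw [cfc_pow_id (R := ℝ) A 2 hA.isSelfAdjoint, hA.eq, sq]
  have h2 := (Matrix.isHermitian_conjTranspose_mul_self A).charpoly_eq
  have h3 := hA.charpoly_cfc_eq (fun x : ℝ => x ^ 2)
  rw [← h1, h2] at h3
  have h4 := congrArg Polynomial.roots h3
  rw [Polynomial.roots_prod, Polynomial.roots_prod] at h4
  · simp only [Polynomial.roots_X_sub_C, Multiset.bind_singleton] at h4
    have h5 := congrArg (fun s : Multiset ℂ => (s.map fun z => Real.sqrt z.re).sum) h4
    simp only [Multiset.map_map, Function.comp_def] at h5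
    simpa [traceNorm, ← Complex.ofReal_pow, Real.sqrt_sq_eq_abs] using h5
  · exact Finset.prod_ne_zero_iff.2 fun i _ => Polynomial.X_sub_C_ne_zero _
  · exact Finset.prod_ne_zero_iff.2 fun i _ => Polynomial.X_sub_C_ne_zero _

/-- In an eigenbasis of `P - N`, the absolute value of an eigenvalue is at most the sum of the
diagonal entries of `P` and `N`. -/
theorem traceNorm_sub_le {P N : Mat X} (hP : P.PosSemidef) (hN : N.PosSemidef) :
    traceNorm (P - N) ≤ P.trace.re + N.trace.re := by
  have hA : (P - N).IsHermitian := hP.1.sub hN.1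
  rw [traceNorm_eq_sum_abs hA]
  let U : Mat X := hA.eigenvectorUnitary
  have hU : U * Uᴴ = 1 := (Matrix.mem_unitaryGroup_iff).1 hA.eigenvectorUnitary.2
  have htr : ∀ B : Mat X, B.trace.re = ∑ i, ((Uᴴ * B * U) i i).re := fun B => by
    rw [← Complex.re_sum]
    change _ = (Uᴴ * B * U).trace.re
    rw [Matrix.trace_mul_comm, ← Matrix.mul_assoc, hU, Matrix.one_mul]
  have hdiag : ∀ i, hA.eigenvalues i = ((Uᴴ * (P - N) * U) i i).re := fun i => by
    have := hA.conjStarAlgAut_star_eigenvectorUnitary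
    have h2 := congrFun (congrFun this i) i
    rw [Unitary.conjStarAlgAut_star_apply] at h2
    simp only [Matrix.diagonal_apply_eq, Function.comp] at h2
    have h3 : (Uᴴ * (P - N) * U) i i = (hA.eigenvalues i : ℂ) := h2
    rw [h3, Complex.ofReal_re]
  rw [htr P, htr N, ← Finset.sum_add_distrib]
  refine Finset.sum_le_sum fun i _ => ?_
  have h1 := (Complex.le_def.1 ((hP.conjTranspose_mul_mul_same U).diag_nonneg (i := i))).1
  have h2 := (Complex.le_def.1 ((hN.conjTranspose_mul_mul_same U).diag_nonneg (i := i))).1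
  rw [hdiag, Matrix.mul_sub, Matrix.sub_mul, Matrix.sub_apply, Complex.sub_re, abs_le]
  simp only [Complex.zero_re] at h1 h2
  constructor <;> linarith

/-- The decomposition of a Hermitian operator into its positive and negative parts. -/
theorem exists_posSemidef_sub {A : Mat X} (hA : A.IsHermitian) :
    ∃ P N : Mat X, P.PosSemidef ∧ N.PosSemidef ∧ A = P - N ∧
      P.trace.re + N.trace.re = traceNorm A := by
  have htr : ∀ g : ℝ → ℝ, (cfc g A).trace.re = ∑ i, g (hA.eigenvalues i) := fun g => by
    rw [hA.cfc_eq, Matrix.IsHermitian.cfc, Unitary.conjStarAlgAut_apply, Matrix.trace_mul_comm,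
      ← Matrix.mul_assoc]
    simp [Matrix.trace]
  have hc : ∀ g : ℝ → ℝ, ContinuousOn g (spectrum ℝ A) := fun g =>
    (Set.toFinite _).continuousOn g
  refine ⟨cfc (fun x : ℝ => max x 0) A, cfc (fun x : ℝ => max (-x) 0) A, ?_, ?_, ?_, ?_⟩
  · exact Matrix.nonneg_iff_posSemidef.1 (cfc_nonneg fun x _ => le_max_right _ _)
  · exact Matrix.nonneg_iff_posSemidef.1 (cfc_nonneg fun x _ => le_max_right _ _)
  · rw [← cfc_sub _ _ A (hc _) (hc _)]
    have : (fun x : ℝ => max x 0 - max (-x) 0) = id := by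
      funext x
      rcases le_total x 0 with h | h
      · simp [h]
      · simp [h]
    rw [this, cfc_id ℝ A hA.isSelfAdjoint]
  · rw [htr, htr, traceNorm_eq_sum_abs hA, ← Finset.sum_add_distrib]
    refine Finset.sum_congr rfl fun i _ => ?_
    rcases le_total (hA.eigenvalues i) 0 with h | h
    · simp [h, abs_of_nonpos]
    · simp [h, abs_of_nonneg]

theorem posSemidef_blockDiagonal {κ : Type} [Fintype κ] [DecidableEq κ] {ρ : κ → Mat X}
    (h : ∀ k, (ρ k).PosSemidef) : (Matrix.blockDiagonal ρ).PosSemidef := by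
  choose S hS using fun k => CStarAlgebra.nonneg_iff_eq_star_mul_self.1
    (Matrix.nonneg_iff_posSemidef.2 (h k))
  have : Matrix.blockDiagonal ρ = (Matrix.blockDiagonal S)ᴴ * Matrix.blockDiagonal S := by
    rw [Matrix.blockDiagonal_conjTranspose, ← Matrix.blockDiagonal_mul]
    congr 1
    funext k
    exact hS k
  rw [this]
  exact Matrix.posSemidef_conjTranspose_mul_self _

end TraceNorm

/-! ### Closeness of families of operators -/

/-- Two families of operators are `ε`-close: the difference is a difference of positive families
whose traces sum to at most `ε`. For Hermitian blocks this says that the trace norm of the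
difference of the block diagonal operators is at most `ε`. -/
def Close {ι : Type} [Fintype ι] {X : ι → Type} [∀ i, Fintype (X i)] (ρ σ : ∀ i, Mat (X i))
    (ε : ℝ) : Prop :=
  ∃ P N : ∀ i, Mat (X i), (∀ i, (P i).PosSemidef) ∧ (∀ i, (N i).PosSemidef) ∧
    (∀ i, ρ i + N i = σ i + P i) ∧ ∑ i, ((P i).trace.re + (N i).trace.re) ≤ ε

namespace Close

variable {ι κ : Type} [Fintype ι] [Fintype κ] {X : ι → Type} [∀ i, Fintype (X i)] {Y : κ → Type}
  [∀ i, Fintype (Y i)]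

theorem refl (ρ : ∀ i, Mat (X i)) : Close ρ ρ 0 :=
  ⟨fun _ => 0, fun _ => 0, fun _ => .zero, fun _ => .zero, fun _ => rfl, by simp⟩

theorem trans {ρ σ τ : ∀ i, Mat (X i)} {ε δ : ℝ} (h : Close ρ σ ε) (h' : Close σ τ δ) :
    Close ρ τ (ε + δ) := by
  obtain ⟨P, N, hP, hN, he, ht⟩ := h
  obtain ⟨P', N', hP', hN', he', ht'⟩ := h'
  refine ⟨fun i => P i + P' i, fun i => N i + N' i, fun i => (hP i).add (hP' i),
    fun i => (hN i).add (hN' i), fun i => ?_, ?_⟩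
  · rw [← add_assoc, he i, add_right_comm, he' i, add_right_comm, add_assoc]
  · simp only [Matrix.trace_add, Complex.add_re]
    simp only [Finset.sum_add_distrib] at ht ht' ⊢
    linarith

theorem map {ρ σ : ∀ i, Mat (X i)} {ε : ℝ} (h : Close ρ σ ε)
    (T : (∀ i, Mat (X i)) → ∀ k, Mat (Y k)) (hadd : ∀ ρ σ k, T (ρ + σ) k = T ρ k + T σ k)
    (hpos : ∀ ρ, (∀ i, (ρ i).PosSemidef) → ∀ k, (T ρ k).PosSemidef)
    (htr : ∀ ρ, (∀ i, (ρ i).PosSemidef) → ∑ k, (T ρ k).trace.re ≤ ∑ i, (ρ i).trace.re) :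
    Close (T ρ) (T σ) ε := by
  obtain ⟨P, N, hP, hN, he, ht⟩ := h
  refine ⟨T P, T N, hpos P hP, hpos N hN, fun k => ?_, le_trans ?_ ht⟩
  · rw [← hadd, ← hadd, show ρ + N = σ + P from funext he]
  · rw [Finset.sum_add_distrib, Finset.sum_add_distrib]
    exact add_le_add (htr P hP) (htr N hN)

theorem congr {ρ σ ρ' σ' : ∀ i, Mat (X i)} {ε : ℝ} (h : Close ρ σ ε) (h1 : ∀ i, ρ' i = ρ i)
    (h2 : ∀ i, σ' i = σ i) : Close ρ' σ' ε := by
  rwa [funext h1, funext h2]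

end Close

section Blocks

variable {X κ : Type} [Fintype X] [DecidableEq X] [Fintype κ] [DecidableEq κ]

theorem traceNorm_blockDiagonal_sub_le {ρ σ : κ → Mat X} {ε : ℝ}
    (h : Close (X := fun _ => X) ρ σ ε) :
    traceNorm (Matrix.blockDiagonal ρ - Matrix.blockDiagonal σ) ≤ ε := by
  obtain ⟨P, N, hP, hN, he, ht⟩ := h
  have h1 : Matrix.blockDiagonal ρ - Matrix.blockDiagonal σ =
      Matrix.blockDiagonal P - Matrix.blockDiagonal N := by
    rw [← Matrix.blockDiagonal_sub, ← Matrix.blockDiagonal_sub]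
    congr 1
    funext k
    exact sub_eq_sub_iff_add_eq_add.2 ((he k).trans (add_comm _ _))
  rw [h1]
  refine (traceNorm_sub_le (posSemidef_blockDiagonal hP) (posSemidef_blockDiagonal hN)).trans ?_
  rwa [Matrix.trace_blockDiagonal, Matrix.trace_blockDiagonal, Complex.re_sum, Complex.re_sum,
    ← Finset.sum_add_distrib]

theorem close_of_traceNorm_le {ρ σ : κ → Mat X} {ε : ℝ} (hρ : ∀ k, (ρ k).PosSemidef)
    (hσ : ∀ k, (σ k).PosSemidef)
    (h : traceNorm (Matrix.blockDiagonal ρ - Matrix.blockDiagonal σ) ≤ ε) :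
    Close (X := fun _ => X) ρ σ ε := by
  obtain ⟨P, N, hP, hN, he, ht⟩ := exists_posSemidef_sub
    ((posSemidef_blockDiagonal hρ).1.sub (posSemidef_blockDiagonal hσ).1)
  refine ⟨fun k => P.submatrix (fun x => (x, k)) (fun x => (x, k)),
    fun k => N.submatrix (fun x => (x, k)) (fun x => (x, k)), fun k => hP.submatrix _,
    fun k => hN.submatrix _, fun k => ?_, ?_⟩
  · ext x y
    have := congrFun (congrFun he (x, k)) (y, k)
    simp only [Matrix.sub_apply, Matrix.blockDiagonal_apply_eq] at this
    simp only [Matrix.add_apply, Matrix.submatrix_apply]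
    linear_combination this
  · rw [Finset.sum_add_distrib]
    have htr : ∀ B : Mat (X × κ),
        ∑ k, (B.submatrix (fun x => (x, k)) (fun x => (x, k))).trace.re = B.trace.re := fun B => by
      simp only [Matrix.trace, Matrix.diag, Matrix.submatrix_apply, Fintype.sum_prod_type,
        Complex.re_sum]
      exact Finset.sum_comm
    rw [htr, htr, ht]
    exact h

end Blocks

/-! ### Extensions of a state are obtained from its canonical purification -/

section Extension

variable {Y : Type} [Fintype Y] [DecidableEq Y]

omit [DecidableEq Y] in
theorem posSemidef_rest_conjL {X Z : Type} [Fintype X] [Fintype Z] (G : Matrix X Y ℂ)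
    {ρ : Mat (Z × Y)} (h : ρ.PosSemidef) : (rest (conjL G) ρ).PosSemidef := by
  classical
  rw [rest_conjL]
  exact h.mul_mul_conjTranspose_same _

/-- Every extension of `η` is the image of the canonical purification of `η` under a completely
positive trace-non-increasing map on the purifying register; here for an extension that consists
of a family of blocks `ω i`. -/
theorem exists_rest_purify {ι : Type} [Fintype ι] {E : ι → Type} [∀ i, Fintype (E i)]
    [∀ i, DecidableEq (E i)] {η : Mat Y} (hη : η.PosSemidef) (ω : ∀ i, Mat (Y × E i))
    (hω : ∀ i, (ω i).PosSemidef) (hsum : ∀ y y', ∑ i, ∑ e, ω i (y, e) (y', e) = η y y') :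
    ∃ Γ : ∀ i, Mat Y →ₗ[ℂ] Mat (E i), (∀ i, rest (Γ i) (purify η) = ω i) ∧
      (∀ (i : ι) (Z : Type) [Fintype Z] (ρ : Mat (Z × Y)), ρ.PosSemidef →
        (rest (Γ i) ρ).PosSemidef) ∧
      (∀ (Z : Type) [Fintype Z] (ρ : Mat (Z × Y)), ρ.PosSemidef →
        ∑ i, (rest (Γ i) ρ).trace.re ≤ ρ.trace.re) := by
  have hc : ∀ g : ℝ → ℝ, ContinuousOn g (spectrum ℝ η) := fun g =>
    (Set.toFinite _).continuousOn g
  have hη0 : 0 ≤ η := Matrix.nonneg_iff_posSemidef.2 hη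
  have hspec : ∀ x ∈ spectrum ℝ η, 0 ≤ x := fun x hx => spectrum_nonneg_of_nonneg hη0 hx
  -- `B` is the pseudo-inverse of the square root of `η`, and `Q` the projection onto the support.
  let B : Mat Y := cfc (fun x : ℝ => (√x)⁻¹) η
  let Q : Mat Y := cfc (fun x : ℝ => √x * (√x)⁻¹) η
  have hself : IsSelfAdjoint η := hη.1
  have hsqrt : CFC.sqrt η = cfc Real.sqrt η := by
    rw [CFC.sqrt_eq_real_sqrt η hη0, cfcₙ_eq_cfc (hf := Real.continuous_sqrt.continuousOn)
      (hf0 := Real.sqrt_zero)]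
  have hid : cfc (fun x : ℝ => x) η = η := cfc_id' ℝ η hself
  have hSB : CFC.sqrt η * B = Q := by
    rw [hsqrt, ← cfc_mul _ _ η (hc _) (hc _)]
  have hB : Bᴴ = B := (cfc_predicate (R := ℝ) (p := IsSelfAdjoint) (fun x : ℝ => (√x)⁻¹) η)
  have hQ : Qᴴ = Q := (cfc_predicate (R := ℝ) (p := IsSelfAdjoint) (fun x : ℝ => √x * (√x)⁻¹) η)
  have hQη : Q * η = η := by
    trans Q * cfc (fun x : ℝ => x) η
    · rw [hid]
    rw [← cfc_mul _ _ η (hc _) (hc _)]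
    conv_rhs => rw [← hid]
    refine cfc_congr fun x hx => ?_
    rcases eq_or_lt_of_le (hspec x hx) with h | h
    · simp [← h]
    · simp [mul_inv_cancel₀ (Real.sqrt_ne_zero'.2 h)]
  have hQQ : Q * Q = Q := by
    rw [← cfc_mul _ _ η (hc _) (hc _)]
    refine cfc_congr fun x hx => ?_
    rcases eq_or_lt_of_le (hspec x hx) with h | h
    · simp [← h]
    · simp [mul_inv_cancel₀ (Real.sqrt_ne_zero'.2 h)]
  have hBηB : B * η * B = Q := by
    trans B * cfc (fun x : ℝ => x) η * B
    · rw [hid]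
    rw [← cfc_mul _ _ η (hc _) (hc _), ← cfc_mul _ _ η (hc _) (hc _)]
    refine cfc_congr fun x hx => ?_
    rcases eq_or_lt_of_le (hspec x hx) with h | h
    · simp [← h]
    · have := Real.sqrt_ne_zero'.2 h
      field_simp
      rw [Real.sq_sqrt h.le]
  -- A decomposition of `ω i` into rank-one operators, whose vectors are read as matrices `V i k`.
  choose R hR using fun i => CStarAlgebra.nonneg_iff_eq_star_mul_self.1
    (Matrix.nonneg_iff_posSemidef.2 (hω i))
  let V : ∀ i, (Y × E i) → Matrix Y (E i) ℂ := fun i k => Matrix.of fun y e => star (R i k (y, e))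
  have hVω : ∀ i y e y' e', ∑ k, V i k y e * star (V i k y' e') = ω i (y, e) (y', e') := by
    intro i y e y' e'
    rw [hR i, Matrix.star_eq_conjTranspose, Matrix.mul_apply]
    simp [V]
  have hVη : ∑ i, ∑ k, V i k * (V i k)ᴴ = η := by
    ext y y'
    simp only [Matrix.sum_apply, Matrix.mul_apply, Matrix.conjTranspose_apply]
    rw [← hsum]
    refine Finset.sum_congr rfl fun i _ => ?_
    rw [Finset.sum_comm]
    exact Finset.sum_congr rfl fun e _ => hVω i y e y' e
  -- The columns of `V i k` lie in the support of `η`.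
  have hQV : ∀ i k, Q * V i k = V i k := by
    have h1 : ∑ i, ∑ k, ((1 - Q) * V i k) * ((1 - Q) * V i k)ᴴ = 0 := by
      have : ∀ i k, ((1 - Q) * V i k) * ((1 - Q) * V i k)ᴴ =
          (1 - Q) * (V i k * (V i k)ᴴ) * (1 - Q)ᴴ := fun i k => by
        rw [Matrix.conjTranspose_mul]
        simp only [Matrix.mul_assoc]
      simp only [this, ← Matrix.sum_mul, ← Matrix.mul_sum, hVη]
      rw [Matrix.sub_mul 1 Q η, hQη, Matrix.one_mul, sub_self, Matrix.zero_mul]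
    have h2 := congrArg Matrix.trace h1
    simp only [Matrix.trace_sum, Matrix.trace_zero] at h2
    have hnn : ∀ i k, 0 ≤ (((1 - Q) * V i k) * ((1 - Q) * V i k)ᴴ).trace := fun i k =>
      (Matrix.posSemidef_self_mul_conjTranspose _).trace_nonneg
    intro i k
    have h3 := (Finset.sum_eq_zero_iff_of_nonneg fun i _ => Finset.sum_nonneg fun k _ => hnn i k).1
      h2 i (Finset.mem_univ _)
    have h4 := (Finset.sum_eq_zero_iff_of_nonneg fun k _ => hnn i k).1 h3 k (Finset.mem_univ _)
    have h5 := Matrix.trace_mul_conjTranspose_self_eq_zero_iff.1 h4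
    rw [Matrix.sub_mul, Matrix.one_mul, sub_eq_zero] at h5
    exact h5.symm
  -- The Kraus operators of `Γ i`: they send the vector `∑ √η |r⟩ ⊗ |r⟩` to the vector of `V i k`.
  let G : ∀ i, (Y × E i) → Matrix (E i) Y ℂ := fun i k => (B * V i k)ᵀ
  refine ⟨fun i => ∑ k, conjL (G i k), fun i => ?_, fun i Z _ ρ h => ?_, fun Z _ ρ h => ?_⟩
  · ext ⟨y, e⟩ ⟨y', e'⟩
    have hG : ∀ k y e, ∑ r, G i k e r * CFC.sqrt η y r = V i k y e := fun k y e => by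
      have : (CFC.sqrt η * (B * V i k)) y e = V i k y e := by
        rw [← Matrix.mul_assoc, hSB, hQV]
      rw [← this, Matrix.mul_apply]
      exact Finset.sum_congr rfl fun r _ => mul_comm _ _
    rw [rest_sum, Matrix.sum_apply, ← hVω]
    refine Finset.sum_congr rfl fun k _ => ?_
    rw [rest_apply, conjL_entry, ← hG k y e, ← hG k y' e', star_sum, Finset.sum_mul_sum]
    refine Finset.sum_congr rfl fun r _ => Finset.sum_congr rfl fun r' _ => ?_
    simp only [Matrix.of_apply, purify, Matrix.vecMulVec_apply, Pi.star_apply, star_mul']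
    ring
  · rw [rest_sum]
    exact Matrix.posSemidef_sum _ fun k _ => posSemidef_rest_conjL _ h
  · have hσ : (trFst ρ).PosSemidef := posSemidef_trFst h
    rw [← trace_trFst ρ]
    simp only [trace_rest]
    generalize trFst ρ = σ at hσ
    -- The maps `Γ i` are jointly trace non-increasing, since `Q` is a projection.
    have h1 : ∑ i, ∑ k, (G i k)ᴴ * G i k = Qᵀ := by
      have : ∀ i k, (G i k)ᴴ * G i k = (B * (V i k * (V i k)ᴴ) * B)ᵀ := fun i k => by
        simp only [G]
        rw [Matrix.conjTranspose_transpose_eq_transpose_conjTranspose, ← Matrix.transpose_mul,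
          Matrix.conjTranspose_mul, hB]
        simp only [Matrix.mul_assoc]
      simp only [this, ← Matrix.transpose_sum, ← Matrix.sum_mul, ← Matrix.mul_sum, hVη, hBηB]
    have h2 : ∑ i, ((∑ k, conjL (G i k)) σ).trace = (Qᵀ * σ).trace := by
      rw [← h1]
      simp only [LinearMap.sum_apply, conjL_apply, Matrix.trace_sum, Matrix.sum_mul]
      refine Finset.sum_congr rfl fun i _ => Finset.sum_congr rfl fun k _ => ?_
      rw [Matrix.trace_mul_comm, ← Matrix.mul_assoc]
    have h3 : 0 ≤ ((1 - Q)ᵀ * σ * ((1 - Q)ᵀ)ᴴ).trace :=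
      (hσ.mul_mul_conjTranspose_same _).trace_nonneg
    have h4 : ((1 - Q)ᵀ)ᴴ * (1 - Q)ᵀ = 1 - Qᵀ := by
      rw [Matrix.conjTranspose_transpose_eq_transpose_conjTranspose, ← Matrix.transpose_mul,
        Matrix.conjTranspose_sub, hQ, Matrix.conjTranspose_one, Matrix.mul_sub, Matrix.sub_mul,
        Matrix.sub_mul, hQQ]
      simp
    rw [Matrix.trace_mul_comm, ← Matrix.mul_assoc, h4, Matrix.sub_mul, Matrix.one_mul,
      Matrix.trace_sub, ← h2] at h3
    have h5 := (Complex.le_def.1 h3).1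
    simp only [Complex.zero_re, Complex.sub_re, Complex.re_sum] at h5
    linarith

theorem posSemidef_purify (η : Mat Y) : (purify η).PosSemidef := by
  exact Matrix.posSemidef_vecMulVec_self_star _

theorem purify_sum_snd {η : Mat Y} (hη : η.PosSemidef) (y y' : Y) :
    ∑ r, purify η (y, r) (y', r) = η y y' := by
  have hη0 : 0 ≤ η := Matrix.nonneg_iff_posSemidef.2 hη
  have h : (CFC.sqrt η)ᴴ = CFC.sqrt η := (CFC.sqrt_nonneg η).isSelfAdjoint
  conv_rhs => rw [← CFC.sqrt_mul_sqrt_self η hη0]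
  conv_rhs => rw [Matrix.mul_apply]
  refine Finset.sum_congr rfl fun r _ => ?_
  rw [show CFC.sqrt η r y' = star (CFC.sqrt η y' r) by rw [← Matrix.conjTranspose_apply, h]]
  rfl

theorem trace_purify {η : Mat Y} (hη : η.PosSemidef) : (purify η).trace = η.trace := by
  simp only [Matrix.trace, Matrix.diag, Fintype.sum_prod_type]
  exact Finset.sum_congr rfl fun y _ => purify_sum_snd hη y y

end Extension

/-! ### Initial states -/

theorem IsDensity.kronecker {X Y : Type} [Fintype X] [Fintype Y] {ρ : Mat X} {σ : Mat Y}
    (hρ : IsDensity ρ) (hσ : IsDensity σ) : IsDensity (ρ ⊗ₖ σ) := by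
  classical
  refine ⟨hρ.1.kronecker hσ.1, ?_⟩
  rw [Matrix.trace_kronecker, hρ.2, hσ.2, one_mul]

theorem IsDensity.submatrix {X Y : Type} [Fintype X] [Fintype Y] {ρ : Mat X} (hρ : IsDensity ρ)
    (e : Y ≃ X) : IsDensity (ρ.submatrix e e) :=
  ⟨hρ.1.submatrix _, (e.sum_comp fun j => ρ j j).trans hρ.2⟩

theorem isDensity_one_unit : IsDensity (1 : Mat (Unit × Unit)) :=
  ⟨Matrix.PosSemidef.one, by simp⟩

theorem isDensity_viewFor {reg : Party → Reg} {ρ : Mat (reg .alice × reg .bob)} (h : IsDensity ρ)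
    (p : Party) : IsDensity (viewFor ρ p) := by
  cases p with
  | alice => exact h.submatrix (Equiv.prodComm _ _)
  | bob => exact h

theorem Resource.isDensity_state {f : Functionality} (r : Resource f) (d : r.Dev) :
    IsDensity (r.state d) := by
  cases r with
  | ideal => exact isDensity_one_unit
  | run P => exact Device.isDensity d

theorem CallDevs.isDensity_state {f : Functionality} {r : Resource f} {sh : Shape}
    (ds : CallDevs r sh) (p : Party) : IsDensity (ds.state p) := by
  induction ds with
  | last => exact isDensity_one_unit
  | call d ds ih =>
    exact ((isDensity_viewFor (r.isDensity_state d) p).kronecker ih).submatrix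
      (Equiv.prodProdProdComm _ _ _ _)

section Attacks

variable {g : Functionality} {Q : Protocol g} {p : Party} {D : Q.Devices}

theorem Attack.isDensity_init (a : Attack Q p D) : IsDensity a.init := by
  let e : ((a.A₀ × D.main.reg p.other × D.calls.reg p.other) ×
        (g.In p × D.main.reg p × D.calls.reg p)) ≃
      (((a.A₀ × g.In p) × (D.main.reg p.other × D.main.reg p)) ×
        (D.calls.reg p.other × D.calls.reg p)) :=
    { toFun := fun i => (((i.1.1, i.2.1), (i.1.2.1, i.2.2.1)), (i.1.2.2, i.2.2.2))
      invFun := fun j => ((j.1.1.1, j.1.2.1, j.2.1), (j.1.1.2, j.1.2.2, j.2.2)) }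
  exact ((a.isDensity.kronecker (isDensity_viewFor D.main.isDensity p)).kronecker
    (D.calls.isDensity_state p)).submatrix e

/-- The purified initial state when the honest party has input `x`, with the registers arranged as
they are for an execution of the protocol. -/
noncomputable def Attack.start (a : Attack Q p D) (x : g.In p) :
    Mat ((a.A₀ × D.main.reg p.other) × Unit × D.main.reg p ×
      (D.calls.reg p.other × D.calls.reg p) × a.initReg) :=
  (purify a.init).submatrix
    (fun i => ((((i.1.1, i.1.2, i.2.2.2.1.1), (x, i.2.2.1, i.2.2.2.1.2)), i.2.2.2.2)))
    (fun i => ((((i.1.1, i.1.2, i.2.2.2.1.1), (x, i.2.2.1, i.2.2.2.1.2)), i.2.2.2.2)))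

/-- The purified initial state when the honest party has input `x` and its shares of the devices
are discarded. -/
noncomputable def Attack.startIdeal (a : Attack Q p D) (x : g.In p) :
    Mat (a.cheatReg × a.initReg) :=
  trace₂ (Z := a.honestDevReg) ((purify a.init).submatrix
    (fun i => ((i.1, (x, i.2.1)), i.2.2)) (fun i => ((i.1, (x, i.2.1)), i.2.2)))

theorem Attack.posSemidef_start (a : Attack Q p D) (x : g.In p) : (a.start x).PosSemidef :=
  (posSemidef_purify a.init).submatrix _

theorem Attack.posSemidef_startIdeal (a : Attack Q p D) (x : g.In p) :
    (a.startIdeal x).PosSemidef :=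
  posSemidef_trace₂ (Z := a.cheatReg) ((posSemidef_purify a.init).submatrix _)

theorem Attack.sum_trace_start (a : Attack Q p D) : ∑ x, (a.start x).trace = 1 := by
  rw [← a.isDensity_init.2, ← trace_purify a.isDensity_init.1]
  let e : (g.In p × ((a.A₀ × D.main.reg p.other) × Unit × D.main.reg p ×
      (D.calls.reg p.other × D.calls.reg p) × a.initReg)) ≃ (a.initReg × a.initReg) :=
    { toFun := fun i => ((((i.2.1.1, i.2.1.2, i.2.2.2.2.1.1), (i.1, i.2.2.2.1, i.2.2.2.2.1.2)),
        i.2.2.2.2.2))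
      invFun := fun j => (j.1.2.1, ((j.1.1.1, j.1.1.2.1), (), j.1.2.2.1, (j.1.1.2.2, j.1.2.2.2),
        j.2)) }
  have h := e.sum_comp fun j => purify a.init j j
  rw [Fintype.sum_prod_type] at h
  exact h

theorem Attack.sum_trace_startIdeal (a : Attack Q p D) : ∑ x, (a.startIdeal x).trace = 1 := by
  rw [← a.isDensity_init.2, ← trace_purify a.isDensity_init.1]
  let e : (g.In p × (a.cheatReg × a.honestDevReg × a.initReg)) ≃ (a.initReg × a.initReg) :=
    { toFun := fun i => ((i.2.1, (i.1, i.2.2.1)), i.2.2.2)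
      invFun := fun j => (j.1.2.1, (j.1.1, j.1.2.2, j.2)) }
  have h := e.sum_comp fun j => purify a.init j j
  rw [Fintype.sum_prod_type] at h
  refine Eq.trans (Finset.sum_congr rfl fun x _ => ?_) h
  exact trace_trace₂ (Z := a.cheatReg) (Y := a.honestDevReg) _

/-- A bound on the error says that the blocks of the final states are close. -/
theorem Attack.close_of_error_le (a : Attack Q p D) (sim : a.Simulator) {ε : ℝ}
    (h : a.error sim ≤ ε) :
    Close (X := fun _ : Option (g.Out p) × g.In p => a.V × a.initReg)
      (fun ox => runIdeal g ox.2 sim (a.startIdeal ox.2) ox.1)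
      (fun ox => runProg (A := a.A₀.prod (D.main.reg p.other)) (W := .unit) D.main Q.resource p
        (Q.oracle.prog p ox.2) a.strategy (a.start ox.2) ox.1) ε := by
  refine close_of_traceNorm_le (fun ox => ?_) (fun ox => ?_) h
  · exact posSemidef_runIdeal g ox.2 sim (a.posSemidef_startIdeal ox.2) ox.1
  · exact posSemidef_runProg (A := a.A₀.prod (D.main.reg p.other)) (W := .unit) D.main Q.resource p
      (Q.oracle.prog p ox.2) a.strategy (a.posSemidef_start ox.2) ox.1

theorem Attack.error_le_of_close (a : Attack Q p D) (sim : a.Simulator) {ε : ℝ}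
    (h : Close (X := fun _ : Option (g.Out p) × g.In p => a.V × a.initReg)
      (fun ox => runIdeal g ox.2 sim (a.startIdeal ox.2) ox.1)
      (fun ox => runProg (A := a.A₀.prod (D.main.reg p.other)) (W := .unit) D.main Q.resource p
        (Q.oracle.prog p ox.2) a.strategy (a.start ox.2) ox.1) ε) : a.error sim ≤ ε :=
  traceNorm_blockDiagonal_sub_le h

theorem Attack.error_nonneg (a : Attack Q p D) (sim : a.Simulator) : 0 ≤ a.error sim :=
  Finset.sum_nonneg fun _ _ => Real.sqrt_nonneg _

theorem Attack.error_le_two (a : Attack Q p D) (sim : a.Simulator) : a.error sim ≤ 2 := by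
  refine a.error_le_of_close sim ⟨fun ox => runIdeal g ox.2 sim (a.startIdeal ox.2) ox.1,
    fun ox => runProg (A := a.A₀.prod (D.main.reg p.other)) (W := .unit) D.main Q.resource p
        (Q.oracle.prog p ox.2) a.strategy (a.start ox.2) ox.1, fun ox => ?_, fun ox => ?_,
    fun ox => add_comm _ _, le_of_eq ?_⟩
  · exact posSemidef_runIdeal g ox.2 sim (a.posSemidef_startIdeal ox.2) ox.1
  · exact posSemidef_runProg (A := a.A₀.prod (D.main.reg p.other)) (W := .unit) D.main Q.resource p
      (Q.oracle.prog p ox.2) a.strategy (a.posSemidef_start ox.2) ox.1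
  · rw [Finset.sum_add_distrib, Fintype.sum_prod_type_right, Fintype.sum_prod_type_right]
    simp only [← Complex.re_sum]
    simp only [sum_trace_runIdeal, a.sum_trace_startIdeal]
    have h : ∀ x, ∑ o, (runProg (A := a.A₀.prod (D.main.reg p.other)) (W := .unit) D.main
        Q.resource p (Q.oracle.prog p x) a.strategy (a.start x) o).trace = (a.start x).trace :=
      fun x => sum_trace_runProg (A := a.A₀.prod (D.main.reg p.other)) (W := .unit) D.main
        Q.resource p (Q.oracle.prog p x) a.strategy (a.start x)
    simp only [h, a.sum_trace_start]
    norm_num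

end Attacks

/-! ### A uniform bound on the errors of the best simulators -/

theorem negligible_two_mul_half_pow : Negligible fun n => 2 * (1 / 2 : ℝ) ^ n := by
  intro k
  have h := (tendsto_pow_const_mul_const_pow_of_abs_lt_one k
    (r := (1 / 2 : ℝ)) (by norm_num [abs_of_pos])).const_mul 2
  rw [mul_zero] at h
  exact h.congr fun n => by ring

/-- Augmented security gives one negligible bound for all attacks with devices in the class: for
every security parameter an attack is chosen whose best simulator is, up to a factor of two and up
to `2⁻ⁿ`, as bad as possible, and security is applied to this family of attacks. -/
theorem AugmentedSecure.exists_uniform {g : ℕ → Functionality} {Q : (n : ℕ) → Protocol (g n)}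
    {𝔇 : (n : ℕ) → Set (Q n).Devices} (h : AugmentedSecure Q 𝔇) (p : Party)
    (hne : ∀ n, ∃ D ∈ 𝔇 n, Nonempty (Attack (Q n) p D)) :
    ∃ ν : ℕ → ℝ, Negligible ν ∧ (∀ n, 0 ≤ ν n) ∧ ∀ n, ∀ D ∈ 𝔇 n, ∀ a : Attack (Q n) p D,
      ∃ sim : a.Simulator, a.error sim ≤ ν n := by
  classical
  have hfam : ∀ t : ∀ n, Σ D : 𝔇 n, Attack (Q n) p D.1, ∃ sim : ∀ n, (t n).2.Simulator,
      ∃ ν : ℕ → ℝ, Negligible ν ∧ ∀ n, (t n).2.error (sim n) ≤ ν n := fun t =>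
    h p (fun n => (t n).1.1) (fun n => (t n).1.2) fun n => (t n).2
  have t₀ : ∀ n, Nonempty (Σ D : 𝔇 n, Attack (Q n) p D.1) := fun n => by
    obtain ⟨D, hD, ⟨a⟩⟩ := hne n
    exact ⟨⟨⟨D, hD⟩, a⟩⟩
  have hsim : ∀ n (t : Σ D : 𝔇 n, Attack (Q n) p D.1), Nonempty t.2.Simulator := fun n t => by
    obtain ⟨sim, -⟩ := hfam (Function.update (fun m => (t₀ m).some) n t)
    have := sim n
    rw [Function.update_self] at this
    exact ⟨this⟩
  -- `good n k` says that every attack has a simulator with error at most `2 * 2⁻ᵏ`.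
  let good (n k : ℕ) : Prop := ∀ t : Σ D : 𝔇 n, Attack (Q n) p D.1, ∃ sim : t.2.Simulator,
    t.2.error sim ≤ 2 * (1 / 2) ^ k
  have hgood : ∀ n, good n 0 := fun n t => by
    obtain ⟨sim⟩ := hsim n t
    exact ⟨sim, by simpa using t.2.error_le_two sim⟩
  let K : ℕ → ℕ := fun n => Nat.findGreatest (good n) n
  have hK : ∀ n, good n (K n) := fun n => Nat.findGreatest_spec (Nat.zero_le n) (hgood n)
  have hbad : ∀ n, ∃ t : Σ D : 𝔇 n, Attack (Q n) p D.1, K n < n → ∀ sim : t.2.Simulator,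
      2 * (1 / 2) ^ (K n + 1) < t.2.error sim := fun n => by
    by_cases hn : K n < n
    · have := Nat.findGreatest_is_greatest (P := good n) (Nat.lt_succ_self (K n)) hn
      simp only [good, not_forall, not_exists, not_le] at this
      obtain ⟨t, ht⟩ := this
      exact ⟨t, fun _ => ht⟩
    · exact ⟨(t₀ n).some, fun h => absurd h hn⟩
  choose t ht using hbad
  obtain ⟨sim, ν, hν, hle⟩ := hfam t
  have hν0 : ∀ n, 0 ≤ ν n := fun n => ((t n).2.error_nonneg (sim n)).trans (hle n)
  refine ⟨fun n => ν n * 2 + 2 * (1 / 2) ^ n, (hν.mul_const 2).add negligible_two_mul_half_pow,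
    fun n => add_nonneg (mul_nonneg (hν0 n) zero_le_two) (by positivity), fun n D hD a => ?_⟩
  obtain ⟨s, hs⟩ := hK n ⟨⟨D, hD⟩, a⟩
  refine ⟨s, hs.trans ?_⟩
  by_cases hn : K n < n
  · have h1 := (ht n hn (sim n)).trans_le (hle n)
    have h2 : (0 : ℝ) < (1 / 2) ^ n := by positivity
    rw [pow_succ] at h1
    linarith
  · have : K n = n := le_antisymm (Nat.findGreatest_le n) (not_lt.1 hn)
    rw [this]
    linarith [mul_nonneg (hν0 n) zero_le_two]

/-- The identity channel. -/
noncomputable def Channel.id (A : Reg) : Channel A A where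
  n := 1
  K _ _ := 1
  trace_preserving := by simp

/-- The instrument that does nothing and reports a fixed outcome. -/
noncomputable def Instrument.const (A : Reg) (M : Reg) : Instrument A A M where
  n := 1
  K m _ := if m = Classical.arbitrary M then 1 else 0
  trace_preserving := by simp

/-- A strategy that does nothing. -/
noncomputable def Cheat.idle (A : Reg) : (s : Sched) → Cheat s A A
  | .done => .done
  | .send _ s => .send (fun _ => Channel.id A) (Cheat.idle A s)
  | .recv M s => .recv (Instrument.const A M) (Cheat.idle A s)

theorem exists_isDensity (X : Type) [Fintype X] [Nonempty X] : ∃ ρ : Mat X, IsDensity ρ := by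
  classical
  let v : X → ℂ := Pi.single (Classical.arbitrary X) 1
  exact ⟨Matrix.vecMulVec v (star v), Matrix.posSemidef_vecMulVec_self_star v,
    by simp [v, Matrix.trace, Matrix.vecMulVec_apply, Pi.single_apply, apply_ite]⟩

theorem PlainProtocol.nonempty_attack {f : Functionality} (P : PlainProtocol f) (p : Party)
    (D : P.toProtocol.Devices) : Nonempty (Attack P.toProtocol p D) := by
  obtain ⟨main, calls⟩ := D
  cases calls
  obtain ⟨φ, hφ⟩ := exists_isDensity ((Reg.unit).prod (f.In p))
  exact ⟨⟨.unit, φ, hφ, _, .last (Cheat.idle _ _)⟩⟩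

/-! ### Strategies of a party that holds an additional register -/

section Entries

variable {A B B' C C' : Reg} {X : Type} [Fintype X] [DecidableEq X] {M : Type} [Fintype M]

theorem act₂_apply (I : Instrument B B' M) (m : M) (ρ : Mat (A × B × X)) (i j : A × B' × X) :
    I.act₂ m ρ i j = ∑ k, ∑ a, ∑ b, I.K m k i.2.1 a * ρ (i.1, a, i.2.2) (j.1, b, j.2.2) *
      star (I.K m k j.2.1 b) := by
  rw [act₂_eq, rest_apply, Instrument.lin_apply, act₁_apply]
  rfl

theorem act₃_apply (I : Instrument C C' M) (m : M) (ρ : Mat (A × B × C × X))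
    (i j : A × B × C' × X) :
    I.act₃ m ρ i j = ∑ k, ∑ a, ∑ b, I.K m k i.2.2.1 a *
      ρ (i.1, i.2.1, a, i.2.2.2) (j.1, j.2.1, b, j.2.2.2) * star (I.K m k j.2.2.1 b) := by
  rw [act₃_eq, rest_apply, rest_apply, Instrument.lin_apply, act₁_apply]
  rfl

end Entries

section Join

variable {A B C Y Y' : Type}

/-- Moves a register `C` that is part of `Y`, with remainder `Y'`, to the first register: the
register `B` stands for `A` and `C` jointly. -/
def join (e : B ≃ A × C) (s : C → Y' → Y) (ρ : Mat (A × Y)) : Mat (B × Y') :=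
  ρ.submatrix (fun i => ((e i.1).1, s (e i.1).2 i.2)) (fun i => ((e i.1).1, s (e i.1).2 i.2))

theorem join_apply (e : B ≃ A × C) (s : C → Y' → Y) (ρ : Mat (A × Y)) (i j : B × Y') :
    join e s ρ i j = ρ ((e i.1).1, s (e i.1).2 i.2) ((e j.1).1, s (e j.1).2 j.2) := rfl

theorem join_sum {ι : Type} (e : B ≃ A × C) (s : C → Y' → Y) (t : Finset ι) (ρ : ι → Mat (A × Y)) :
    join e s (∑ k ∈ t, ρ k) = ∑ k ∈ t, join e s (ρ k) := by
  ext i j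
  simp only [join_apply, Matrix.sum_apply]

theorem join_smul (e : B ≃ A × C) (s : C → Y' → Y) (c : ℂ) (ρ : Mat (A × Y)) :
    join e s (c • ρ) = c • join e s ρ := rfl

theorem join_zero (e : B ≃ A × C) (s : C → Y' → Y) : join e s (0 : Mat (A × Y)) = 0 := rfl

/-- The extracted register stands behind a register `W`. -/
abbrev behind {W : Type} (s : C → Y' → Y) : C → W × Y' → W × Y := fun c i => (i.1, s c i.2)

end Join

section Lift

variable {A A' B B' C : Reg} {Y Y' : Type} [Fintype Y] [DecidableEq Y] [Fintype Y']
  [DecidableEq Y'] {M : Type} [Fintype M]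

/-- `I ⊗ id_C`, on registers that stand for the joint registers. -/
noncomputable def Instrument.lift (I : Instrument A A' M) (e : B ≃ A × C) (e' : B' ≃ A' × C) :
    Instrument B B' M where
  n := I.n
  K m k := (I.K m k ⊗ₖ (1 : Mat C)).submatrix e' e
  trace_preserving := by
    have h : ∀ m k, ((I.K m k ⊗ₖ (1 : Mat C)).submatrix e' e)ᴴ *
        (I.K m k ⊗ₖ (1 : Mat C)).submatrix e' e =
        (((I.K m k)ᴴ * I.K m k) ⊗ₖ (1 : Mat C)).submatrix e e := fun m k => by
      rw [Matrix.conjTranspose_submatrix, Matrix.submatrix_mul_equiv,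
        Matrix.conjTranspose_kronecker, ← Matrix.mul_kronecker_mul, Matrix.conjTranspose_one,
        Matrix.mul_one]
    simp only [h]
    have h2 : ∑ m, ∑ k, (((I.K m k)ᴴ * I.K m k) ⊗ₖ (1 : Mat C)).submatrix e e =
        ((∑ m, ∑ k, (I.K m k)ᴴ * I.K m k) ⊗ₖ (1 : Mat C)).submatrix e e := by
      ext i j
      simp only [Matrix.sum_apply, Matrix.submatrix_apply, Matrix.kroneckerMap_apply,
        Finset.sum_mul]
    rw [h2, I.trace_preserving, Matrix.one_kronecker_one, Matrix.submatrix_one_equiv]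

theorem act₁_lift_join (I : Instrument A A' M) (e : B ≃ A × C) (e' : B' ≃ A' × C) (m : M)
    (s : C → Y' → Y) (ρ : Mat (A × Y)) :
    (I.lift e e').act₁ m (join e s ρ) = join e' s (I.act₁ m ρ) := by
  ext i j
  rw [join_apply, act₁_apply, act₁_apply]
  refine Finset.sum_congr rfl fun k _ => ?_
  simp only [Instrument.lift, Matrix.submatrix_apply, join_apply]
  rw [e.sum_comp fun a : A × C => ∑ b, (I.K m k ⊗ₖ (1 : Mat C)) (e' i.1) a *
    ρ (a.1, s a.2 i.2) ((e b).1, s (e b).2 j.2) * star ((I.K m k ⊗ₖ (1 : Mat C)) (e' j.1) (e b))]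
  have h : ∀ a : A × C, ∑ b, (I.K m k ⊗ₖ (1 : Mat C)) (e' i.1) a *
      ρ (a.1, s a.2 i.2) ((e b).1, s (e b).2 j.2) * star ((I.K m k ⊗ₖ (1 : Mat C)) (e' j.1) (e b)) =
      ∑ b : A × C, (I.K m k ⊗ₖ (1 : Mat C)) (e' i.1) a *
      ρ (a.1, s a.2 i.2) (b.1, s b.2 j.2) * star ((I.K m k ⊗ₖ (1 : Mat C)) (e' j.1) b) := fun a =>
    e.sum_comp fun b : A × C => (I.K m k ⊗ₖ (1 : Mat C)) (e' i.1) a *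
      ρ (a.1, s a.2 i.2) (b.1, s b.2 j.2) * star ((I.K m k ⊗ₖ (1 : Mat C)) (e' j.1) b)
  refine (Finset.sum_congr rfl fun a _ => h a).trans ?_
  simp [Fintype.sum_prod_type, Matrix.kroneckerMap_apply, Matrix.one_apply, apply_ite]

theorem act₂_join {W W' : Reg} (I : Instrument W W' M) (e : B ≃ A × C) (m : M) (s : C → Y' → Y)
    (ρ : Mat (A × W × Y)) :
    I.act₂ m (join e (behind s) ρ) = join e (behind s) (I.act₂ m ρ) := by
  ext i j
  simp only [join_apply, act₂_apply]

theorem act₃_join {W D D' : Reg} (I : Instrument D D' M) (e : B ≃ A × C) (m : M) (s : C → Y' → Y)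
    (ρ : Mat (A × W × D × Y)) :
    I.act₃ m (join e (behind (behind s)) ρ) = join e (behind (behind s)) (I.act₃ m ρ) := by
  ext i j
  simp only [join_apply, act₃_apply]

omit [Fintype Y] [DecidableEq Y] [Fintype Y'] [DecidableEq Y'] in
theorem trace₂_join {W : Type} [Fintype W] (e : B ≃ A × C) (s : C → Y' → Y) (ρ : Mat (A × W × Y)) :
    trace₂ (join e (behind s) ρ) = join e s (trace₂ ρ) := rfl

/-- The strategy `adv` of a party that holds the additional register `C` throughout: its final
register, which stands for the final register of `adv` and `C` jointly, and the strategy. -/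
noncomputable def Cheat.lift {C : Reg} : {s : Sched} → {A A' B : Reg} → Cheat s A A' →
    (B ≃ A × C) → (B' : Reg) × (B' ≃ A' × C) × Cheat s B B'
  | _, _, _, B, .done, e => ⟨B, e, .done⟩
  | _, _, _, _, .send (A₁ := A₁) process adv, e =>
      let r := Cheat.lift (B := A₁.prod C) adv (Equiv.refl _)
      ⟨r.1, r.2.1, .send (fun m => (process m).lift e (Equiv.refl _)) r.2.2⟩
  | _, _, _, _, .recv (A₁ := A₁) msg adv, e =>
      let r := Cheat.lift (B := A₁.prod C) adv (Equiv.refl _)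
      ⟨r.1, r.2.1, .recv (msg.lift e (Equiv.refl _)) r.2.2⟩

theorem runCode_lift_join {P : Ports} (D : Device P) (p : Party) {s : Sched}
    {W W' : Reg} (code : Code (P.X p) (P.O p) s W W') (adv : Cheat s A A') (e : B ≃ A × C)
    (t : C → Y' → Y) (ρ : Mat (A × W × D.reg p × Y)) :
    runCode D p code (adv.lift e).2.2 (join e (behind (behind t)) ρ) =
      join (adv.lift e).2.1 (behind (behind t)) (runCode D p code adv ρ) := by
  induction code generalizing A B with
  | done => cases adv; rfl
  | query input output r ih =>
    simp only [runCode, act₂_join, act₃_join, ← join_sum, ih]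
  | send msg r ih =>
    cases adv with | @send _ _ _ A₁ _ process adv =>
    refine (congrArg (runCode D p r (Cheat.lift (B := A₁.prod C) adv (Equiv.refl _)).2.2) ?_).trans
      (ih (B := A₁.prod C) adv (Equiv.refl _) (∑ m, (process m).act₁ () (msg.act₂ m ρ)))
    rw [join_sum]
    refine Finset.sum_congr rfl fun m _ => ?_
    rw [act₂_join]
    exact act₁_lift_join (B' := A₁.prod C) (process m) e (Equiv.refl _) () (behind (behind t)) _
  | recv msg r ih =>
    cases adv with | @recv _ _ _ A₁ _ process adv =>
    refine (congrArg (runCode D p r (Cheat.lift (B := A₁.prod C) adv (Equiv.refl _)).2.2) ?_).trans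
      (ih (B := A₁.prod C) adv (Equiv.refl _) (∑ m, (msg m).act₂ () (process.act₁ m ρ)))
    rw [join_sum]
    refine Finset.sum_congr rfl fun m _ => ?_
    have h := act₁_lift_join process (B' := A₁.prod C) e (Equiv.refl _) m (behind (behind t)) ρ
    rw [← act₂_join, ← h]

theorem runLast_lift_join {P : Ports} (D : Device P) (p : Party) {s : Sched}
    {W Out : Reg} (L : LastPhase (P.X p) (P.O p) s W Out) (adv : Cheat s A A') (e : B ≃ A × C)
    (t : C → Y' → Y) (ρ : Mat (A × W × D.reg p × Y)) (o : Option Out) :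
    runLast D p L (adv.lift e).2.2 (join e (behind (behind t)) ρ) o =
      join (adv.lift e).2.1 t (runLast D p L adv ρ o) := by
  simp only [runLast, runCode_lift_join, act₂_join, trace₂_join]

/-- The strategy `adv` of a party that holds the additional register `C` throughout. -/
noncomputable def IdealCheat.lift {f : Functionality} {C : Reg} : {p : Party} → {A A' B B' : Reg} →
    IdealCheat f p A A' → (B ≃ A × C) → (B' ≃ A' × C) → IdealCheat f p B B'
  | _, _, _, _, _, .alice (A₁ := A₁) input abort, e, e' =>
      .alice (A₁ := A₁.prod C) (input.lift e (Equiv.refl _))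
        (fun o => (abort o).lift (Equiv.refl _) e')
  | _, _, _, _, _, .bob (A₁ := A₁) input process, e, e' =>
      .bob (A₁ := A₁.prod C) (input.lift e (Equiv.refl _))
        (fun o => (process o).lift (Equiv.refl _) e')

theorem runIdeal_lift_join {f : Functionality} {p : Party} (x : f.In p)
    (adv : IdealCheat f p A A') (e : B ≃ A × C) (e' : B' ≃ A' × C) (t : C → Y' → Y)
    (ρ : Mat (A × Y)) (o : Option (f.Out p)) :
    runIdeal f x (adv.lift e e') (join e t ρ) o = join e' t (runIdeal f x adv ρ o) := by
  cases adv with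
  | @alice _ A₁ _ input abort =>
    have h : ∀ oA c a, ((abort oA).lift (B := A₁.prod C) (Equiv.refl _) e').act₁ c
        ((input.lift (B' := A₁.prod C) e (Equiv.refl _)).act₁ a (join e t ρ)) =
        join e' t ((abort oA).act₁ c (input.act₁ a ρ)) := fun oA c a => by
      rw [act₁_lift_join, act₁_lift_join]
    simp only [runIdeal, IdealCheat.lift, h, join_sum]
    refine Finset.sum_congr rfl fun a _ => Finset.sum_congr rfl fun oA _ =>
      Finset.sum_congr rfl fun oB _ => Finset.sum_congr rfl fun c _ => ?_
    by_cases hq : (if c = true then none else oB) = o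
    · rw [if_pos hq, if_pos hq, join_smul]
    · rw [if_neg hq, if_neg hq, join_zero]
  | @bob _ A₁ _ input process =>
    have h : ∀ oB b, ((process oB).lift (B := A₁.prod C) (Equiv.refl _) e').act₁ ()
        ((input.lift (B' := A₁.prod C) e (Equiv.refl _)).act₁ b (join e t ρ)) =
        join e' t ((process oB).act₁ () (input.act₁ b ρ)) := fun oB b => by
      rw [act₁_lift_join, act₁_lift_join]
    simp only [runIdeal, IdealCheat.lift, h, join_sum, join_smul]

/-- The channel that discards `C` and applies `I`. -/
noncomputable def Instrument.discard (I : Channel A A') (e : B ≃ A × C) (e' : B' ≃ A') :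
    Channel B B' where
  n := I.n * Fintype.card C
  K m k := Matrix.of fun b' b => if (e b).2 = (Fintype.equivFin C).symm (finProdFinEquiv.symm k).2
    then I.K m (finProdFinEquiv.symm k).1 (e' b') (e b).1 else 0
  trace_preserving := by
    ext b₁ b₂
    have h := congrFun (congrFun I.trace_preserving (e b₁).1) (e b₂).1
    simp only [Finset.univ_unique, Finset.sum_singleton, Matrix.sum_apply, Matrix.mul_apply,
      Matrix.conjTranspose_apply, Matrix.of_apply] at h ⊢
    rw [← finProdFinEquiv.sum_comp, Fintype.sum_prod_type]
    simp only [Equiv.symm_apply_apply]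
    have hc : ∀ k, ∑ c : Fin (Fintype.card C), ∑ b', star (if (e b₁).2 = (Fintype.equivFin C).symm c
        then I.K default k (e' b') (e b₁).1 else 0) *
        (if (e b₂).2 = (Fintype.equivFin C).symm c then I.K default k (e' b') (e b₂).1 else 0) =
        if (e b₁).2 = (e b₂).2 then
          ∑ a, star (I.K default k a (e b₁).1) * I.K default k a (e b₂).1 else 0 := fun k => by
      rw [(Fintype.equivFin C).symm.sum_comp fun c => ∑ b', star (if (e b₁).2 = c
        then I.K default k (e' b') (e b₁).1 else 0) *
        (if (e b₂).2 = c then I.K default k (e' b') (e b₂).1 else 0)]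
      rw [Finset.sum_comm, ← e'.sum_comp]
      split_ifs with hb
      · simp [hb, apply_ite]
      · simp [hb, apply_ite]
    rw [Finset.sum_congr rfl fun k _ => hc k]
    have h1 : (1 : Mat B) b₁ b₂ =
        if (e b₁).2 = (e b₂).2 then (1 : Mat A) (e b₁).1 (e b₂).1 else 0 := by
      simp only [Matrix.one_apply, ← ite_and, ← e.injective.eq_iff, Prod.ext_iff, and_comm]
    rw [h1]
    split_ifs
    · exact h
    · simp

theorem act₁_discard_join (I : Channel A A') (e : B ≃ A × C) (e' : B' ≃ A')
    (s : C → Y' → Y) (ρ : Mat (A × Y)) :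
    (Instrument.discard I e e').act₁ () (join e s ρ) = Matrix.of fun i j =>
      ∑ c, I.act₁ () ρ (e' i.1, s c i.2) (e' j.1, s c j.2) := by
  ext i j
  simp only [act₁_apply, Matrix.of_apply, Instrument.discard, join_apply]
  rw [← finProdFinEquiv.sum_comp, Fintype.sum_prod_type]
  conv_rhs => rw [Finset.sum_comm]
  refine Finset.sum_congr rfl fun k _ => ?_
  simp only [Equiv.symm_apply_apply]
  rw [(Fintype.equivFin C).symm.sum_comp fun c => ∑ a, ∑ b,
    (if (e a).2 = c then I.K () k (e' i.1) (e a).1 else 0) *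
      ρ ((e a).1, s (e a).2 i.2) ((e b).1, s (e b).2 j.2) *
      star (if (e b).2 = c then I.K () k (e' j.1) (e b).1 else 0)]
  refine Finset.sum_congr rfl fun c _ => ?_
  rw [e.sum_comp fun a => ∑ b, (if a.2 = c then I.K () k (e' i.1) a.1 else 0) *
      ρ (a.1, s a.2 i.2) ((e b).1, s (e b).2 j.2) *
      star (if (e b).2 = c then I.K () k (e' j.1) (e b).1 else 0)]
  have h : ∀ a : A × C, ∑ b, (if a.2 = c then I.K () k (e' i.1) a.1 else 0) *
      ρ (a.1, s a.2 i.2) ((e b).1, s (e b).2 j.2) *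
      star (if (e b).2 = c then I.K () k (e' j.1) (e b).1 else 0) =
      ∑ b : A × C, (if a.2 = c then I.K () k (e' i.1) a.1 else 0) *
      ρ (a.1, s a.2 i.2) (b.1, s b.2 j.2) *
      star (if b.2 = c then I.K () k (e' j.1) b.1 else 0) := fun a =>
    e.sum_comp fun b : A × C => (if a.2 = c then I.K () k (e' i.1) a.1 else 0) *
      ρ (a.1, s a.2 i.2) (b.1, s b.2 j.2) * star (if b.2 = c then I.K () k (e' j.1) b.1 else 0)
  refine (Finset.sum_congr rfl fun a _ => h a).trans ?_
  simp [Fintype.sum_prod_type, apply_ite]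

end Lift

/-! ### One call -/

/-- Extensions of a multiple `c • η`, with `c ≤ 1`, are obtained from the purification of `η`. -/
theorem exists_rest_purify_smul {Y : Type} [Fintype Y] [DecidableEq Y] {ι : Type} [Fintype ι]
    {E : ι → Type} [∀ i, Fintype (E i)] [∀ i, DecidableEq (E i)] {η : Mat Y} (hη : η.PosSemidef)
    {c : ℝ} (hc0 : 0 ≤ c) (hc1 : c ≤ 1) (ω : ∀ i, Mat (Y × E i)) (hω : ∀ i, (ω i).PosSemidef)
    (hsum : ∀ y y', ∑ i, ∑ e, ω i (y, e) (y', e) = c * η y y') :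
    ∃ Γ : ∀ i, Mat Y →ₗ[ℂ] Mat (E i), (∀ i, rest (Γ i) (purify η) = ω i) ∧
      (∀ (i : ι) (Z : Type) [Fintype Z] (ρ : Mat (Z × Y)), ρ.PosSemidef →
        (rest (Γ i) ρ).PosSemidef) ∧
      (∀ (Z : Type) [Fintype Z] (ρ : Mat (Z × Y)), ρ.PosSemidef →
        ∑ i, (rest (Γ i) ρ).trace.re ≤ ρ.trace.re) := by
  rcases hc0.eq_or_lt with rfl | hc
  · have hz : ∀ i, ω i = 0 := by
      have h1 : ∑ i, (ω i).trace = 0 := by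
        have h2 : ∀ i, (ω i).trace = ∑ y, ∑ e, ω i (y, e) (y, e) := fun i => by
          simp [Matrix.trace, Fintype.sum_prod_type]
        simp only [h2]
        rw [Finset.sum_comm]
        exact Finset.sum_eq_zero fun y _ => by rw [hsum]; simp
      intro i
      refine (hω i).trace_eq_zero_iff.1 ?_
      exact (Finset.sum_eq_zero_iff_of_nonneg fun i _ => (hω i).trace_nonneg).1 h1 i
        (Finset.mem_univ _)
    have hrest : ∀ (i : ι) (Z : Type) (ρ : Mat (Z × Y)),
        rest (0 : Mat Y →ₗ[ℂ] Mat (E i)) ρ = 0 := fun i Z ρ => rfl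
    refine ⟨fun _ => 0, fun i => ?_, fun i Z _ ρ _ => ?_, fun Z _ ρ h => ?_⟩
    · rw [hz, hrest]
    · rw [hrest]
      exact .zero
    · simp only [hrest, Matrix.trace_zero, Complex.zero_re, Finset.sum_const_zero]
      exact (Complex.le_def.1 h.trace_nonneg).1
  · have hcC : (c : ℂ) ≠ 0 := by exact_mod_cast hc.ne'
    obtain ⟨Γ, h1, h2, h3⟩ := exists_rest_purify hη (fun i => ((c⁻¹ : ℝ) : ℂ) • ω i)
      (fun i => (hω i).smul (by exact_mod_cast (inv_pos.2 hc).le)) (fun y y' => by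
        simp only [Matrix.smul_apply, smul_eq_mul, ← Finset.mul_sum, hsum]
        push_cast
        field_simp)
    have hrest : ∀ (i : ι) (Z : Type) (ρ : Mat (Z × Y)),
        rest ((c : ℂ) • Γ i) ρ = (c : ℂ) • rest (Γ i) ρ := fun i Z ρ => rfl
    refine ⟨fun i => (c : ℂ) • Γ i, fun i => ?_, fun i Z _ ρ h => ?_, fun Z _ ρ h => ?_⟩
    · rw [hrest, h1, smul_smul]
      push_cast
      rw [mul_inv_cancel₀ hcC, one_smul]
    · rw [hrest]
      exact (h2 i Z ρ h).smul (by exact_mod_cast hc0)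
    · simp only [hrest, Matrix.trace_smul, smul_eq_mul, Complex.re_ofReal_mul, ← Finset.mul_sum]
      have h4 := (Complex.le_def.1 h.trace_nonneg).1
      exact (mul_le_mul_of_nonneg_left (h3 Z ρ h) hc0).trans (mul_le_of_le_one_left h4 hc1)

section Call

variable {f : Functionality}

/-- A device for `P`, as the devices of the protocol without calls. -/
def PlainProtocol.devices (P : PlainProtocol f) (D : Device P.ports) : P.toProtocol.Devices :=
  ⟨D, .last⟩

/-- A strategy in one execution of `P`, as an attack on `P`. -/
def callAttack (P : PlainProtocol f) {p : Party} (D : Device P.ports) {A A' : Reg}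
    (inCall : Cheat (P.sched.view p) (A.prod (D.reg p.other)) A') {φ : Mat (A × f.In p)}
    (hφ : IsDensity φ) : Attack P.toProtocol p (P.devices D) where
  A₀ := A
  φ := φ
  isDensity := hφ
  V := A'
  strategy := .last inCall

/-- Adjoins a one-dimensional register to the device share of the cheating party. -/
def adjoinUnit {A O E : Type} (ρ : Mat ((A × O) × E)) : Mat ((A × O × Unit) × E) :=
  ρ.submatrix (fun i => ((i.1.1, i.1.2.1), i.2)) (fun i => ((i.1.1, i.1.2.1), i.2))

variable (P : PlainProtocol f) {p : Party} (D : Device P.ports) {A A' : Reg}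
    (inCall : Cheat (P.sched.view p) (A.prod (D.reg p.other)) A')

theorem callAttack_init_apply {φ : Mat (A × f.In p)} (hφ : IsDensity φ)
    (i j : (A × D.reg p.other × Unit) × f.In p × D.reg p × Unit) :
    (callAttack P D inCall hφ).init i j = φ (i.1.1, i.2.1) (j.1.1, j.2.1) *
      viewFor D.state p (i.1.2.1, i.2.2.1) (j.1.2.1, j.2.2.1) := by
  have h : (1 : Mat (Unit × Unit)) (i.1.2.2, i.2.2.2) (j.1.2.2, j.2.2.2) = 1 := rfl
  exact (congrArg (φ (i.1.1, i.2.1) (j.1.1, j.2.1) *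
      viewFor D.state p (i.1.2.1, i.2.2.1) (j.1.2.1, j.2.2.1) * ·) h).trans (mul_one _)

/-- A bound on the errors of simulators for `P` replaces one execution of `P` by a simulator and
`IDEAL(f)` within a larger computation: `σ i x` is the state when the input of the honest party is
`x`, with further registers `E i`. The simulator does not touch `E i`, since these registers are
obtained from the purifying register of the initial state of an attack on `P`. -/
theorem exists_call_simulator {ε : ℝ}
    (hε : ∀ a : Attack P.toProtocol p (P.devices D), ∃ sim : a.Simulator, a.error sim ≤ ε)
    {ι : Type} [Fintype ι] {E : ι → Type} [∀ i, Fintype (E i)] [∀ i, DecidableEq (E i)]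
    (σ : ∀ i, f.In p → Mat ((A × D.reg p.other) × D.reg p × E i))
    (hσ : ∀ i x, (σ i x).PosSemidef) (htr : ∑ i, ∑ x, (σ i x).trace.re ≤ 1)
    (φ : f.In p → Mat A)
    (hφ : ∀ x a o h a' o' h', ∑ i, ∑ e, σ i x ((a, o), h, e) ((a', o'), h', e) =
      φ x a a' * viewFor D.state p (o, h) (o', h')) :
    ∃ sim : IdealCheat f p (A.prod ((D.reg p.other).prod .unit)) A',
      Close (ι := ι × f.In p × Option (f.Out p)) (X := fun k => A' × E k.1)
        (fun k => runIdeal f k.2.1 sim (adjoinUnit (trace₂ (σ k.1 k.2.1))) k.2.2)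
        (fun k => runLast (A := A.prod (D.reg p.other)) D p (P.prog p k.2.1) inCall
          (insertUnit (σ k.1 k.2.1)) k.2.2) ε := by
  have hD := isDensity_viewFor D.isDensity p
  have hφ' : ∀ x, φ x = ∑ o, ∑ h, ∑ i, ∑ e, (σ i x).submatrix (fun a => ((a, o), h, e))
      (fun a => ((a, o), h, e)) := fun x => by
    ext a a'
    have h1 : ∑ o, ∑ h, viewFor D.state p (o, h) (o, h) = 1 := by
      rw [← hD.2, Matrix.trace, Fintype.sum_prod_type]
      rfl
    simp only [Matrix.sum_apply, Matrix.submatrix_apply, hφ, ← Finset.mul_sum, h1, mul_one]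
  have hφpos : ∀ x, (φ x).PosSemidef := fun x => by
    rw [hφ' x]
    exact Matrix.posSemidef_sum _ fun o _ => Matrix.posSemidef_sum _ fun h _ =>
      Matrix.posSemidef_sum _ fun i _ => Matrix.posSemidef_sum _ fun e _ => (hσ i x).submatrix _
  have hφtr : ∑ x, (φ x).trace = ∑ i, ∑ x, (σ i x).trace := by
    rw [Finset.sum_comm]
    refine Finset.sum_congr rfl fun x _ => ?_
    rw [hφ' x]
    simp only [Matrix.trace, Matrix.diag, Matrix.sum_apply, Matrix.submatrix_apply,
      Fintype.sum_prod_type]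
    rw [Finset.sum_comm (s := (Finset.univ : Finset ι))]
    refine Finset.sum_congr rfl fun a _ => ?_
    rw [Finset.sum_comm (s := (Finset.univ : Finset ι))]
    exact Finset.sum_congr rfl fun o _ => Finset.sum_comm
  -- The reduced state before the call, normalised: `c` is its trace.
  obtain ⟨c, φ₀, hφ₀, hc0, hc1, hc⟩ : ∃ (c : ℝ) (φ₀ : Mat (A × f.In p)), IsDensity φ₀ ∧ 0 ≤ c ∧
      c ≤ 1 ∧ ∀ i j, (c : ℂ) * φ₀ i j = Matrix.blockDiagonal φ i j := by
    have hbpos := posSemidef_blockDiagonal hφpos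
    have hbtr : (Matrix.blockDiagonal φ).trace.re = ∑ i, ∑ x, (σ i x).trace.re := by
      rw [Matrix.trace_blockDiagonal, hφtr]
      simp only [Complex.re_sum]
    have hbC : (((Matrix.blockDiagonal φ).trace.re : ℝ) : ℂ) = (Matrix.blockDiagonal φ).trace := by
      have := (Complex.le_def.1 hbpos.trace_nonneg).2
      exact Complex.ext rfl this
    rcases ((Complex.le_def.1 hbpos.trace_nonneg).1 : (0 : ℝ) ≤ _).eq_or_lt with h0 | h0
    · obtain ⟨φ₀, hφ₀⟩ := exists_isDensity (A × f.In p)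
      refine ⟨0, φ₀, hφ₀, le_rfl, zero_le_one, fun i j => ?_⟩
      have : Matrix.blockDiagonal φ = 0 := hbpos.trace_eq_zero_iff.1 (by rw [← hbC, ← h0]; simp)
      rw [this]
      simp
    · refine ⟨(Matrix.blockDiagonal φ).trace.re,
        (((Matrix.blockDiagonal φ).trace.re⁻¹ : ℝ) : ℂ) • Matrix.blockDiagonal φ,
        ⟨hbpos.smul (by exact_mod_cast (inv_pos.2 h0).le), ?_⟩, h0.le, hbtr.trans_le htr,
        fun i j => ?_⟩
      · rw [Matrix.trace_smul, smul_eq_mul]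
        refine (congrArg _ hbC.symm).trans ?_
        rw [← Complex.ofReal_mul, inv_mul_cancel₀ h0.ne', Complex.ofReal_one]
      · rw [Matrix.smul_apply, smul_eq_mul, ← mul_assoc, ← Complex.ofReal_mul,
          mul_inv_cancel₀ h0.ne']
        simp
  let a := callAttack P D inCall hφ₀
  -- The input of the honest party is classical: the blocks for different inputs `x` are diagonal.
  let ω : ∀ i, Mat (((A × D.reg p.other × Unit) × f.In p × D.reg p × Unit) × E i) := fun i =>
    (Matrix.blockDiagonal (σ i)).submatrix
      (fun j => (((j.1.1.1, j.1.1.2.1), j.1.2.2.1, j.2), j.1.2.1))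
      (fun j => (((j.1.1.1, j.1.1.2.1), j.1.2.2.1, j.2), j.1.2.1))
  have hω : ∀ y y', ∑ i, ∑ e, ω i (y, e) (y', e) = c * a.init y y' := fun y y' => by
    have h1 : ∀ i e, ω i (y, e) (y', e) = if y.2.1 = y'.2.1 then
        σ i y.2.1 ((y.1.1, y.1.2.1), y.2.2.1, e) ((y'.1.1, y'.1.2.1), y'.2.2.1, e) else 0 :=
      fun i e => Matrix.blockDiagonal_apply (σ i) (((y.1.1, y.1.2.1), y.2.2.1, e), y.2.1)
        (((y'.1.1, y'.1.2.1), y'.2.2.1, e), y'.2.1)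
    rw [callAttack_init_apply P D inCall hφ₀ y y', ← mul_assoc, hc, Matrix.blockDiagonal_apply]
    simp only [h1]
    split_ifs with hx
    · rw [hφ]
    · simp
  obtain ⟨Γ, hΓ, hΓpos, hΓtr⟩ := exists_rest_purify_smul (η := a.init) a.isDensity_init.1 hc0 hc1 ω
    (fun i => (posSemidef_blockDiagonal (hσ i)).submatrix _) hω
  have hΓ' : ∀ i y e y' e', rest (Γ i) (purify a.init) (y, e) (y', e') = if y.2.1 = y'.2.1 then
      σ i y.2.1 ((y.1.1, y.1.2.1), y.2.2.1, e) ((y'.1.1, y'.1.2.1), y'.2.2.1, e') else 0 :=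
    fun i y e y' e' => by
      rw [hΓ]
      exact Matrix.blockDiagonal_apply (σ i) (((y.1.1, y.1.2.1), y.2.2.1, e), y.2.1)
        (((y'.1.1, y'.1.2.1), y'.2.2.1, e'), y'.2.1)
  obtain ⟨sim, hsim⟩ := hε a
  have hclose := a.close_of_error_le sim hsim
  refine ⟨sim, ?_⟩
  have hmap := hclose.map (κ := ι × f.In p × Option (f.Out p)) (Y := fun k => A' × E k.1)
    (fun ρ k => rest (Γ k.1) (ρ (k.2.2, k.2.1))) (fun ρ ρ' k => map_add _ _ _)
    (fun ρ hρ k => hΓpos _ _ _ (hρ _)) (fun ρ hρ => by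
      rw [Fintype.sum_prod_type, Fintype.sum_prod_type_right]
      simp only [Fintype.sum_prod_type]
      rw [Finset.sum_comm]
      refine Finset.sum_le_sum fun x _ => ?_
      rw [Finset.sum_comm]
      exact Finset.sum_le_sum fun o _ => hΓtr _ _ (hρ _))
  -- The states within the larger computation are the images under `Γ` of those of the attack `a`.
  have hideal : ∀ i x, adjoinUnit (trace₂ (σ i x)) = rest (Γ i) (a.startIdeal x) := fun i x => by
    have hs : rest (Γ i) (a.startIdeal x) = trace₂ (Z := D.reg p × Unit)
        ((rest (Γ i) (purify a.init)).submatrix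
          (fun j : (A × D.reg p.other × Unit) × (D.reg p × Unit) × E i =>
            ((j.1, (x, j.2.1)), j.2.2)) (fun j => ((j.1, (x, j.2.1)), j.2.2))) :=
      (trace₂_rest (Γ i) ((purify a.init).submatrix
          (fun j : (A × D.reg p.other × Unit) × (D.reg p × Unit) × a.initReg =>
            ((j.1, (x, j.2.1)), j.2.2)) (fun j => ((j.1, (x, j.2.1)), j.2.2)))).symm
    rw [hs]
    ext j j'
    have hz : ∀ z : D.reg p × Unit, rest (Γ i) (purify a.init) ((j.1, (x, z)), j.2)
        ((j'.1, (x, z)), j'.2) =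
        σ i x ((j.1.1, j.1.2.1), z.1, j.2) ((j'.1.1, j'.1.2.1), z.1, j'.2) :=
      fun z => (hΓ' _ _ _ _ _).trans (if_pos rfl)
    refine Eq.trans ?_ (Finset.sum_congr rfl fun z _ => (hz z).symm)
    rw [Fintype.sum_prod_type]
    simp [adjoinUnit, trace₂]
  have hreal : ∀ i x, insertUnit (σ i x) =
      rest (rest (rest (Γ i ∘ₗ trFst (Z := Unit × Unit)))) (a.start x) := fun i x => by
    ext ⟨⟨b, o⟩, u, h, e⟩ ⟨⟨b', o'⟩, u', h', e'⟩
    have hz : rest (Γ i) (purify a.init) (((b, o, ()), x, h, ()), e)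
        (((b', o', ()), x, h', ()), e') =
        σ i x ((b, o), h, e) ((b', o'), h', e') := (hΓ' _ _ _ _ _).trans (if_pos rfl)
    refine hz.symm.trans ?_
    refine congrFun (congrFun (congrArg (Γ i) ?_) e) e'
    ext r r'
    exact (Fintype.sum_subsingleton (fun z : Unit × Unit =>
      purify a.init (((b, o, z.1), x, h, z.2), r) (((b', o', z.1), x, h', z.2), r')) ((), ())).symm
  refine hmap.congr (fun k => ?_) (fun k => ?_)
  · exact (congrArg (fun τ => runIdeal f k.2.1 sim τ k.2.2) (hideal k.1 k.2.1)).trans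
      (runIdeal_rest f (Γ k.1) k.2.1 sim (a.startIdeal k.2.1) k.2.2)
  · exact (congrArg (fun τ => runLast (A := A.prod (D.reg p.other)) D p (P.prog p k.2.1) inCall τ
      k.2.2) (hreal k.1 k.2.1)).trans
      (runLast_rest (A := A.prod (D.reg p.other)) D p (Γ k.1 ∘ₗ trFst (Z := Unit × Unit))
        (P.prog p k.2.1) inCall (a.start k.2.1) k.2.2)

end Call

/-! ### From executions with devices to executions with ideal calls -/

section ToIdeal

variable {A B C H U V W D X : Type} [Fintype H]

/-- Traces out the register `H`, and adjoins a register `U` that is meant to be one-dimensional. -/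
def dropHonest (U : Type) : Mat ((C × H) × X) →ₗ[ℂ] Mat (C × U × X) where
  toFun m := Matrix.of fun i j => ∑ h, m ((i.1, h), i.2.2) ((j.1, h), j.2.2)
  map_add' m m' := by ext i j; simp [Finset.sum_add_distrib]
  map_smul' c m := by ext i j; simp [Finset.mul_sum]

/-- The state of an execution with ideal calls that corresponds to a state `ρ` of an execution with
devices for the calls: the shares `C` of the cheating party in these devices are part of its memory
`B` from the beginning, and the shares `H` of the honest party are discarded. -/
def toIdeal (U : Type) (e : B ≃ A × C) (ρ : Mat (A × W × D × (C × H) × X)) :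
    Mat (B × W × D × U × X) :=
  join e (behind (behind Prod.mk)) (rest (rest (rest (dropHonest U))) ρ)

theorem toIdeal_apply (e : B ≃ A × C) (ρ : Mat (A × W × D × (C × H) × X))
    (i j : B × W × D × U × X) :
    toIdeal U e ρ i j = ∑ h, ρ ((e i.1).1, i.2.1, i.2.2.1, ((e i.1).2, h), i.2.2.2.2)
      ((e j.1).1, j.2.1, j.2.2.1, ((e j.1).2, h), j.2.2.2.2) := rfl

theorem posSemidef_toIdeal (e : B ≃ A × C) {ρ : Mat (A × W × D × (C × H) × X)}
    (hρ : ρ.PosSemidef) : (toIdeal U e ρ).PosSemidef := by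
  have : toIdeal U e ρ = ∑ h, ρ.submatrix
      (fun i => ((e i.1).1, i.2.1, i.2.2.1, ((e i.1).2, h), i.2.2.2.2))
      (fun i => ((e i.1).1, i.2.1, i.2.2.1, ((e i.1).2, h), i.2.2.2.2)) := by
    ext i j
    simp only [toIdeal_apply, Matrix.sum_apply, Matrix.submatrix_apply]
  rw [this]
  exact Matrix.posSemidef_sum _ fun h _ => hρ.submatrix _

theorem toIdeal_add (e : B ≃ A × C) (ρ σ : Mat (A × W × D × (C × H) × X)) :
    toIdeal U e (ρ + σ) = toIdeal U e ρ + toIdeal U e σ := by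
  rw [toIdeal, map_add]
  rfl

theorem toIdeal_sum {ι : Type} (e : B ≃ A × C) (t : Finset ι)
    (ρ : ι → Mat (A × W × D × (C × H) × X)) :
    toIdeal U e (∑ k ∈ t, ρ k) = ∑ k ∈ t, toIdeal U e (ρ k) := by
  rw [toIdeal, map_sum, join_sum]
  rfl

theorem trace_toIdeal [Fintype A] [Fintype B] [Fintype C] [Fintype W] [Fintype D] [Fintype X]
    [Fintype U] [Subsingleton U] [Nonempty U] (e : B ≃ A × C)
    (ρ : Mat (A × W × D × (C × H) × X)) : (toIdeal U e ρ).trace = ρ.trace := by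
  let e' : ((B × W × D × U × X) × H) ≃ (A × W × D × (C × H) × X) :=
    { toFun := fun i => ((e i.1.1).1, i.1.2.1, i.1.2.2.1, ((e i.1.1).2, i.2), i.1.2.2.2.2)
      invFun := fun j => ((e.symm (j.1, j.2.2.2.1.1), j.2.1, j.2.2.1, Classical.arbitrary U,
        j.2.2.2.2), j.2.2.2.1.2)
      left_inv := fun i => by
        refine Prod.ext (Prod.ext (e.symm_apply_apply _) (Prod.ext rfl (Prod.ext rfl (Prod.ext
          (Subsingleton.elim _ _) rfl)))) rfl
      right_inv := fun j => by simp }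
  have h := e'.sum_comp fun j => ρ j j
  rw [Fintype.sum_prod_type] at h
  exact h

end ToIdeal

section ToIdealRegisters

variable {A B C C' V : Reg} {H H' U D X : Type} [Fintype H] [Fintype H'] [DecidableEq H]
  [DecidableEq H'] [Fintype U] [DecidableEq U] [Fintype X] [DecidableEq X]
  {M : Type} [Fintype M]

theorem act₂_toIdeal [Fintype D] [DecidableEq D] {W W' : Reg} (I : Instrument W W' M)
    (e : B ≃ A × C) (m : M) (ρ : Mat (A × W × D × (C × H) × X)) :
    I.act₂ m (toIdeal U e ρ) = toIdeal U e (I.act₂ m ρ) := by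
  rw [toIdeal, act₂_join, act₂_rest]
  rfl

theorem runCode_toIdeal {P : Ports} (D : Device P) (p : Party) {s : Sched} {A' W W' : Reg}
    (code : Code (P.X p) (P.O p) s W W') (adv : Cheat s A A') (e : B ≃ A × C)
    (ρ : Mat (A × W × D.reg p × (C × H) × X)) :
    runCode D p code (adv.lift e).2.2 (toIdeal U e ρ) =
      toIdeal U (adv.lift e).2.1 (runCode D p code adv ρ) := by
  rw [toIdeal, runCode_lift_join, runCode_rest]
  rfl

theorem runIdeal_toIdeal [Fintype D] [DecidableEq D] {W : Reg} {f : Functionality} {p : Party}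
    (x : f.In p) (adv : IdealCheat f p A V) (e : B ≃ A × C) (ρ : Mat (A × W × D × (C × H) × X))
    (o : Option (f.Out p)) :
    runIdeal f x (adv.lift (B' := V.prod C) e (Equiv.refl _)) (toIdeal U e ρ) o =
      toIdeal U (B := V.prod C) (Equiv.refl _) (runIdeal f x adv ρ o) := by
  rw [toIdeal, runIdeal_lift_join, runIdeal_rest]
  rfl

theorem abortStep_toIdeal [Subsingleton U] [Nonempty U] [Fintype D] [DecidableEq D] {W W' V' : Reg}
    {f : Functionality} {p : Party}
    (input : Instrument W W' (Option (f.In p))) (onAbort : Channel A V) (e : B ≃ A × C)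
    (e' : V' ≃ V) (ρ : Mat (A × W × D × (C × H) × X)) :
    abortStep input (Instrument.discard onAbort e e') (toIdeal U e ρ) =
      (abortStep input onAbort ρ).submatrix (Prod.map e' id) (Prod.map e' id) := by
  rw [abortStep, abortStep, act₂_toIdeal]
  generalize input.act₂ none ρ = σ
  rw [toIdeal, act₁_discard_join, act₁_rest]
  generalize onAbort.act₁ () σ = τ
  ext i j
  have h1 : ∀ u : U, ∑ d : D, ∑ w : W', ∑ c : C, ∑ h : H,
      τ (e' i.1, w, d, (c, h), i.2) (e' j.1, w, d, (c, h), j.2) =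
      ∑ q : C × H, ∑ d : D, ∑ w : W', τ (e' i.1, w, d, q, i.2) (e' j.1, w, d, q, j.2) := fun u => by
    have h2 : ∀ d : D, ∑ q : C × H, ∑ w : W', τ (e' i.1, w, d, q, i.2) (e' j.1, w, d, q, j.2) =
        ∑ w : W', ∑ c : C, ∑ h : H, τ (e' i.1, w, d, (c, h), i.2) (e' j.1, w, d, (c, h), j.2) :=
      fun d => by
        rw [Finset.sum_comm]
        exact Finset.sum_congr rfl fun w _ => Fintype.sum_prod_type _
    exact (Finset.sum_congr rfl fun d _ => (h2 d).symm).trans Finset.sum_comm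
  refine (Fintype.sum_subsingleton _ (Classical.arbitrary U)).trans (h1 (Classical.arbitrary U))

/-- At a call, the cheating party's share of the device for this call is taken out of its memory. -/
theorem trace₂_atCall_toIdeal {A B O O' H H' W D U U' X : Type} [Fintype H] [Fintype H']
    (e : B ≃ A × (O × O')) (e' : B × Unit ≃ (A × O × Unit) × O')
    (he : ∀ b, e' b = (((e b.1).1, (e b.1).2.1, ()), (e b.1).2.2))
    (ρ : Mat (A × W × D × ((O × O') × (H × H')) × X)) :
    trace₂ (Z := Unit) (atCall (toIdeal ((Unit × U) × (Unit × U')) e ρ)) =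
      toIdeal (U × U') e' (adjoinUnit (trace₂ (atCall ρ))) := by
  ext i j
  have h : ∑ h : H × H', ρ ((e i.1.1).1, i.2.1, i.2.2.1, ((e i.1.1).2, h), i.2.2.2.2)
      ((e j.1.1).1, j.2.1, j.2.2.1, ((e j.1.1).2, h), j.2.2.2.2) =
      ∑ h' : H', ∑ h : H, ρ ((e i.1.1).1, i.2.1, i.2.2.1, ((e i.1.1).2, (h, h')), i.2.2.2.2)
      ((e j.1.1).1, j.2.1, j.2.2.1, ((e j.1.1).2, (h, h')), j.2.2.2.2) :=
    Fintype.sum_prod_type_right _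
  refine ((Fintype.sum_subsingleton (fun _ : Unit => ∑ h : H × H',
    ρ ((e i.1.1).1, i.2.1, i.2.2.1, ((e i.1.1).2, h), i.2.2.2.2)
      ((e j.1.1).1, j.2.1, j.2.2.1, ((e j.1.1).2, h), j.2.2.2.2)) ()).trans h).trans ?_
  rw [toIdeal_apply, he, he]
  rfl

end ToIdealRegisters

/-! ### Devices in a product state with the parties' memories -/

section Product

variable {A W D Q X Y : Type}

/-- The trace, with values in the operators on the one-dimensional register. -/
def traceOut [Fintype X] : Mat X →ₗ[ℂ] Mat Unit where
  toFun m := Matrix.of fun _ _ => m.trace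
  map_add' m m' := by ext i j; simp
  map_smul' c m := by ext i j; simp

/-- Adjoins a register in the state `τ`. -/
def adjoinState (τ : Mat Q) : Mat Unit →ₗ[ℂ] Mat (Q × Unit) where
  toFun m := τ ⊗ₖ m
  map_add' _ _ := Matrix.kronecker_add _ _ _
  map_smul' _ _ := Matrix.kronecker_smul _ _ _

/-- After tracing out `X`, the register `Q` is in the state `τ`, in a product with the others. -/
def IsProductWith [Fintype X] (τ : Mat Q) (ρ : Mat (A × W × D × Q × X)) : Prop :=
  ∃ ρ' : Mat (A × W × D × Unit),
    rest (rest (rest (rest traceOut))) ρ = rest (rest (rest (adjoinState τ))) ρ'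

/-- The state of two devices, the shares of either party being grouped together. -/
def pairState {O O' H H' : Type} (τ : Mat (O × H)) (τ' : Mat (O' × H')) :
    Mat ((O × O') × (H × H')) :=
  (τ ⊗ₖ τ').submatrix (fun i => ((i.1.1, i.2.1), (i.1.2, i.2.2)))
    (fun i => ((i.1.1, i.2.1), (i.1.2, i.2.2)))

/-- Before a call, the device for the call is in a product state with the other registers of the
cheating party. -/
theorem IsProductWith.exists_atCall {O O' H H' : Type} [Fintype X] [Fintype W] [Fintype D]
    [Fintype O'] [Fintype H'] {τ : Mat (O × H)} {τ' : Mat (O' × H')} (hτ' : τ'.trace = 1)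
    {ρ : Mat (A × W × D × ((O × O') × (H × H')) × X)} (h : IsProductWith (pairState τ τ') ρ) :
    ∃ φ : Mat A, ∀ a o h a' o' h', ∑ e, atCall ρ ((a, o), h, e) ((a', o'), h', e) =
      φ a a' * τ (o, h) (o', h') := by
  obtain ⟨ρ', h⟩ := h
  refine ⟨Matrix.of fun a a' => ∑ w, ∑ d, ρ' (a, w, d, ()) (a', w, d, ()),
    fun a o h₁ a' o' h₁' => ?_⟩
  have h2 : ∀ w d o₂ h₂, ∑ x, ρ (a, w, d, ((o, o₂), (h₁, h₂)), x)
      (a', w, d, ((o', o₂), (h₁', h₂)), x) =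
      τ (o, h₁) (o', h₁') * τ' (o₂, h₂) (o₂, h₂) * ρ' (a, w, d, ()) (a', w, d, ()) :=
    fun w d o₂ h₂ => congrFun (congrFun h (a, w, d, ((o, o₂), (h₁, h₂)), ()))
      (a', w, d, ((o', o₂), (h₁', h₂)), ())
  have h3 : ∑ o₂, ∑ h₂, τ' (o₂, h₂) (o₂, h₂) = 1 := by
    rw [← hτ', Matrix.trace, Fintype.sum_prod_type]
    rfl
  have h4 : ∀ e : W × D × (O' × H') × X, atCall ρ ((a, o), h₁, e) ((a', o'), h₁', e) =
      ρ (a, e.1, e.2.1, ((o, e.2.2.1.1), (h₁, e.2.2.1.2)), e.2.2.2)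
        (a', e.1, e.2.1, ((o', e.2.2.1.1), (h₁', e.2.2.1.2)), e.2.2.2) := fun e => rfl
  simp only [h4, Fintype.sum_prod_type, h2, Matrix.of_apply]
  simp only [← Finset.sum_mul, ← Finset.mul_sum, h3, mul_one]
  rw [mul_comm]

theorem atCall_adjoinState {O O' H H' : Type} (τ : Mat (O × H)) (τ' : Mat (O' × H'))
    (ρ : Mat (A × W × D × Unit)) :
    atCall (rest (rest (rest (adjoinState (pairState τ τ')))) ρ) =
      rest (rest (rest (rest (adjoinState τ')))) (Matrix.of fun i j : (A × O) × H × W × D × Unit =>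
        τ (i.1.2, i.2.1) (j.1.2, j.2.1) * ρ (i.1.1, i.2.2) (j.1.1, j.2.2)) := by
  ext i j
  have h : ∀ a b c : ℂ, a * b * c = b * (a * c) := fun a b c => by ring
  exact h _ _ _

end Product

section ProductSteps

variable {A A' : Reg} {D Q X : Type} [Fintype D] [DecidableEq D] [Fintype Q] [DecidableEq Q]
  [Fintype X] [DecidableEq X] {M : Type} [Fintype M]

theorem IsProductWith.runCode {P : Ports} (D : Device P) (p : Party) {s : Sched} {W W' : Reg}
    (code : Code (P.X p) (P.O p) s W W') (adv : Cheat s A A') {τ : Mat Q}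
    {ρ : Mat (A × W × D.reg p × Q × X)} (h : IsProductWith τ ρ) :
    IsProductWith τ (runCode D p code adv ρ) := by
  obtain ⟨ρ', h⟩ := h
  exact ⟨QComp.runCode D p code adv ρ', by rw [← runCode_rest, h, runCode_rest]⟩

theorem IsProductWith.act₂ {W W' : Reg} (I : Instrument W W' M) (m : M) {τ : Mat Q}
    {ρ : Mat (A × W × D × Q × X)} (h : IsProductWith τ ρ) : IsProductWith τ (I.act₂ m ρ) := by
  obtain ⟨ρ', h⟩ := h
  exact ⟨I.act₂ m ρ', by rw [← act₂_rest, h, act₂_rest]⟩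

/-- After a call, the devices for the calls still to come are in a product state with the other
registers. -/
theorem IsProductWith.callStep {f : Functionality} {r : Resource f} {p : Party} {d : r.Dev}
    {O' H' : Type} [Fintype O'] [Fintype H'] [DecidableEq O'] [DecidableEq H']
    {W₁ W₂ W₃ : Reg} (input : Instrument W₁ W₂ (Option (f.In p)))
    (process : Option (f.Out p) → Channel W₂ W₃) (inCall : r.Cheat p d A A')
    {τ : Mat (r.reg d p.other × r.reg d p)} {τ' : Mat (O' × H')}
    {ρ : Mat (A × W₁ × D × ((r.reg d p.other × O') × (r.reg d p × H')) × X)}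
    (h : IsProductWith (pairState τ τ') ρ) :
    IsProductWith τ' (callStep input process inCall ρ) := by
  obtain ⟨ρ', h⟩ := h
  refine ⟨∑ x : f.In p, ∑ y : Option (f.Out p), (process y).act₂ ()
    (r.exec p d x inCall (Matrix.of fun i j : (A × r.reg d p.other) × r.reg d p × W₂ × D × Unit =>
        τ (i.1.2, i.2.1) (j.1.2, j.2.1) *
          input.act₂ (some x) ρ' (i.1.1, i.2.2) (j.1.1, j.2.2)) y), ?_⟩
  rw [← callStep_rest, h]
  simp only [QComp.callStep, map_sum]
  refine Finset.sum_congr rfl fun x _ => Finset.sum_congr rfl fun y _ => ?_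
  rw [act₂_rest, atCall_adjoinState, Resource.exec_rest, act₂_rest]

end ProductSteps

/-! ### Replacing all calls -/

/-- No devices, for calls that are answered by the ideal functionality. -/
def idealDevs (f : Functionality) : (sh : Shape) → CallDevs (.ideal : Resource f) sh
  | .last _ => .last
  | .call _ sh => .call PUnit.unit (idealDevs f sh)

theorem subsingleton_idealDevs_reg (f : Functionality) (sh : Shape) (p : Party) :
    Subsingleton ((idealDevs f sh).reg p) := by
  induction sh with
  | last s => exact inferInstanceAs (Subsingleton Unit)
  | call s sh ih => exact inferInstanceAs (Subsingleton (Unit × (idealDevs f sh).reg p))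

theorem Prog.exists_eq_call {f : Functionality} {Pm : Ports} {p : Party} {Out : Reg} {s : Sched}
    {sh : Shape} {W : Reg} (prog : Prog f Pm p Out (.call s sh) W) :
    ∃ (W₁ W₂ W₃ : Reg) (code : Code (Pm.X p) (Pm.O p) (s.view p) W W₁)
      (input : Instrument W₁ W₂ (Option (f.In p))) (process : Option (f.Out p) → Channel W₂ W₃)
      (prog' : Prog f Pm p Out sh W₃), prog = .call code input process prog' := by
  cases prog with | call code input process prog' =>
  exact ⟨_, _, _, code, input, process, prog', rfl⟩

theorem Prog.exists_eq_last {f : Functionality} {Pm : Ports} {p : Party} {Out : Reg} {s : Sched}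
    {W : Reg} (prog : Prog f Pm p Out (.last s) W) :
    ∃ L : LastPhase (Pm.X p) (Pm.O p) (s.view p) W Out, prog = .last L := by
  cases prog with | last L =>
  exact ⟨L, rfl⟩

theorem Close.add_left {ι : Type} [Fintype ι] {X : ι → Type} [∀ i, Fintype (X i)]
    {ρ σ : ∀ i, Mat (X i)} {ε : ℝ} (h : Close ρ σ ε) (τ : ∀ i, Mat (X i)) :
    Close (fun i => τ i + ρ i) (fun i => τ i + σ i) ε := by
  obtain ⟨P, N, hP, hN, he, ht⟩ := h
  exact ⟨P, N, hP, hN, fun i => by rw [add_assoc, he, add_assoc], ht⟩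

/-- The strategy `st`, in a protocol whose calls are answered by executions of `P`, has counterparts
for calls to the ideal functionality: for every finite family of programs of the honest party and of
initial states in which the devices for the calls are in a product state with the rest, there is one
strategy for the whole family whose final states are jointly `ε`-close to those of `st`. (The
simulators may depend on the family; in the application it is indexed by the inputs of the honest
party.) The cheating party holds its shares of the devices from the beginning. -/
def Simulates {f : Functionality} (P : PlainProtocol f) {Pm : Ports} (D : Device Pm) (p : Party)
    (Out : Reg) {sh : Shape} {ds : CallDevs (.run P) sh} {A V : Reg}
    (st : CheatAll (.run P) p ds A V) (ε : ℝ) : Prop :=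
  ∀ (ι : Type) [Fintype ι] (W : ι → Reg) (prog : ∀ i, Prog f Pm p Out sh (W i)) (X : Type)
    [Fintype X] [DecidableEq X]
    (ρ : ∀ i, Mat (A × W i × D.reg p × (ds.reg p.other × ds.reg p) × X)),
    (∀ i, (ρ i).PosSemidef) → ∑ i, (ρ i).trace.re ≤ 1 → (∀ i, IsProductWith (ds.state p) (ρ i)) →
    ∀ (B : Reg) (e : B ≃ A × ds.reg p.other),
      ∃ (V' : Reg) (e' : V' ≃ V) (st' : CheatAll .ideal p (idealDevs f sh) B V'),
        Close (ι := ι × Option Out) (X := fun _ => V' × X)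
          (fun k => runProg D .ideal p (prog k.1) st' (toIdeal _ e (ρ k.1)) k.2)
          (fun k => (runProg D (.run P) p (prog k.1) st (ρ k.1) k.2).submatrix
            (Prod.map e' id) (Prod.map e' id)) ε

section Simulates

variable {f : Functionality} {P : PlainProtocol f} {Pm : Ports} (D : Device Pm) {p : Party}
  {Out : Reg}

theorem simulates_last {s : Sched} {A V : Reg} (adv : Cheat (s.view p) A V) :
    Simulates P D p Out (.last (s := s) adv) 0 := by
  intro ι _ W prog X _ _ ρ hρ htr hprod B e
  choose L hL using fun i => (prog i).exists_eq_last
  obtain rfl : prog = fun i => .last (L i) := funext hL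
  have key : ∀ (ρ : ∀ i, Mat (A × W i × D.reg p × (Unit × Unit) × X)) (e : B ≃ A × Unit),
      ∃ (V' : Reg) (e' : V' ≃ V) (adv' : Cheat (s.view p) B V'),
        Close (ι := ι × Option Out) (X := fun _ => V' × X)
          (fun k => trace₂ (runLast D p (L k.1) adv' (toIdeal (Unit × Unit) e (ρ k.1)) k.2))
          (fun k => (trace₂ (runLast D p (L k.1) adv (ρ k.1) k.2)).submatrix
            (Prod.map e' id) (Prod.map e' id)) 0 := by
    intro ρ e
    refine ⟨(adv.lift (C := .unit) e).1, (adv.lift (C := .unit) e).2.1.trans (Equiv.prodUnique _ _),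
      (adv.lift (C := .unit) e).2.2, (Close.refl _).congr (fun k => ?_) (fun _ => rfl)⟩
    have h : runLast D p (L k.1) (adv.lift (C := .unit) e).2.2
        (toIdeal (Unit × Unit) e (ρ k.1)) k.2 =
        join (adv.lift (C := .unit) e).2.1 Prod.mk (rest (dropHonest (Unit × Unit))
          (runLast D p (L k.1) adv (ρ k.1) k.2)) := by
      rw [toIdeal, runLast_lift_join, runLast_rest]
    rw [h]
    generalize runLast D p (L k.1) adv (ρ k.1) k.2 = τ
    ext i j
    let E := (adv.lift (C := .unit) e).2.1
    exact (Fintype.sum_subsingleton (fun _ : Unit × Unit => ∑ h : Unit,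
      τ ((E i.1).1, ((E i.1).2, h), i.2) ((E j.1).1, ((E j.1).2, h), j.2)) ((), ())).trans
      ((Fintype.sum_subsingleton (fun h : Unit =>
        τ ((E i.1).1, ((), h), i.2) ((E j.1).1, ((), h), j.2)) ()).trans
      (Fintype.sum_subsingleton (fun z : Unit × Unit =>
        τ ((E i.1).1, z, i.2) ((E j.1).1, z, j.2)) ((), ())).symm)
  obtain ⟨V', e', adv', h⟩ := key ρ e
  exact ⟨V', e', .last adv', h⟩

/-- A call to the ideal functionality with a simulator that uses the cheating party's share of the
device for this call. -/
theorem callStep_toIdeal {D H H' U U' X : Type} [Fintype D] [DecidableEq D]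
    {A A' B O O' : Reg} [Fintype H] [Fintype H'] [DecidableEq H] [DecidableEq H']
    [Fintype U] [Fintype U'] [DecidableEq U] [DecidableEq U'] [Fintype X] [DecidableEq X]
    {W₁ W₂ W₃ : Reg} (input : Instrument W₁ W₂ (Option (f.In p)))
    (process : Option (f.Out p) → Channel W₂ W₃)
    (sim : IdealCheat f p (A.prod (O.prod .unit)) A') (e : B ≃ A × (O × O'))
    (e' : B.prod .unit ≃ (A.prod (O.prod .unit)) × O')
    (he : ∀ b, e' b = (((e b.1).1, (e b.1).2.1, ()), (e b.1).2.2))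
    (ρ : Mat (A × W₁ × D × ((O × O') × (H × H')) × X)) :
    ∑ x : f.In p, ∑ y : Option (f.Out p), (process y).act₂ ()
      (runIdeal f x (sim.lift (B' := A'.prod O') e' (Equiv.refl _)) (trace₂ (Z := Unit)
        (atCall (input.act₂ (some x) (toIdeal ((Unit × U) × (Unit × U')) e ρ)))) y) =
    toIdeal (U × U') (B := A'.prod O') (Equiv.refl _) (∑ x : f.In p, ∑ y : Option (f.Out p),
      (process y).act₂ () (runIdeal f x sim
        (adjoinUnit (trace₂ (atCall (input.act₂ (some x) ρ)))) y)) := by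
  rw [toIdeal_sum]
  refine Finset.sum_congr rfl fun x _ => ?_
  rw [toIdeal_sum]
  refine Finset.sum_congr rfl fun y _ => ?_
  rw [← act₂_toIdeal (B := A'.prod O')]
  refine congrArg ((process y).act₂ ()) ?_
  refine (congrArg (fun τ => runIdeal f x (sim.lift (B' := A'.prod O') e' (Equiv.refl _))
    (trace₂ (Z := Unit) (atCall τ)) y) (act₂_toIdeal (C := O.prod O')
      (U := (Unit × U) × (Unit × U')) input e (some x) ρ)).trans ?_
  generalize input.act₂ (some x) ρ = σ
  exact (congrArg (fun τ => runIdeal f x (sim.lift (B' := A'.prod O') e' (Equiv.refl _)) τ y)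
    (trace₂_atCall_toIdeal e e' he σ)).trans (runIdeal_toIdeal x sim e' _ y)

/-- Closeness of the states after a call carries over to the final states. -/
theorem Close.runProg_toIdeal {sh : Shape} {ι : Type} [Fintype ι] {W₂ W₃ : ι → Reg}
    {A O' V' : Reg} {H' X : Type} [Fintype H'] [DecidableEq H'] [Fintype X] [DecidableEq X]
    (process : ∀ i, Option (f.Out p) → Channel (W₂ i) (W₃ i))
    (prog : ∀ i, Prog f Pm p Out sh (W₃ i))
    (st : CheatAll .ideal p (idealDevs f sh) (A.prod O') V') {ε : ℝ}
    {τ τ' : ∀ k : ι × f.In p × Option (f.Out p),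
      Mat (A × W₂ k.1 × D.reg p × (O' × H') × X)} (h : Close τ τ' ε) :
    Close (ι := ι × Option Out) (X := fun _ => V' × X)
      (fun k => runProg D .ideal p (prog k.1) st (toIdeal _ (B := A.prod O') (Equiv.refl _)
        (∑ x, ∑ y, (process k.1 y).act₂ () (τ (k.1, x, y)))) k.2)
      (fun k => runProg D .ideal p (prog k.1) st (toIdeal _ (B := A.prod O') (Equiv.refl _)
        (∑ x, ∑ y, (process k.1 y).act₂ () (τ' (k.1, x, y)))) k.2) ε := by
  refine h.map (κ := ι × Option Out) (Y := fun _ => V' × X)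
    (fun τ k => runProg D .ideal p (prog k.1) st (toIdeal _ (B := A.prod O') (Equiv.refl _)
        (∑ x, ∑ y, (process k.1 y).act₂ () (τ (k.1, x, y)))) k.2)
    (fun τ τ' k => ?_) (fun τ hτ k => ?_) (fun τ _ => le_of_eq ?_)
  · refine Eq.trans ?_ (runProg_add D .ideal p (prog k.1) st _ _ k.2)
    rw [← toIdeal_add]
    simp only [Pi.add_apply, act₂_eq, map_add, Finset.sum_add_distrib]
  · have h1 : (∑ x, ∑ y, (process k.1 y).act₂ () (τ (k.1, x, y))).PosSemidef :=
      Matrix.posSemidef_sum _ fun x _ => Matrix.posSemidef_sum _ fun y _ =>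
        posSemidef_act₂ (process k.1 y) () (hτ (k.1, x, y))
    exact posSemidef_runProg D .ideal p (prog k.1) st (posSemidef_toIdeal _ h1) k.2
  · have := subsingleton_idealDevs_reg f sh p
    have := subsingleton_idealDevs_reg f sh p.other
    simp only [Fintype.sum_prod_type]
    refine Finset.sum_congr rfl fun i _ => ?_
    simp only [← Complex.re_sum]
    have h1 : ∀ ρ : Mat (A × W₃ i × D.reg p × (O' × H') × X),
        ∑ o, (runProg D .ideal p (prog i) st
          (toIdeal _ (B := A.prod O') (Equiv.refl _) ρ) o).trace = ρ.trace := fun ρ =>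
      (sum_trace_runProg (A := A.prod O') D .ideal p (prog i) st
        (toIdeal _ (B := A.prod O') (Equiv.refl _) ρ)).trans
        (trace_toIdeal (B := A.prod O') (A := A) (C := O') (Equiv.refl _) ρ)
    refine congrArg Complex.re ((h1 (∑ x, ∑ y, (process i y).act₂ () (τ (i, x, y)))).trans ?_)
    simp only [Matrix.trace_sum, trace_act₂]

/-- The first call is replaced by its simulator, with error `ε`, and the rest of the execution by
its counterpart, with error `ε'`. If the honest party aborts instead, the cheating party discards its
shares of the devices for the calls, and the two executions agree exactly. -/
theorem simulates_call {ε ε' : ℝ} {s : Sched} {sh : Shape} (d : Device P.ports)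
    (hε : ∀ a : Attack P.toProtocol p (P.devices d), ∃ sim : a.Simulator, a.error sim ≤ ε)
    {ds : CallDevs (.run P) sh} {A A₁ A₂ V : Reg} (adv : Cheat (s.view p) A A₁)
    (onAbort : Channel A₁ V) (inCall : Cheat (P.sched.view p) (A₁.prod (d.reg p.other)) A₂)
    (advRest : CheatAll (.run P) p ds A₂ V) (ih : Simulates P D p Out advRest ε') :
    Simulates P D p Out (CheatAll.call (r := .run P) (s := s) (d := d) adv onAbort inCall advRest)
      (ε + ε') := by
  intro ι _ W prog X _ _ ρ₀ hρ₀ htr₀ hprod₀ B e₀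
  choose W₁ W₂ W₃ code input process prog' hcall using fun i => (prog i).exists_eq_call
  obtain rfl : prog = fun i => .call (code i) (input i) (process i) (prog' i) := funext hcall
  have key : ∀ (ρ : ∀ i, Mat (A × W i × D.reg p ×
      ((d.reg p.other × ds.reg p.other) × (d.reg p × ds.reg p)) × X)),
      (∀ i, (ρ i).PosSemidef) → ∑ i, (ρ i).trace.re ≤ 1 →
      (∀ i, IsProductWith (pairState (viewFor d.state p) (ds.state p)) (ρ i)) →
      ∀ e : B ≃ A × (d.reg p.other × ds.reg p.other),
      ∃ (V' : Reg) (e' : V' ≃ V) (B₁ B₂ : Reg) (adv' : Cheat (s.view p) B B₁)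
        (onAbort' : Channel B₁ V') (inCall' : IdealCheat f p (B₁.prod .unit) B₂)
        (advRest' : CheatAll .ideal p (idealDevs f sh) B₂ V'),
        Close (ι := ι × Option Out) (X := fun _ => V' × X)
          (fun k => runCall D .ideal p (d := PUnit.unit) (ds := idealDevs f sh) (code k.1)
            (input k.1) (process k.1) (prog' k.1) adv' onAbort' inCall' advRest'
            (toIdeal ((Unit × (idealDevs f sh).reg p.other) × (Unit × (idealDevs f sh).reg p)) e
              (ρ k.1)) k.2)
          (fun k => (runCall D (.run P) p (d := d) (code k.1) (input k.1) (process k.1) (prog' k.1)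
            adv onAbort inCall advRest (ρ k.1) k.2).submatrix
            (Prod.map e' id) (Prod.map e' id)) (ε + ε') := by
    intro ρ hρ htr hprod e
    have h1 : ∀ i, (runCode D p (code i) adv (ρ i)).PosSemidef := fun i =>
      posSemidef_runCode D p (code i) adv (hρ i)
    have ht1 : ∀ i, (runCode D p (code i) adv (ρ i)).trace = (ρ i).trace := fun i =>
      trace_runCode D p (code i) adv (ρ i)
    have hp1 := fun i => (hprod i).runCode D p (code i) adv
    generalize hρ₁ : (fun i => runCode D p (code i) adv (ρ i)) = ρ₁
    have hρ₁' : ∀ i, runCode D p (code i) adv (ρ i) = ρ₁ i := congrFun hρ₁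
    simp only [hρ₁'] at h1 ht1 hp1
    have htsum : ∀ i, ∑ x, ((input i).act₂ (some x) (ρ₁ i)).trace.re ≤ (ρ₁ i).trace.re :=
      fun i => by
      rw [← sum_trace_act₂ (input i) (ρ₁ i), Fintype.sum_option, Complex.add_re, Complex.re_sum]
      exact le_add_of_nonneg_left
        (Complex.le_def.1 (posSemidef_act₂ (input i) none (h1 i)).trace_nonneg).1
    have htr1 : ∑ i, (ρ₁ i).trace.re ≤ 1 := by simpa only [ht1] using htr
    -- When the call begins, its device is in a product state with the memory of the cheating party.
    choose φ hφ using fun i x =>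
      ((hp1 i).act₂ (input i) (some x)).exists_atCall (ds.isDensity_state p).2
    obtain ⟨sim, hsim⟩ := exists_call_simulator P d inCall hε
      (E := fun i => W₂ i × D.reg p × (ds.reg p.other × ds.reg p) × X)
      (fun i x => atCall ((input i).act₂ (some x) (ρ₁ i)))
      (fun i x => posSemidef_atCall (posSemidef_act₂ _ _ (h1 i)))
      (by
        simp only [trace_atCall]
        exact (Finset.sum_le_sum fun i _ => htsum i).trans htr1)
      (fun x => ∑ i, φ i x) (fun x a o h a' o' h' => by
        simp only [hφ, Matrix.sum_apply, Finset.sum_mul])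
    obtain ⟨V', e', st', hst⟩ := ih ι W₃ prog' X
      (fun i => callStep (r := .run P) (d := d) (input i) (process i) inCall (ρ₁ i))
      (fun i => posSemidef_callStep (r := .run P) (d := d) (input i) (process i) inCall (h1 i))
      (le_trans (Finset.sum_le_sum fun i _ => by
        have := trace_callStep (r := .run P) (d := d) (input i) (process i) inCall (ρ₁ i)
        rw [this, Complex.re_sum]
        exact htsum i) htr1)
      (fun i => (hp1 i).callStep (r := .run P) (d := d) (input i) (process i) inCall)
      (A₂.prod (ds.reg p.other)) (Equiv.refl _)
    obtain ⟨B₁, e₁, adv', hadv⟩ : ∃ (B₁ : Reg)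
        (e₁ : B₁ ≃ A₁ × (d.reg p.other × ds.reg p.other)) (adv' : Cheat (s.view p) B B₁), ∀ i,
        runCode D p (code i) adv' (toIdeal ((Unit × (idealDevs f sh).reg p.other) ×
          (Unit × (idealDevs f sh).reg p)) e (ρ i)) =
        toIdeal ((Unit × (idealDevs f sh).reg p.other) × (Unit × (idealDevs f sh).reg p)) e₁
          (ρ₁ i) :=
      ⟨_, _, _, fun i => hρ₁' i ▸ runCode_toIdeal (C := (d.reg p.other).prod (ds.reg p.other))
        D p (code i) adv e (ρ i)⟩
    -- The simulator acts on the memory and the share for this call, and not on the other shares.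
    let e₃ : B₁.prod .unit ≃ (A₁.prod ((d.reg p.other).prod .unit)) × ds.reg p.other :=
      { toFun := fun b => (((e₁ b.1).1, (e₁ b.1).2.1, ()), (e₁ b.1).2.2)
        invFun := fun b => (e₁.symm (b.1.1, (b.1.2.1, b.2)), ())
        left_inv := fun b => by simp
        right_inv := fun b => by simp }
    refine ⟨V', e', B₁, A₂.prod (ds.reg p.other), adv',
      Instrument.discard (C := (d.reg p.other).prod (ds.reg p.other)) onAbort e₁ e',
      sim.lift (B' := A₂.prod (ds.reg p.other)) e₃ (Equiv.refl _), st', ?_⟩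
    have hmap := hsim.runProg_toIdeal D process prog' st'
    have hfin := (hmap.trans hst).add_left (fun k => if k.2 = none then
      (abortStep (input k.1) onAbort (ρ₁ k.1)).submatrix (Prod.map e' id) (Prod.map e' id) else 0)
    refine hfin.congr (fun k => ?_) (fun k => ?_)
    · refine (runCall_of_eq D (hadv k.1) k.2).trans ?_
      have := subsingleton_idealDevs_reg f sh p
      have := subsingleton_idealDevs_reg f sh p.other
      refine congrArg₂ (fun a b => a + b) ?_ ?_
      · split_ifs
        · exact abortStep_toIdeal (U := (Unit × (idealDevs f sh).reg p.other) ×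
            (Unit × (idealDevs f sh).reg p)) (C := (d.reg p.other).prod (ds.reg p.other))
            (input k.1) onAbort e₁ e' (ρ₁ k.1)
        · rfl
      · exact congrArg (fun τ => runProg D .ideal p (prog' k.1) st' τ k.2)
          (callStep_toIdeal (O := d.reg p.other) (O' := ds.reg p.other) (input k.1) (process k.1)
            sim e₁ e₃ (fun _ => rfl) (ρ₁ k.1))
    · refine (congrArg (fun τ : Mat (V × X) => τ.submatrix (Prod.map e' id) (Prod.map e' id))
        (runCall_of_eq D (hρ₁' k.1) k.2)).trans ?_
      split_ifs
      · rfl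
      · rfl
  obtain ⟨V', e', B₁, B₂, adv', onAbort', inCall', advRest', h⟩ := key ρ₀ hρ₀ htr₀ hprod₀ e₀
  exact ⟨V', e', .call adv' onAbort' inCall' advRest', h⟩

/-- One simulator for each call, with errors that add up. -/
theorem simulates {ε : ℝ} {T : Set (Device P.ports)}
    (hε : ∀ d ∈ T, ∀ a : Attack P.toProtocol p (P.devices d), ∃ sim : a.Simulator, a.error sim ≤ ε)
    {sh : Shape} {ds : CallDevs (.run P) sh} (hds : CallDevs.All (r := .run P) T ds) {A V : Reg}
    (st : CheatAll (.run P) p ds A V) : Simulates P D p Out st (sh.numCalls * ε) := by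
  induction st with
  | last adv =>
    have h := simulates_last (P := P) D (Out := Out) adv
    simpa only [Shape.numCalls, Nat.cast_zero, zero_mul] using h
  | @call s sh d ds A A₁ A₂ V adv onAbort inCall advRest ih =>
    have h := simulates_call D d (hε d hds.1) adv onAbort inCall advRest (ih hds.2)
    have h2 : ((Shape.call s sh).numCalls : ℝ) * ε = ε + sh.numCalls * ε := by
      rw [Shape.numCalls]
      push_cast
      ring
    rw [h2]
    exact h

end Simulates

/-! ### The composed protocol -/

section Composition

variable {f g : Functionality} {Q : OracleProtocol f g} {P : PlainProtocol f} {p : Party}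
  {main : Device Q.ports} {calls : CallDevs (.run P) Q.shape}

/-- The devices for ideal calls are trivial. -/
theorem idealDevs_state_apply (f : Functionality) (sh : Shape) (p : Party)
    (i j : (idealDevs f sh).reg p.other × (idealDevs f sh).reg p) :
    (idealDevs f sh).state p i j = 1 := by
  have := subsingleton_idealDevs_reg f sh p
  have := subsingleton_idealDevs_reg f sh p.other
  have h := ((idealDevs f sh).isDensity_state p).2
  rw [← h, Subsingleton.elim j i]
  exact (Fintype.sum_subsingleton (fun i => (idealDevs f sh).state p i i) i).symm

theorem CallDevs.all_univ {r : Resource f} {sh : Shape} (ds : CallDevs r sh) :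
    ds.All Set.univ := by
  induction ds with
  | last => trivial
  | call d ds ih => exact ⟨trivial, ih⟩

/-- The devices of the composed protocol. -/
abbrev compDevs (main : Device Q.ports) (calls : CallDevs (.run P) Q.shape) :
    (Q.replace P).Devices := ⟨main, calls⟩

/-- The devices of the oracle-aided protocol. -/
abbrev aidedDevs (main : Device Q.ports) : Q.aided.Devices := ⟨main, idealDevs f Q.shape⟩

/-- The purifying register being traced out, the devices for the calls are initially in a product
state with everything else. -/
theorem isProductWith_start (a : Attack (Q.replace P) p (compDevs main calls)) (x : g.In p) :
    IsProductWith (calls.state p) (a.start x) := by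
  refine ⟨Matrix.of fun i j => a.φ (i.1.1, x) (j.1.1, x) *
    viewFor main.state p (i.1.2, i.2.2.1) (j.1.2, j.2.2.1), ?_⟩
  ext i j
  refine (purify_sum_snd a.isDensity_init.1 ((i.1.1, i.1.2, i.2.2.2.1.1), (x, i.2.2.1, i.2.2.2.1.2))
    ((j.1.1, j.1.2, j.2.2.2.1.1), (x, j.2.2.1, j.2.2.2.1.2))).trans ?_
  exact mul_comm _ _

/-- The initial state of the cheating party in the oracle-aided protocol: the cheating party holds
its shares of the devices for the calls as part of its own registers. -/
noncomputable def aidedState (a : Attack (Q.replace P) p (compDevs main calls)) :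
    Mat ((a.A₀ × calls.reg p.other) × g.In p) :=
  ∑ h, (a.φ ⊗ₖ calls.state p).submatrix (fun i => ((i.1.1, i.2), (i.1.2, h)))
    (fun i => ((i.1.1, i.2), (i.1.2, h)))

theorem isDensity_aidedState (a : Attack (Q.replace P) p (compDevs main calls)) :
    IsDensity (aidedState a) := by
  have h := a.isDensity.kronecker (calls.isDensity_state p)
  refine ⟨Matrix.posSemidef_sum _ fun _ _ => h.1.submatrix _, ?_⟩
  let e : (calls.reg p × ((a.A₀ × calls.reg p.other) × g.In p)) ≃
      ((a.A₀ × g.In p) × (calls.reg p.other × calls.reg p)) :=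
    { toFun := fun i => ((i.2.1.1, i.2.2), (i.2.1.2, i.1))
      invFun := fun j => (j.2.2, ((j.1.1, j.2.1), j.1.2)) }
  rw [aidedState, Matrix.trace_sum, ← h.2]
  have h2 := e.sum_comp fun j => (a.φ ⊗ₖ calls.state p) j j
  rw [Fintype.sum_prod_type] at h2
  exact h2

/-- The attack on the oracle-aided protocol that belongs to an attack on the composed protocol and a
strategy for calls to the ideal functionality. -/
noncomputable def aidedAttack (a : Attack (Q.replace P) p (compDevs main calls)) {V : Reg}
    (st : CheatAll .ideal p (idealDevs f Q.shape)
      ((a.A₀.prod (calls.reg p.other)).prod (main.reg p.other)) V) :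
    Attack Q.aided p (aidedDevs main) where
  A₀ := a.A₀.prod (calls.reg p.other)
  φ := aidedState a
  isDensity := isDensity_aidedState a
  V := V
  strategy := st

section Extension

variable (a : Attack (Q.replace P) p (compDevs main calls)) {V : Reg}
  (st : CheatAll .ideal p (idealDevs f Q.shape)
    ((a.A₀.prod (calls.reg p.other)).prod (main.reg p.other)) V)

theorem aidedAttack_init_apply
    (i j : ((a.A₀ × calls.reg p.other) × main.reg p.other × (idealDevs f Q.shape).reg p.other) ×
      g.In p × main.reg p × (idealDevs f Q.shape).reg p) :
    (aidedAttack a st).init i j = ∑ h : calls.reg p,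
      a.init ((i.1.1.1, i.1.2.1, i.1.1.2), (i.2.1, i.2.2.1, h))
        ((j.1.1.1, j.1.2.1, j.1.1.2), (j.2.1, j.2.2.1, h)) := by
  have h1 : (aidedAttack a st).init i j = aidedState a (i.1.1, i.2.1) (j.1.1, j.2.1) *
      viewFor main.state p (i.1.2.1, i.2.2.1) (j.1.2.1, j.2.2.1) *
      (idealDevs f Q.shape).state p (i.1.2.2, i.2.2.2) (j.1.2.2, j.2.2.2) := rfl
  rw [h1, idealDevs_state_apply, mul_one, aidedState, Matrix.sum_apply, Finset.sum_mul]
  refine Finset.sum_congr rfl fun h _ => ?_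
  exact mul_right_comm (a.φ (i.1.1.1, i.2.1) (j.1.1.1, j.2.1))
    (calls.state p (i.1.1.2, h) (j.1.1.2, h))
    (viewFor main.state p (i.1.2.1, i.2.2.1) (j.1.2.1, j.2.2.1))

/-- The purified initial state of an attack on the composed protocol, with the honest shares of the
devices for the calls discarded, is obtained from the purified initial state of the attack on the
oracle-aided protocol by an operation on the purifying register. -/
theorem exists_rest_start :
    ∃ Γ : Mat (aidedAttack a st).initReg →ₗ[ℂ] Mat a.initReg,
      (∀ y r y' r', rest Γ (purify (aidedAttack a st).init) (y, r) (y', r') = ∑ h : calls.reg p,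
        purify a.init (((y.1.1.1, y.1.2.1, y.1.1.2), (y.2.1, y.2.2.1, h)), r)
          (((y'.1.1.1, y'.1.2.1, y'.1.1.2), (y'.2.1, y'.2.2.1, h)), r')) ∧
      (∀ (Z : Type) [Fintype Z] (ρ : Mat (Z × (aidedAttack a st).initReg)), ρ.PosSemidef →
        (rest Γ ρ).PosSemidef ∧ (rest Γ ρ).trace.re ≤ ρ.trace.re) := by
  let κ (h : calls.reg p) (y : (aidedAttack a st).initReg × a.initReg) : a.initReg × a.initReg :=
    (((y.1.1.1.1, y.1.1.2.1, y.1.1.1.2), (y.1.2.1, y.1.2.2.1, h)), y.2)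
  let ω : Mat ((aidedAttack a st).initReg × a.initReg) :=
    ∑ h, (purify a.init).submatrix (κ h) (κ h)
  have hω : ω.PosSemidef :=
    Matrix.posSemidef_sum _ fun h _ => (posSemidef_purify a.init).submatrix _
  have hω' : ∀ i j, ω i j = ∑ h, purify a.init (κ h i) (κ h j) := fun i j => by
    simp only [ω, Matrix.sum_apply, Matrix.submatrix_apply]
  have hsum : ∀ y y', ∑ r, ω (y, r) (y', r) = (aidedAttack a st).init y y' := fun y y' => by
    simp only [hω']
    rw [Finset.sum_comm]
    refine Eq.trans ?_ (aidedAttack_init_apply a st y y').symm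
    exact Finset.sum_congr rfl fun h _ => purify_sum_snd a.isDensity_init.1
      ((y.1.1.1, y.1.2.1, y.1.1.2), (y.2.1, y.2.2.1, h))
      ((y'.1.1.1, y'.1.2.1, y'.1.1.2), (y'.2.1, y'.2.2.1, h))
  obtain ⟨Γ, h1, h2, h3⟩ := exists_rest_purify (aidedAttack a st).isDensity_init.1 (ι := Unit)
    (E := fun _ => a.initReg) (fun _ => ω) (fun _ => hω)
    (fun y y' => (Fintype.sum_subsingleton (fun _ : Unit => ∑ r, ω (y, r) (y', r)) ()).trans
      (hsum y y'))
  refine ⟨Γ (), fun y r y' r' => ?_, fun Z _ ρ hρ => ⟨h2 () Z ρ hρ, ?_⟩⟩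
  · rw [h1]
    exact hω' (y, r) (y', r')
  · have := h3 Z ρ hρ
    exact (Fintype.sum_subsingleton (fun i : Unit => (rest (Γ i) ρ).trace.re) ()).symm.trans_le this

/-- Moves the shares of the cheating party in the devices for the calls to its own registers. -/
def regroup (A C O : Type) : (A × C) × O ≃ (A × O) × C where
  toFun b := ((b.1.1, b.2), b.1.2)
  invFun b := ((b.1.1, b.2), b.1.2)

theorem rest_aidedAttack_start {Γ : Mat (aidedAttack a st).initReg →ₗ[ℂ] Mat a.initReg}
    (hΓ : ∀ y r y' r', rest Γ (purify (aidedAttack a st).init) (y, r) (y', r') =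
      ∑ h : calls.reg p, purify a.init (((y.1.1.1, y.1.2.1, y.1.1.2), (y.2.1, y.2.2.1, h)), r)
          (((y'.1.1.1, y'.1.2.1, y'.1.1.2), (y'.2.1, y'.2.2.1, h)), r')) (x : g.In p) :
    rest (rest (rest (rest Γ))) ((aidedAttack a st).start x) =
      toIdeal _ (regroup a.A₀ (calls.reg p.other) (main.reg p.other)) (a.start x) := by
  ext i j
  exact hΓ (((i.1.1, i.1.2, i.2.2.2.1.1), (x, i.2.2.1, i.2.2.2.1.2))) i.2.2.2.2
    (((j.1.1, j.1.2, j.2.2.2.1.1), (x, j.2.2.1, j.2.2.2.1.2))) j.2.2.2.2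

theorem rest_aidedAttack_startIdeal {Γ : Mat (aidedAttack a st).initReg →ₗ[ℂ] Mat a.initReg}
    (hΓ : ∀ y r y' r', rest Γ (purify (aidedAttack a st).init) (y, r) (y', r') =
      ∑ h : calls.reg p, purify a.init (((y.1.1.1, y.1.2.1, y.1.1.2), (y.2.1, y.2.2.1, h)), r)
          (((y'.1.1.1, y'.1.2.1, y'.1.1.2), (y'.2.1, y'.2.2.1, h)), r')) (x : g.In p)
    (e : a.cheatReg ≃ (aidedAttack a st).cheatReg × Unit)
    (he : ∀ b, (e b).1.1 = (b.1, b.2.2) ∧ (e b).1.2.1 = b.2.1) :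
    a.startIdeal x = join e (fun _ y => y) (rest Γ ((aidedAttack a st).startIdeal x)) := by
  have hs : rest Γ ((aidedAttack a st).startIdeal x) =
      trace₂ (Z := main.reg p × (idealDevs f Q.shape).reg p)
        ((rest Γ (purify (aidedAttack a st).init)).submatrix
          (fun j : (aidedAttack a st).cheatReg × (main.reg p × (idealDevs f Q.shape).reg p) ×
            a.initReg => ((j.1, (x, j.2.1)), j.2.2)) (fun j => ((j.1, (x, j.2.1)), j.2.2))) :=
    (trace₂_rest Γ ((purify (aidedAttack a st).init).submatrix
        (fun j : (aidedAttack a st).cheatReg × (main.reg p × (idealDevs f Q.shape).reg p) ×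
          (aidedAttack a st).initReg => ((j.1, (x, j.2.1)), j.2.2))
          (fun j => ((j.1, (x, j.2.1)), j.2.2)))).symm
  rw [hs]
  have := subsingleton_idealDevs_reg f Q.shape p
  ext i j
  have hz : ∀ z : main.reg p × (idealDevs f Q.shape).reg p,
      rest Γ (purify (aidedAttack a st).init) (((e i.1).1, (x, z)), i.2)
        (((e j.1).1, (x, z)), j.2) =
      ∑ h : calls.reg p, purify a.init ((i.1, (x, z.1, h)), i.2) ((j.1, (x, z.1, h)), j.2) :=
    fun z => by
      refine (hΓ ((e i.1).1, (x, z)) i.2 ((e j.1).1, (x, z)) j.2).trans ?_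
      simp only [(he _).1, (he _).2]
  refine Eq.trans ?_ (Finset.sum_congr rfl fun z _ => (hz z).symm)
  rw [Fintype.sum_prod_type]
  refine Eq.trans (Fintype.sum_prod_type fun z : main.reg p × calls.reg p =>
    purify a.init ((i.1, (x, z)), i.2) ((j.1, (x, z)), j.2)) ?_
  exact Finset.sum_congr rfl fun z _ => (Fintype.sum_subsingleton (fun _ => ∑ h : calls.reg p,
    purify a.init ((i.1, (x, z, h)), i.2) ((j.1, (x, z, h)), j.2)) (Classical.arbitrary _)).symm

end Extension

/-- Composition for one value of the security parameter: the errors of the simulators for the calls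
and of the simulator for the oracle-aided protocol add up. -/
theorem exists_aided_attack {ε : ℝ} {T : Set (Device P.ports)}
    (hε : ∀ d ∈ T, ∀ a : Attack P.toProtocol p (P.devices d), ∃ sim : a.Simulator, a.error sim ≤ ε)
    (hcalls : CallDevs.All (r := .run P) T calls)
    (a : Attack (Q.replace P) p (compDevs main calls)) :
    ∃ a' : Attack Q.aided p (aidedDevs main), ∀ sim' : a'.Simulator, ∃ sim : a.Simulator,
      a.error sim ≤ a'.error sim' + Q.shape.numCalls * ε := by
  have htr : ∑ x, (a.start x).trace.re ≤ 1 := by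
    rw [← Complex.re_sum, a.sum_trace_start, Complex.one_re]
  obtain ⟨V', e', st', hhyb⟩ := simulates (P := P) main (Out := g.Out p) hε hcalls a.strategy
    (g.In p) (fun _ => .unit) (Q.prog p) a.initReg a.start a.posSemidef_start htr
    (isProductWith_start a) ((a.A₀.prod (calls.reg p.other)).prod (main.reg p.other))
    (regroup a.A₀ (calls.reg p.other) (main.reg p.other))
  refine ⟨aidedAttack a st', fun sim' => ?_⟩
  have hclose := (aidedAttack a st').close_of_error_le sim' le_rfl
  obtain ⟨Γ, hΓ, hΓpos⟩ := exists_rest_start a st'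
  have := subsingleton_idealDevs_reg f Q.shape p.other
  -- `a.cheatReg` and `(aidedAttack a st').cheatReg` differ by the order of the registers and by a
  -- one-dimensional one. The factor `Unit` is the additional register of `IdealCheat.lift`, which
  -- thereby only transports `sim'` along `e` and `eV`.
  let e : a.cheatReg ≃ (aidedAttack a st').cheatReg × Unit :=
    { toFun := fun b => (((b.1, b.2.2), b.2.1, Classical.arbitrary _), ())
      invFun := fun b => (b.1.1.1, b.1.2.1, b.1.1.2)
      left_inv := fun b => rfl
      right_inv := fun b => Prod.ext (Prod.ext rfl (Prod.ext rfl (this.elim _ _))) rfl }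
  let eV : a.V ≃ V' × Unit := e'.symm.trans (Equiv.prodUnique _ _).symm
  have h1 : Close (ι := g.In p × Option (g.Out p)) (X := fun _ => V' × a.initReg)
      (fun k => runIdeal g k.1 sim' (rest Γ ((aidedAttack a st').startIdeal k.1)) k.2)
      (fun k => runProg (W := .unit) main .ideal p (Q.prog p k.1) st'
        (toIdeal _ (regroup a.A₀ (calls.reg p.other) (main.reg p.other)) (a.start k.1)) k.2)
      ((aidedAttack a st').error sim') := by
    refine (hclose.map (κ := g.In p × Option (g.Out p)) (Y := fun _ => V' × a.initReg)
      (fun τ k => rest Γ (τ (k.2, k.1))) (fun τ τ' k => map_add _ _ _)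
      (fun τ hτ k => (hΓpos _ _ (hτ _)).1) (fun τ hτ => ?_)).congr (fun k => ?_) (fun k => ?_)
    · exact (Finset.sum_le_sum fun k _ => (hΓpos _ _ (hτ (k.2, k.1))).2).trans_eq
        ((Equiv.prodComm _ _).sum_comp fun k => (τ k).trace.re)
    · exact runIdeal_rest g Γ k.1 sim' ((aidedAttack a st').startIdeal k.1) k.2
    · refine (congrArg (fun τ => runProg (A := (a.A₀.prod (calls.reg p.other)).prod
        (main.reg p.other)) (W := .unit) main .ideal p (Q.prog p k.1) st' τ k.2)
        (rest_aidedAttack_start a st' hΓ k.1).symm).trans ?_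
      exact runProg_rest (W := .unit) main .ideal p Γ (Q.prog p k.1) st'
        ((aidedAttack a st').start k.1) k.2
  refine ⟨IdealCheat.lift (C := .unit) sim' e eV, a.error_le_of_close _ ?_⟩
  refine ((h1.trans hhyb).map (κ := Option (g.Out p) × g.In p) (Y := fun _ => a.V × a.initReg)
    (fun τ k => join eV (fun _ y => y) (τ (k.2, k.1))) (fun τ τ' k => rfl)
    (fun τ hτ k => (hτ (k.2, k.1)).submatrix _) (fun τ hτ => le_of_eq ?_)).congr
    (fun k => ?_) (fun k => ?_)
  · have h2 : ∀ ρ : Mat (V' × a.initReg), (join eV (fun _ y => y) ρ).trace = ρ.trace := fun ρ =>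
      (Equiv.prodCongr e'.symm (Equiv.refl _)).sum_comp fun j => ρ j j
    simp only [h2]
    exact (Equiv.prodComm _ _).sum_comp fun k => (τ k).trace.re
  · rw [rest_aidedAttack_startIdeal a st' hΓ k.2 e fun _ => ⟨rfl, rfl⟩]
    exact runIdeal_lift_join (C := .unit) k.2 sim' e eV (fun _ y => y)
      (rest Γ ((aidedAttack a st').startIdeal k.2)) k.1
  · ext i j
    simp [join_apply, eV]
    rfl

end Composition

end QComp

theorem mainTheorem3 (f g : ℕ → QComp.Functionality)
    (Pgf : (n : ℕ) → QComp.OracleProtocol (f n) (g n))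
    (Pf : (n : ℕ) → QComp.PlainProtocol (f n))
    (hcalls : ∃ q : Polynomial ℕ, ∀ n, (Pgf n).shape.numCalls ≤ q.eval n)
    (𝔇g : (n : ℕ) → Set (QComp.Device (Pgf n).ports))
    (𝔇f : (n : ℕ) → Set (QComp.Device (Pf n).ports))
    (h𝔇f : ∀ n, (𝔇f n).Nonempty)
    (hgf : QComp.AugmentedSecure (fun n => (Pgf n).aided)
      (fun n => (Pgf n).aided.deviceClass (𝔇g n) Set.univ))
    (hf : QComp.AugmentedSecure (fun n => (Pf n).toProtocol)
      (fun n => (Pf n).toProtocol.deviceClass (𝔇f n) Set.univ)) :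
    QComp.AugmentedSecure (fun n => (Pgf n).replace (Pf n))
      (fun n => ((Pgf n).replace (Pf n)).deviceClass (𝔇g n) (𝔇f n)) := by
  intro p D hD a
  obtain ⟨q, hq⟩ := hcalls
  -- `ν n` bounds the error of one call, for every device of the class and every attack.
  obtain ⟨ν, hν, hν0, hsim⟩ := hf.exists_uniform p fun n => by
    obtain ⟨d, hd⟩ := h𝔇f n
    exact ⟨(Pf n).devices d, ⟨hd, QComp.CallDevs.all_univ _⟩, (Pf n).nonempty_attack p _⟩
  choose a' ha' using fun n => QComp.exists_aided_attack (Q := Pgf n) (P := Pf n) (p := p)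
    (main := (D n).main) (calls := (D n).calls) (T := 𝔇f n)
    (fun d hd a => hsim n _ ⟨hd, QComp.CallDevs.all_univ _⟩ a) (hD n).2 (a n)
  obtain ⟨sim', μ, hμ, hle'⟩ := hgf p (fun n => QComp.aidedDevs (D n).main)
    (fun n => ⟨(hD n).1, QComp.CallDevs.all_univ _⟩) a'
  choose sim hle using fun n => ha' n (sim' n)
  refine ⟨sim, fun n => μ n + q.eval n * ν n, ?_, fun n => (hle n).trans (add_le_add (hle' n) ?_)⟩
  · refine hμ.add ((hν.polynomial_mul (q.map (Nat.castRingHom ℝ))).congr fun n => ?_)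
    simp
  · exact mul_le_mul_of_nonneg_right (by exact_mod_cast hq n) (hν0 n)
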